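/- Nets are indexed by $\varepsilon\in(0,1]$, and all $O$-estimates are as $\varepsilon\to0$. Let $\widetilde{\mathbb C}$ (resp. $\widetilde{\mathbb R}$) be the ring of complex (resp. real) generalized numbers: nets of scalars that are $O(\varepsilon^{-N})$ for some $N\in\mathbb N$, modulo nets that are $O(\varepsilon^q)$ for all $q\in\mathbb N$. For $\Omega\subseteq\mathbb R^n$ open, $K\Subset\Omega$ and $j\in\mathbb N$ put $p_{K,j}(f)=\sup_{x\in K,|\alpha|\le j}|\partial^\alpha f(x)|$. Let $\mathcal E_M(\Omega)$ be the set of nets $(u_\varepsilon)_\varepsilon$ in $C^\infty(\Omega)$ such that for all $K\Subset\Omega$ and all $j$ there is $N$ with $p_{K,j}(u_\varepsilon)=O(\varepsilon^{-N})$; let $\mathcal E_M^\infty(\Omega)$ be the set of those for which, for every $K$, one $N$ can be chosen independently of $j$; and let $\mathcal N(\Omega)$ be the set of those with $p_{K,j}(u_\varepsilon)=O(\varepsilon^q)$ for all $K$, $j$, $q$. Then $\mathcal G(\Omega)=\mathcal E_M(\Omega)/\mathcal N(\Omega)$ and $\mathcal G^\infty(\Omega)=\mathcal E_M^\infty(\Omega)/\mathcal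 N(\Omega)$, and $\mathcal G_c(\Omega)$ is the $\widetilde{\mathbb C}$-module of generalized functions with compact support in $\Omega$, i.e. of the classes of nets in $\mathcal E_M(\Omega)$ whose supports lie in one compact subset of $\Omega$; below, representatives $(u_\varepsilon)_\varepsilon$ of $u\in\mathcal G_c(\Omega)$ are taken of this kind. Let $\mathcal L(\mathcal G_c(\Omega),\widetilde{\mathbb C})$ be the space of continuous $\widetilde{\mathbb C}$-linear functionals on $\mathcal G_c(\Omega)$. Here $T$ is continuous if for every $K\Subset\Omega$ there are $j\in\mathbb N$ and $c\in\mathbb R$ with $\mathrm{val}_{K,j}(u)\le \mathrm{val}(Tu)+c$ for all $u$ with a representative supported in $K$, where $\mathrm{val}_{K,j}(u)=\sup\{b\in\mathbb R: p_{K,j}(u_\varepsilon)=O(\varepsilon^b)\}$ and $\mathrm{val}([(z_\varepsilon)])=\sup\{b\in\mathbb R: |z_\varepsilon|=O(\varepsilon^b)\}$. Such a functional $T$ is *basic* if there are distributions $T_\varepsilon\in\mathcal D'(\Omega)$ such that $Tu=[(T_\varepsilon u_\varepsilon)_\varepsilon]$ for all $u\in\mathcal G_c(\Omega)$, and for every $K\Subset\Omega$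 there are $j,N\in\mathbb N$, $c>0$, $\eta\in(0,1]$ with $|T_\varepsilon f|\le c\,\varepsilon^{-N}p_{K,j}(f)$ for all $f\in C^\infty$ supported in $K$ and all $\varepsilon\in(0,\eta]$. The restriction $T|_V$ to an open $V\subseteq\Omega$ is obtained by applying $T$ to extensions by zero. The spaces $\mathcal G^\infty(\Omega)\subseteq\mathcal G(\Omega)$ are regarded as subspaces of $\mathcal L(\mathcal G_c(\Omega),\widetilde{\mathbb C})$ through $g\mapsto\bigl(u\mapsto[(\int_\Omega g_\varepsilon u_\varepsilon\,dx)_\varepsilon]\bigr)$. For $\mathcal R\in\{\mathcal G,\mathcal G^\infty\}$ the set $\mathrm{sing\,supp}_{\mathcal R}\,T$ consists of the points $x\in\Omega$ that have no open neighbourhood $V\subseteq\Omega$ with $T|_V\in\mathcal R(V)$. Let $\iota_d(\delta)(u)=[(u_\varepsilon(0))_\varepsilon]$ for $u\in\mathcal G_c(\mathbb R^n)$. Let $P(\xi)=\sum_{|\alpha|\le m}c_\alpha\xi^\alpha$ be a polynomial with coefficients $c_\alpha\in\widetilde{\mathbb C}$, let $P(D)=\sum_{|\alpha|\le m} c_\alpha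 D^\alpha$ with $D_k=-i\partial_k$ and $(\partial_kT)(u)=-T(\partial_ku)$, and let $\widetilde P:\mathbb R^n\to\widetilde{\mathbb R}$ be given by $\widetilde P^2(\xi)=\sum_{|\alpha|\le m}|\partial^\alpha P(\xi)|^2$. For $\mathcal R\in\{\mathcal G,\mathcal G^\infty\}$, $P(D)$ is *$\mathcal R$-hypoelliptic* if $\mathrm{sing\,supp}_{\mathcal R}P(D)T=\mathrm{sing\,supp}_{\mathcal R}T$ for all open $\Omega\subseteq\mathbb R^n$ and all basic $T\in\mathcal L(\mathcal G_c(\Omega),\widetilde{\mathbb C})$. A *fundamental solution* of $P(D)$ is an $E\in\mathcal L(\mathcal G_c(\mathbb R^n),\widetilde{\mathbb C})$ with $P(D)E=\iota_d(\delta)$; an *$\mathcal R$-parametrix* is a basic $F\in\mathcal L(\mathcal G_c(\mathbb R^n),\widetilde{\mathbb C})$ with $P(D)F-\iota_d(\delta)\in\mathcal R(\mathbb R^n)$. **Theorem.** Assume that $\widetilde P(\xi_0)$ is invertible in $\widetilde{\mathbb R}$ for some $\xi_0\in\mathbb R^n$. Then the following are equivalent: (i) $P(D)$ is $\mathcal G$-hypoelliptic;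 (ii) $P(D)$ has a basic fundamental solution $E$ with $\mathrm{sing\,supp}_{\mathcal G}E\subseteq\{0\}$; (iii) $P(D)$ has a $\mathcal G$-parametrix $F$ with $\mathrm{sing\,supp}_{\mathcal G}F\subseteq\{0\}$. The same equivalence holds with $\mathcal G^\infty$ in place of $\mathcal G$ throughout (in hypoellipticity, singular supports and parametrix). -/

import Mathlib

open scoped Distributions ContDiff Topology
open TopologicalSpace Filter Asymptotics

noncomputable section

namespace Colombeau

/-! ### Nets, moderateness, negligibility -/

/-- The index set `(0, 1]` of all nets. -/
abbrev Idx : Type := Set.Ioc (0 : ℝ) 1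

/-- The filter "`ε → 0`" on `(0, 1]`. -/
def atZero : Filter Idx := comap Subtype.val (𝓝 (0 : ℝ))

/-- `u_ε = O(ε^{-N})` as `ε → 0`, for some natural number `N`. -/
def IsModerate {F : Type*} [NormedAddCommGroup F] (u : Idx → F) : Prop :=
  ∃ N : ℕ, u =O[atZero] fun ε => ((ε : ℝ)⁻¹) ^ N

/-- `u_ε = O(ε^q)` as `ε → 0`, for all natural numbers `q`. -/
def IsNegligible {F : Type*} [NormedAddCommGroup F] (u : Idx → F) : Prop :=
  ∀ q : ℕ, u =O[atZero] fun ε => (ε : ℝ) ^ q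

section NetLemmas

variable {F G : Type*} [NormedAddCommGroup F] [NormedAddCommGroup G]

theorem isBigO_inv_pow {M N : ℕ} (h : M ≤ N) :
    (fun ε : Idx => ((ε : ℝ)⁻¹) ^ M) =O[atZero] fun ε => ((ε : ℝ)⁻¹) ^ N := by
  refine IsBigO.of_bound 1 (Eventually.of_forall fun ε => ?_)
  have h0 : (0 : ℝ) < ε := ε.2.1
  have h1 : (1 : ℝ) ≤ (ε : ℝ)⁻¹ := (one_le_inv₀ h0).2 ε.2.2
  rw [one_mul, Real.norm_of_nonneg (by positivity), Real.norm_of_nonneg (by positivity)]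
  exact pow_le_pow_right₀ h1 h

theorem IsModerate.add {u v : Idx → F} (hu : IsModerate u) (hv : IsModerate v) :
    IsModerate (fun ε => u ε + v ε) := by
  obtain ⟨M, hM⟩ := hu
  obtain ⟨N, hN⟩ := hv
  exact ⟨max M N, (hM.trans (isBigO_inv_pow (le_max_left _ _))).add
    (hN.trans (isBigO_inv_pow (le_max_right _ _)))⟩

theorem IsModerate.of_le {u : Idx → F} {v : Idx → G} (hv : IsModerate v)
    (h : ∀ ε, ‖u ε‖ ≤ ‖v ε‖) : IsModerate u := by
  obtain ⟨N, hN⟩ := hv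
  exact ⟨N, (IsBigO.of_norm_le (g := fun ε => ‖v ε‖) h).trans hN.norm_left⟩

theorem IsModerate.mul {R : Type*} [NormedRing R] {u v : Idx → R}
    (hu : IsModerate u) (hv : IsModerate v) : IsModerate (fun ε => u ε * v ε) := by
  obtain ⟨M, hM⟩ := hu
  obtain ⟨N, hN⟩ := hv
  refine ⟨M + N, ?_⟩
  simpa only [pow_add] using hM.mul hN

theorem isModerate_const (c : F) : IsModerate (fun _ : Idx => c) := by
  refine ⟨0, ?_⟩
  simpa using isBigO_const_const c (one_ne_zero (α := ℝ)) atZero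

theorem isNegligible_zero : IsNegligible (fun _ : Idx => (0 : F)) :=
  fun _ => isBigO_zero _ _

theorem IsNegligible.add {u v : Idx → F} (hu : IsNegligible u) (hv : IsNegligible v) :
    IsNegligible (fun ε => u ε + v ε) :=
  fun q => (hu q).add (hv q)

theorem IsNegligible.of_le {u : Idx → F} {v : Idx → G} (hv : IsNegligible v)
    (h : ∀ ε, ‖u ε‖ ≤ ‖v ε‖) : IsNegligible u :=
  fun q => (IsBigO.of_norm_le (g := fun ε => ‖v ε‖) h).trans (hv q).norm_left

theorem IsModerate.mul_isNegligible {R : Type*} [NormedRing R] {u v : Idx → R}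
    (hu : IsModerate u) (hv : IsNegligible v) : IsNegligible (fun ε => u ε * v ε) := by
  obtain ⟨M, hM⟩ := hu
  intro q
  refine (hM.mul (hv (q + M))).trans (IsBigO.of_bound 1 (Eventually.of_forall fun ε => ?_))
  have h0 : (0 : ℝ) < ε := ε.2.1
  rw [one_mul, pow_add, inv_pow, mul_comm, mul_assoc, mul_inv_cancel₀ (by positivity), mul_one]

end NetLemmas

/-! ### Generalized numbers -/

/-- The ring of moderate nets of scalars. -/
def moderateNets (𝕜 : Type) [RCLike 𝕜] : Subring (Idx → 𝕜) where
  carrier := {r | IsModerate r}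
  mul_mem' hu hv := hu.mul hv
  one_mem' := isModerate_const 1
  add_mem' hu hv := hu.add hv
  zero_mem' := isModerate_const 0
  neg_mem' hu := IsModerate.of_le hu fun ε => by simp

/-- The ideal of negligible nets of scalars. -/
def negligibleNets (𝕜 : Type) [RCLike 𝕜] : Ideal (moderateNets 𝕜) where
  carrier := {r | IsNegligible (r : Idx → 𝕜)}
  zero_mem' := isNegligible_zero
  add_mem' hu hv := hu.add hv
  smul_mem' c _ hu := IsModerate.mul_isNegligible c.2 hu

/-- The ring of generalized numbers over `𝕜`. -/
def GenNum (𝕜 : Type) [RCLike 𝕜] : Type := moderateNets 𝕜 ⧸ negligibleNets 𝕜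

instance (𝕜 : Type) [RCLike 𝕜] : CommRing (GenNum 𝕜) :=
  inferInstanceAs (CommRing (moderateNets 𝕜 ⧸ negligibleNets 𝕜))

/-- The class of a moderate net. -/
def GenNum.mk {𝕜 : Type} [RCLike 𝕜] : moderateNets 𝕜 →+* GenNum 𝕜 :=
  Ideal.Quotient.mk (negligibleNets 𝕜)

/-- The class of a constant net. -/
def GenNum.const {𝕜 : Type} [RCLike 𝕜] (c : 𝕜) : GenNum 𝕜 :=
  GenNum.mk ⟨fun _ => c, isModerate_const c⟩

/-- The ring of complex generalized numbers. -/
abbrev GenC : Type := GenNum ℂ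

/-- The ring of real generalized numbers. -/
abbrev GenR : Type := GenNum ℝ

/-- The net `r` is moderate, and its class is `z`. -/
def Represents {𝕜 : Type} [RCLike 𝕜] (r : Idx → 𝕜) (z : GenNum 𝕜) : Prop :=
  ∃ h : r ∈ moderateNets 𝕜, GenNum.mk ⟨r, h⟩ = z

/-- The valuation of a net of reals: the supremum of all `b` with `r_ε = O(ε^b)`. -/
def netVal (r : Idx → ℝ) : EReal :=
  sSup {b : EReal | ∃ a : ℝ, b = a ∧ r =O[atZero] fun ε => (ε : ℝ) ^ a}

/-- The valuation of a generalized number (the supremum does not depend on the representative). -/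
def GenNum.val {𝕜 : Type} [RCLike 𝕜] (z : GenNum 𝕜) : EReal :=
  sSup {b : EReal | ∃ r : Idx → 𝕜, Represents r z ∧ b = netVal (fun ε => ‖r ε‖)}

/-- The absolute value `|[(z_ε)]| = [(|z_ε|)]`. -/
def GenNum.abs : GenC → GenR :=
  Quotient.map' (s₁ := Submodule.quotientRel _) (s₂ := Submodule.quotientRel _)
    (fun z : moderateNets ℂ => (⟨fun ε => ‖z.1 ε‖, z.2.of_le fun ε => by simp⟩ : moderateNets ℝ))
    (by
      intro z w h
      rw [Submodule.quotientRel_def] at h ⊢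
      exact IsNegligible.of_le (v := fun ε => z.1 ε - w.1 ε) h
        fun ε => abs_norm_sub_norm_le (z.1 ε) (w.1 ε))

theorem abs_sqrt_sub_sqrt_le (a b : ℝ) : |√a - √b| ≤ √|a - b| := by
  have key : ∀ x y : ℝ, √x - √y ≤ √|x - y| := by
    intro x y
    have h1 : √x ≤ √(|x - y| + max y 0) :=
      Real.sqrt_le_sqrt (by have := le_abs_self (x - y); have := le_max_left y 0; linarith)
    have h2 : √(|x - y| + max y 0) ≤ √|x - y| + √(max y 0) :=
      Real.sqrt_le_iff.2 ⟨by positivity, by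
        have e1 := Real.sq_sqrt (abs_nonneg (x - y))
        have e2 := Real.sq_sqrt (le_max_right y 0)
        nlinarith [mul_nonneg (Real.sqrt_nonneg |x - y|) (Real.sqrt_nonneg (max y 0))]⟩
    have h3 : √(max y 0) = √y := by
      rcases le_total y 0 with h | h
      · rw [max_eq_right h, Real.sqrt_zero, Real.sqrt_eq_zero_of_nonpos h]
      · rw [max_eq_left h]
    linarith
  rw [abs_le]
  have := key b a
  rw [abs_sub_comm] at this
  constructor <;> linarith [key a b]

theorem IsNegligible.sqrt_abs {r : Idx → ℝ} (h : IsNegligible r) :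
    IsNegligible (fun ε => √|r ε|) := by
  intro q
  obtain ⟨C, hC⟩ := (h (q + q)).bound
  refine IsBigO.of_bound (√C) (hC.mono fun ε hε => ?_)
  have h0 : (0 : ℝ) < ε := ε.2.1
  rw [Real.norm_of_nonneg (Real.sqrt_nonneg _), Real.norm_of_nonneg (by positivity)]
  rw [Real.norm_eq_abs, Real.norm_of_nonneg (by positivity)] at hε
  calc √|r ε| ≤ √(C * (ε : ℝ) ^ (q + q)) := Real.sqrt_le_sqrt hε
    _ = √C * (ε : ℝ) ^ q := by
      rw [Real.sqrt_mul' _ (by positivity), pow_add, Real.sqrt_mul_self (by positivity)]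

/-- The square root `√[(r_ε)] = [(√r_ε)]`, used for positive generalized numbers. -/
def GenNum.sqrt : GenR → GenR :=
  Quotient.map' (s₁ := Submodule.quotientRel _) (s₂ := Submodule.quotientRel _)
    (fun r : moderateNets ℝ => (⟨fun ε => √(r.1 ε),
      ((isModerate_const (1 : ℝ)).add (r.2.of_le (u := fun ε => |r.1 ε|) fun ε => by simp)).of_le
        fun ε => by
          have h := Real.sqrt_nonneg (r.1 ε)
          have h1 := abs_nonneg (r.1 ε)
          rw [Real.norm_of_nonneg h, Real.norm_of_nonneg (by linarith), Real.sqrt_le_left (by linarith)]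
          nlinarith [le_abs_self (r.1 ε)]⟩ : moderateNets ℝ))
    (by
      intro z w h
      rw [Submodule.quotientRel_def] at h ⊢
      refine IsNegligible.of_le (IsNegligible.sqrt_abs h) fun ε => ?_
      rw [Real.norm_of_nonneg (Real.sqrt_nonneg _)]
      exact abs_sqrt_sub_sqrt_le _ _)

/-! ### Colombeau generalized functions -/

variable {n : ℕ}

/-- The Euclidean space `ℝⁿ`. -/
abbrev Eu (n : ℕ) : Type := EuclideanSpace ℝ (Fin n)

/-- The seminorm `p_{K,j}(f)`, the supremum over `x ∈ K` of the derivatives of `f` of order at most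
`j`. The size of the derivatives of order `i` is measured by the norm of the `i`-th Fréchet
derivative, which equals `max_{|α| = i} |∂^α f(x)|` up to factors that depend only on `n`, `i`. -/
def supNorm (K : Set (Eu n)) (j : ℕ) (f : Eu n → ℂ) : ℝ :=
  ⨆ p : K × Fin (j + 1), ‖iteratedFDeriv ℝ (p.2 : ℕ) f p.1‖

/-- `𝓔_M(Ω)`: the moderate nets of smooth functions on `Ω`
(values outside of `Ω` are irrelevant). -/
def EM (Ω : Opens (Eu n)) : Set (Idx → Eu n → ℂ) :=
  {u | (∀ ε, ContDiffOn ℝ ∞ (u ε) Ω) ∧ ∀ K : Set (Eu n), IsCompact K → K ⊆ Ω →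
    ∀ j : ℕ, ∃ N : ℕ, (fun ε => supNorm K j (u ε)) =O[atZero] fun ε => ((ε : ℝ)⁻¹) ^ N}

/-- `𝓔_M^∞(Ω)`: the regular nets of smooth functions on `Ω`; on every compact set a single power
of `ε` bounds the derivatives of all orders. -/
def EMinf (Ω : Opens (Eu n)) : Set (Idx → Eu n → ℂ) :=
  {u | (∀ ε, ContDiffOn ℝ ∞ (u ε) Ω) ∧ ∀ K : Set (Eu n), IsCompact K → K ⊆ Ω →
    ∃ N : ℕ, ∀ j : ℕ, (fun ε => supNorm K j (u ε)) =O[atZero] fun ε => ((ε : ℝ)⁻¹) ^ N}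

/-- `𝓝(Ω)`: the negligible nets of smooth functions on `Ω`. -/
def EN (Ω : Opens (Eu n)) : Set (Idx → Eu n → ℂ) :=
  {u | (∀ ε, ContDiffOn ℝ ∞ (u ε) Ω) ∧ ∀ K : Set (Eu n), IsCompact K → K ⊆ Ω →
    ∀ j q : ℕ, (fun ε => supNorm K j (u ε)) =O[atZero] fun ε => (ε : ℝ) ^ q}

section SupNormLemmas

variable {Ω V : Opens (Eu n)} {K : Set (Eu n)} {j : ℕ}

theorem supNorm_nonneg (f : Eu n → ℂ) : 0 ≤ supNorm K j f :=
  Real.iSup_nonneg fun _ => norm_nonneg _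

theorem supNorm_le {f : Eu n → ℂ} {C : ℝ} (hC : 0 ≤ C)
    (h : ∀ x ∈ K, ∀ i ≤ j, ‖iteratedFDeriv ℝ i f x‖ ≤ C) : supNorm K j f ≤ C :=
  Real.iSup_le (fun p => h p.1 p.1.2 p.2 (Nat.lt_succ_iff.1 p.2.2)) hC

theorem le_supNorm (hK : IsCompact K) {f : Eu n → ℂ} (hf : ContDiff ℝ ∞ f) {x : Eu n}
    (hx : x ∈ K) {i : ℕ} (hi : i ≤ j) : ‖iteratedFDeriv ℝ i f x‖ ≤ supNorm K j f := by
  have hb : ∀ i : ℕ, ∃ C, ∀ y ∈ K, ‖iteratedFDeriv ℝ i f y‖ ≤ C := fun i =>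
    hK.exists_bound_of_continuousOn
      (hf.continuous_iteratedFDeriv (m := i) (mod_cast le_top)).continuousOn
  choose C hC using hb
  refine le_ciSup (f := fun p : K × Fin (j + 1) => ‖iteratedFDeriv ℝ (p.2 : ℕ) f p.1‖)
    ⟨∑ i : Fin (j + 1), |C i|, ?_⟩ (⟨x, hx⟩, ⟨i, Nat.lt_succ_iff.2 hi⟩)
  rintro _ ⟨p, rfl⟩
  exact ((hC _ _ p.1.2).trans (le_abs_self _)).trans
    (Finset.single_le_sum (f := fun i : Fin (j + 1) => |C i|) (fun _ _ => abs_nonneg _)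
      (Finset.mem_univ p.2))

theorem contDiff_test (f : 𝓓(Ω, ℂ)) : ContDiff ℝ ∞ f := f.contDiff

theorem supNorm_add_le (hK : IsCompact K) (f g : 𝓓(Ω, ℂ)) :
    supNorm K j (f + g : 𝓓(Ω, ℂ)) ≤ supNorm K j f + supNorm K j g := by
  refine supNorm_le (add_nonneg (supNorm_nonneg _) (supNorm_nonneg _)) fun x hx i hi => ?_
  rw [FunLike.coe_add, iteratedFDeriv_add_apply
    ((contDiff_test f).of_le (mod_cast le_top)).contDiffAt
    ((contDiff_test g).of_le (mod_cast le_top)).contDiffAt]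
  exact (norm_add_le _ _).trans
    (add_le_add (le_supNorm hK (contDiff_test f) hx hi) (le_supNorm hK (contDiff_test g) hx hi))

theorem supNorm_smul_le (hK : IsCompact K) (c : ℂ) (f : 𝓓(Ω, ℂ)) :
    supNorm K j (c • f : 𝓓(Ω, ℂ)) ≤ ‖c‖ * supNorm K j f := by
  refine supNorm_le (mul_nonneg (norm_nonneg _) (supNorm_nonneg _)) fun x hx i hi => ?_
  rw [FunLike.coe_smul, iteratedFDeriv_const_smul_apply
    ((contDiff_test f).of_le (mod_cast le_top)).contDiffAt, norm_smul]
  exact mul_le_mul_of_nonneg_left (le_supNorm hK (contDiff_test f) hx hi) (norm_nonneg _)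

theorem supNorm_zero : supNorm K j (0 : 𝓓(Ω, ℂ)) = 0 := by
  refine le_antisymm (supNorm_le le_rfl fun x _ i _ => ?_) (supNorm_nonneg _)
  rw [FunLike.coe_zero, Pi.zero_def, iteratedFDeriv_fun_zero]
  simp

theorem supNorm_le_of_tsupport {L : Set (Eu n)} (hL : IsCompact L) {f : Eu n → ℂ}
    (hf : ContDiff ℝ ∞ f) (h : tsupport f ⊆ L) : supNorm K j f ≤ supNorm L j f := by
  refine supNorm_le (supNorm_nonneg _) fun x _ i hi => ?_
  by_cases hx : x ∈ L
  · exact le_supNorm hL hf hx hi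
  · have : iteratedFDeriv ℝ i f x = 0 := by
      by_contra h0
      exact hx (h (support_iteratedFDeriv_subset i h0))
    rw [this, norm_zero]
    exact supNorm_nonneg _

/-- The partial derivative `∂_k f` of a test function. -/
def testPartial (Ω : Opens (Eu n)) (k : Fin n) : 𝓓(Ω, ℂ) →L[ℂ] 𝓓(Ω, ℂ) :=
  TestFunction.lineDerivCLM ℂ (EuclideanSpace.single k (1 : ℝ))

theorem coe_testPartial (k : Fin n) (f : 𝓓(Ω, ℂ)) :
    (testPartial Ω k f : Eu n → ℂ) =
      fun x => fderiv ℝ f x (EuclideanSpace.single k (1 : ℝ)) := by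
  funext x
  rw [testPartial, TestFunction.lineDerivCLM_apply_of_le (by simp)]
  exact ((contDiff_test f).differentiable (by simp)).differentiableAt.lineDeriv_eq_fderiv

theorem tsupport_testPartial (k : Fin n) (f : 𝓓(Ω, ℂ)) :
    tsupport (testPartial Ω k f) ⊆ tsupport f := by
  rw [coe_testPartial]
  exact tsupport_fderiv_apply_subset ℝ _

theorem supNorm_testPartial_le (hK : IsCompact K) (k : Fin n) (f : 𝓓(Ω, ℂ)) :
    supNorm K j (testPartial Ω k f) ≤ supNorm K (j + 1) f := by
  refine supNorm_le (supNorm_nonneg _) fun x hx i hi => ?_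
  rw [coe_testPartial]
  have hf : ContDiff ℝ ∞ (fderiv ℝ f) := (contDiff_test f).fderiv_right (by simp)
  have h := norm_iteratedFDeriv_clm_apply_const (𝕜 := ℝ) (c := EuclideanSpace.single k (1 : ℝ))
    (n := i) (N := ∞) (x := x) hf.contDiffAt (mod_cast le_top)
  refine h.trans ?_
  rw [show ‖EuclideanSpace.single k (1 : ℝ)‖ = 1 by simp, one_mul, norm_iteratedFDeriv_fderiv]
  exact le_supNorm hK (contDiff_test f) hx (by omega)

/-- Extension by zero of test functions from `V` to a larger open set. -/
def testExtend (h : V ≤ Ω) : 𝓓(V, ℂ) →ₗ[ℂ] 𝓓(Ω, ℂ) where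
  toFun f := ⟨f, f.contDiff, f.hasCompactSupport, f.tsupport_subset.trans h⟩
  map_add' _ _ := rfl
  map_smul' _ _ := rfl

end SupNormLemmas

/-- `𝓔_{c,M}(Ω)`: the moderate nets of smooth functions whose supports lie in one compact subset
of `Ω`. -/
def EcM (Ω : Opens (Eu n)) : Submodule (moderateNets ℂ) (Idx → 𝓓(Ω, ℂ)) where
  carrier := {u | (∃ K : Set (Eu n), IsCompact K ∧ K ⊆ Ω ∧ ∀ ε, tsupport (u ε) ⊆ K) ∧
    (fun ε => (u ε : Eu n → ℂ)) ∈ EM Ω}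
  zero_mem' := by
    refine ⟨⟨∅, isCompact_empty, Set.empty_subset _, fun ε => ?_⟩,
      fun ε => (contDiff_test _).contDiffOn, fun K _ _ j => ⟨0, ?_⟩⟩
    · change tsupport (⇑(0 : 𝓓(Ω, ℂ))) ⊆ ∅
      rw [FunLike.coe_zero, tsupport_zero]
    · change (fun ε => supNorm K j (0 : 𝓓(Ω, ℂ))) =O[atZero] _
      simp only [supNorm_zero]
      exact isBigO_zero _ _
  add_mem' := by
    rintro u v ⟨⟨K, hK, hKΩ, hu⟩, -, hu'⟩ ⟨⟨L, hL, hLΩ, hv⟩, -, hv'⟩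
    refine ⟨⟨K ∪ L, hK.union hL, Set.union_subset hKΩ hLΩ, fun ε => ?_⟩,
      fun ε => (contDiff_test _).contDiffOn, fun K' hK' hKΩ' j => ?_⟩
    · exact (tsupport_add _ _).trans (Set.union_subset_union (hu ε) (hv ε))
    · refine IsModerate.of_le (IsModerate.add (hu' K' hK' hKΩ' j) (hv' K' hK' hKΩ' j)) fun ε => ?_
      rw [Real.norm_of_nonneg (supNorm_nonneg _),
        Real.norm_of_nonneg (add_nonneg (supNorm_nonneg _) (supNorm_nonneg _))]
      exact supNorm_add_le hK' (u ε) (v ε)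
  smul_mem' := by
    rintro c u ⟨⟨K, hK, hKΩ, hu⟩, -, hu'⟩
    refine ⟨⟨K, hK, hKΩ, fun ε => ?_⟩,
      fun ε => (contDiff_test _).contDiffOn, fun K' hK' hKΩ' j => ?_⟩
    · exact (tsupport_smul_subset_right (fun _ => c.1 ε) (u ε : Eu n → ℂ)).trans (hu ε)
    · refine IsModerate.of_le (IsModerate.mul (u := fun ε => ‖c.1 ε‖)
        (IsModerate.of_le (v := c.1) c.2 fun ε => by simp) (hu' K' hK' hKΩ' j)) fun ε => ?_
      rw [Real.norm_of_nonneg (supNorm_nonneg _),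
        Real.norm_of_nonneg (mul_nonneg (norm_nonneg _) (supNorm_nonneg _))]
      exact supNorm_smul_le hK' (c.1 ε) (u ε)

/-- `𝓝_c(Ω)`: the negligible nets in `𝓔_{c,M}(Ω)`. -/
def Nc (Ω : Opens (Eu n)) : Submodule (moderateNets ℂ) (EcM Ω) where
  carrier := {u | (fun ε => (u.1 ε : Eu n → ℂ)) ∈ EN Ω}
  zero_mem' := by
    refine ⟨fun ε => (contDiff_test _).contDiffOn, fun K _ _ j q => ?_⟩
    change (fun ε => supNorm K j (0 : 𝓓(Ω, ℂ))) =O[atZero] _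
    simp only [supNorm_zero]
    exact isBigO_zero _ _
  add_mem' := by
    rintro u v ⟨-, hu⟩ ⟨-, hv⟩
    refine ⟨fun ε => (contDiff_test _).contDiffOn, fun K hK hKΩ j => ?_⟩
    refine IsNegligible.of_le (IsNegligible.add (hu K hK hKΩ j) (hv K hK hKΩ j)) fun ε => ?_
    rw [Real.norm_of_nonneg (supNorm_nonneg _),
      Real.norm_of_nonneg (add_nonneg (supNorm_nonneg _) (supNorm_nonneg _))]
    exact supNorm_add_le hK (u.1 ε) (v.1 ε)
  smul_mem' := by
    rintro c u ⟨-, hu⟩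
    refine ⟨fun ε => (contDiff_test _).contDiffOn, fun K hK hKΩ j => ?_⟩
    refine IsNegligible.of_le (IsModerate.mul_isNegligible (u := fun ε => ‖c.1 ε‖)
        (IsModerate.of_le (v := c.1) c.2 fun ε => by simp) (hu K hK hKΩ j)) fun ε => ?_
    rw [Real.norm_of_nonneg (supNorm_nonneg _),
      Real.norm_of_nonneg (mul_nonneg (norm_nonneg _) (supNorm_nonneg _))]
    exact supNorm_smul_le hK (c.1 ε) (u.1 ε)

/-- `𝓖_c(Ω)`: the Colombeau generalized functions with compact support in `Ω`. -/
def Gc (Ω : Opens (Eu n)) : Type := EcM Ω ⧸ Nc Ω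

instance (Ω : Opens (Eu n)) : AddCommGroup (Gc Ω) :=
  inferInstanceAs (AddCommGroup (EcM Ω ⧸ Nc Ω))

theorem isTorsionBySet_Gc (Ω : Opens (Eu n)) :
    Module.IsTorsionBySet (moderateNets ℂ) (EcM Ω ⧸ Nc Ω) (negligibleNets ℂ) := by
  rw [Module.isTorsionBySet_quotient_iff]
  rintro ⟨u, -, -, hu⟩ c hc
  refine ⟨fun ε => (contDiff_test _).contDiffOn, fun K hK hKΩ j => ?_⟩
  refine IsNegligible.of_le (IsModerate.mul_isNegligible (hu K hK hKΩ j)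
    (IsNegligible.of_le (v := c.1) (u := fun ε => ‖c.1 ε‖) hc fun ε => by simp)) fun ε => ?_
  rw [Real.norm_of_nonneg (supNorm_nonneg _),
    Real.norm_of_nonneg (mul_nonneg (supNorm_nonneg _) (norm_nonneg _)), mul_comm]
  exact supNorm_smul_le hK (c.1 ε) (u ε)

instance (Ω : Opens (Eu n)) : Module (moderateNets ℂ ⧸ negligibleNets ℂ) (EcM Ω ⧸ Nc Ω) :=
  (isTorsionBySet_Gc Ω).module

/-- `𝓖_c(Ω)` is a module over the complex generalized numbers, `[(c_ε)] [(u_ε)] = [(c_ε u_ε)]`. -/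
instance (Ω : Opens (Eu n)) : Module GenC (Gc Ω) :=
  inferInstanceAs (Module (moderateNets ℂ ⧸ negligibleNets ℂ) (EcM Ω ⧸ Nc Ω))

/-- The class in `𝓖_c(Ω)` of a net in `𝓔_{c,M}(Ω)`. -/
def Gc.mk {Ω : Opens (Eu n)} (u : EcM Ω) : Gc Ω := Submodule.Quotient.mk u

/-- An operation on nets that is compatible with the module structures and with negligibility
acts on classes. -/
def Gc.map {Ω V : Opens (Eu n)} (A : EcM V →ₗ[moderateNets ℂ] EcM Ω)
    (hA : ∀ u ∈ Nc V, A u ∈ Nc Ω) : Gc V →ₗ[GenC] Gc Ω where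
  toFun := (Nc V).mapQ (Nc Ω) A hA
  map_add' := map_add ((Nc V).mapQ (Nc Ω) A hA)
  map_smul' := by
    intro c u
    obtain ⟨c, rfl⟩ := Ideal.Quotient.mk_surjective c
    exact map_smul ((Nc V).mapQ (Nc Ω) A hA) c (show EcM V ⧸ Nc V from u)

/-- The partial derivative `∂_k` on `𝓔_{c,M}(Ω)`. -/
def EcM.partial (Ω : Opens (Eu n)) (k : Fin n) : EcM Ω →ₗ[moderateNets ℂ] EcM Ω where
  toFun u := ⟨fun ε => testPartial Ω k (u.1 ε), by
    obtain ⟨u, ⟨K, hK, hKΩ, hu⟩, -, hu'⟩ := u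
    refine ⟨⟨K, hK, hKΩ, fun ε => (tsupport_testPartial k _).trans (hu ε)⟩,
      fun ε => (contDiff_test _).contDiffOn, fun K' hK' hKΩ' j => ?_⟩
    refine IsModerate.of_le (hu' K' hK' hKΩ' (j + 1)) fun ε => ?_
    rw [Real.norm_of_nonneg (supNorm_nonneg _), Real.norm_of_nonneg (supNorm_nonneg _)]
    exact supNorm_testPartial_le hK' k (u ε)⟩
  map_add' u v := Subtype.ext <| funext fun ε => map_add (testPartial Ω k) (u.1 ε) (v.1 ε)
  map_smul' c u := Subtype.ext <| funext fun ε => map_smul (testPartial Ω k) (c.1 ε) (u.1 ε)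

/-- The partial derivative `∂_k` on `𝓖_c(Ω)`. -/
def Gc.partial (Ω : Opens (Eu n)) (k : Fin n) : Gc Ω →ₗ[GenC] Gc Ω :=
  Gc.map (EcM.partial Ω k) (by
    rintro u ⟨-, hu⟩
    refine ⟨fun ε => (contDiff_test _).contDiffOn, fun K hK hKΩ j => ?_⟩
    refine IsNegligible.of_le (hu K hK hKΩ (j + 1)) fun ε => ?_
    rw [Real.norm_of_nonneg (supNorm_nonneg _), Real.norm_of_nonneg (supNorm_nonneg _)]
    exact supNorm_testPartial_le hK k (u.1 ε))

/-- Extension by zero `𝓔_{c,M}(V) → 𝓔_{c,M}(Ω)`. -/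
def EcM.extend {Ω V : Opens (Eu n)} (h : V ≤ Ω) : EcM V →ₗ[moderateNets ℂ] EcM Ω where
  toFun u := ⟨fun ε => testExtend h (u.1 ε), by
    obtain ⟨u, ⟨K, hK, hKV, hu⟩, -, hu'⟩ := u
    refine ⟨⟨K, hK, hKV.trans h, hu⟩,
      fun ε => (contDiff_test _).contDiffOn, fun K' hK' hKΩ' j => ?_⟩
    refine IsModerate.of_le (hu' K hK hKV j) fun ε => ?_
    rw [Real.norm_of_nonneg (supNorm_nonneg _), Real.norm_of_nonneg (supNorm_nonneg _)]
    exact supNorm_le_of_tsupport hK (contDiff_test (u ε)) (hu ε)⟩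
  map_add' u v := Subtype.ext <| funext fun ε => map_add (testExtend h) (u.1 ε) (v.1 ε)
  map_smul' c u := Subtype.ext <| funext fun ε => map_smul (testExtend h) (c.1 ε) (u.1 ε)

/-- Extension by zero `𝓖_c(V) → 𝓖_c(Ω)`. -/
def Gc.extend {Ω V : Opens (Eu n)} (h : V ≤ Ω) : Gc V →ₗ[GenC] Gc Ω :=
  Gc.map (EcM.extend h) (by
    rintro ⟨u, ⟨K, hK, hKV, hu⟩, hu'⟩ ⟨-, hn⟩
    refine ⟨fun ε => (contDiff_test _).contDiffOn, fun K' hK' hKΩ' j => ?_⟩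
    refine IsNegligible.of_le (hn K hK hKV j) fun ε => ?_
    rw [Real.norm_of_nonneg (supNorm_nonneg _), Real.norm_of_nonneg (supNorm_nonneg _)]
    exact supNorm_le_of_tsupport hK (contDiff_test (u ε)) (hu ε))

/-! ### Functionals on `𝓖_c(Ω)` -/

/-- The linear functionals on `𝓖_c(Ω)` with values in the complex generalized numbers. -/
abbrev Functional (Ω : Opens (Eu n)) : Type := Gc Ω →ₗ[GenC] GenC

/-- Continuity for the inductive limit topology of `𝓖_c(Ω)`: for every compact `K ⊆ Ω` there are
`j` and a constant with `|T u|_e ≤ const · 𝒫_{K,j}(u)` for all `u` supported in `K`, where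
`|·|_e = exp(-val(·))` and `𝒫_{K,j} = exp(-val_{K,j}(·))`. -/
def IsContinuousFunctional {Ω : Opens (Eu n)} (T : Functional Ω) : Prop :=
  ∀ K : Set (Eu n), IsCompact K → K ⊆ Ω → ∃ (j : ℕ) (c : ℝ),
    ∀ u : EcM Ω, (∀ ε, tsupport (u.1 ε) ⊆ K) →
      netVal (fun ε => supNorm K j (u.1 ε)) ≤ (T (Gc.mk u)).val + (c : EReal)

/-- The nets of distributions on `Ω` in `𝓜(C_c^∞(Ω), ℂ)`. -/
def IsModerateDistNet {Ω : Opens (Eu n)} (S : Idx → 𝓓(Ω, ℂ) →L[ℂ] ℂ) : Prop :=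
  ∀ K : Set (Eu n), IsCompact K → K ⊆ Ω → ∃ (j N : ℕ) (c : ℝ) (η : Idx), 0 < c ∧
    ∀ f : 𝓓(Ω, ℂ), tsupport f ⊆ K → ∀ ε ≤ η,
      ‖S ε f‖ ≤ c * ((ε : ℝ)⁻¹) ^ N * supNorm K j f

/-- `T` is a basic element of the dual of `𝓖_c(Ω)`. -/
def IsBasic {Ω : Opens (Eu n)} (T : Functional Ω) : Prop :=
  IsContinuousFunctional T ∧ ∃ S : Idx → 𝓓(Ω, ℂ) →L[ℂ] ℂ, IsModerateDistNet S ∧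
    ∀ u : EcM Ω, Represents (fun ε => S ε (u.1 ε)) (T (Gc.mk u))

/-- The restriction `T|_V` of a functional to a smaller open set. -/
def Functional.restrict {Ω V : Opens (Eu n)} (h : V ≤ Ω) (T : Functional Ω) : Functional V :=
  T ∘ₗ Gc.extend h

/-- `T` is the functional `u ↦ [(∫ g_ε u_ε dx)]` given by the class of a net `(g_ε)` in the class
`R Ω`. For `R = EM` this says `T ∈ 𝓖(Ω)`, and for `R = EMinf` it says `T ∈ 𝓖^∞(Ω)`. -/
def IsGivenBy (R : Opens (Eu n) → Set (Idx → Eu n → ℂ)) {Ω : Opens (Eu n)}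
    (T : Functional Ω) : Prop :=
  ∃ g ∈ R Ω, ∀ u : EcM Ω,
    Represents (fun ε => ∫ x in (Ω : Set (Eu n)), g ε x * u.1 ε x) (T (Gc.mk u))

/-- The singular support with respect to `R`; for `R = EM` it is the `𝓖`-singular support, and for
`R = EMinf` the `𝓖^∞`-singular support. -/
def singSupp (R : Opens (Eu n) → Set (Idx → Eu n → ℂ)) {Ω : Opens (Eu n)}
    (T : Functional Ω) : Set (Eu n) :=
  {x | x ∈ Ω ∧ ¬ ∃ (V : Opens (Eu n)) (h : V ≤ Ω), x ∈ V ∧ IsGivenBy R (T.restrict h)}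

/-- `ι_d(δ)`: the functional `u ↦ [(u_ε(0))]` on `𝓖_c(ℝⁿ)`. -/
def delta (n : ℕ) : Functional (⊤ : Opens (Eu n)) where
  toFun := Quotient.map' (s₁ := Submodule.quotientRel _) (s₂ := Submodule.quotientRel _)
    (fun u : EcM (⊤ : Opens (Eu n)) => (⟨fun ε => u.1 ε 0,
      IsModerate.of_le (u.2.2.2 {0} isCompact_singleton (Set.subset_univ _) 0) fun ε => by
        rw [Real.norm_of_nonneg (supNorm_nonneg _)]
        simpa using le_supNorm (j := 0) isCompact_singleton (contDiff_test (u.1 ε))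
          (Set.mem_singleton (0 : Eu n)) le_rfl⟩ : moderateNets ℂ))
    (by
      intro u v h
      rw [Submodule.quotientRel_def] at h ⊢
      refine IsNegligible.of_le (h.2 {0} isCompact_singleton (Set.subset_univ _) 0) fun ε => ?_
      rw [Real.norm_of_nonneg (supNorm_nonneg _)]
      simpa using le_supNorm (j := 0) isCompact_singleton (contDiff_test ((u - v).1 ε))
          (Set.mem_singleton (0 : Eu n)) le_rfl)
  map_add' := by
    rintro ⟨u⟩ ⟨v⟩
    rfl
  map_smul' := by
    rintro ⟨c⟩ ⟨u⟩
    rfl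

/-! ### Differential operators with constant coefficients -/

/-- `D_k = -i ∂_k` on functionals, where `(∂_k T)(u) = -T(∂_k u)`. -/
def dualD (Ω : Opens (Eu n)) (k : Fin n) : Module.End GenC (Functional Ω) :=
  (GenNum.const (-Complex.I) : GenC) • -(LinearMap.lcomp GenC GenC (Gc.partial Ω k))

/-- `D^α` on functionals. -/
def dualDPow (Ω : Opens (Eu n)) (α : Fin n →₀ ℕ) : Module.End GenC (Functional Ω) :=
  ((List.finRange n).map fun k => dualD Ω k ^ α k).prod

/-- `P(D) T = ∑_α c_α D^α T` for the polynomial `P = ∑_α c_α ξ^α`. -/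
def applyOp (P : MvPolynomial (Fin n) GenC) {Ω : Opens (Eu n)} (T : Functional Ω) :
    Functional Ω :=
  ∑ α ∈ P.support, P.coeff α • dualDPow Ω α T

/-- The formal derivative `∂^α P`. -/
def polyDeriv (P : MvPolynomial (Fin n) GenC) (α : Fin n →₀ ℕ) : MvPolynomial (Fin n) GenC :=
  ((List.finRange n).map fun k =>
    ((MvPolynomial.pderiv k).toLinearMap : Module.End GenC (MvPolynomial (Fin n) GenC)) ^ α k).prod P

/-- `P̃(ξ) = (∑_{|α| ≤ m} |∂^α P(ξ)|²)^{1/2}`, a real generalized number; `m` is the degree. -/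
def tildeFn (P : MvPolynomial (Fin n) GenC) (ξ : Eu n) : GenR :=
  GenNum.sqrt (∑ k ∈ Finset.range (P.totalDegree + 1), ∑ α ∈ Finset.univ.finsuppAntidiag k,
    GenNum.abs ((polyDeriv P α).eval fun j => (GenNum.const (ξ j : ℂ) : GenC)) ^ 2)

/-- `P(D)` is hypoelliptic with respect to `R` (`R = EM`: `𝓖`-hypoelliptic, `R = EMinf`:
`𝓖^∞`-hypoelliptic). -/
def IsHypoelliptic (R : Opens (Eu n) → Set (Idx → Eu n → ℂ))
    (P : MvPolynomial (Fin n) GenC) : Prop :=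
  ∀ (Ω : Opens (Eu n)) (T : Functional Ω), IsBasic T →
    singSupp R (applyOp P T) = singSupp R T

/-- `E` is a fundamental solution of `P(D)`. -/
def IsFundamentalSolution (P : MvPolynomial (Fin n) GenC)
    (E : Functional (⊤ : Opens (Eu n))) : Prop :=
  applyOp P E = delta n

/-- `P(D) F - ι_d(δ)` belongs to `𝓖(ℝⁿ)` (`R = EM`) or to `𝓖^∞(ℝⁿ)` (`R = EMinf`). -/
def IsParametrix (R : Opens (Eu n) → Set (Idx → Eu n → ℂ)) (P : MvPolynomial (Fin n) GenC)
    (F : Functional (⊤ : Opens (Eu n))) : Prop :=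
  IsGivenBy R (applyOp P F - delta n)

end Colombeau

end

/-!
Write `P_ε` for a net of polynomials representing `P`. Malgrange's inequality bounds `|f(0)|` by
the reciprocal of the size of the coefficients of `P_ε` times a seminorm of the transpose
`P_ε(-D) f` that is independent of `ε`, a weighted supremum of its Fourier–Laplace transform on a
strip in `ℂⁿ`. By Hahn–Banach, `P_ε(-D) f ↦ f(0)` extends to a distribution with the same bound.
Invertibility of `P̃(ξ₀)` keeps the coefficients above a power of `ε`, so these distributions form a
basic fundamental solution.

Conversely, cut a parametrix `F` off near the origin, where it is singular. This gives distributions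
`S_ε` of small support with `P_ε(D) S_ε = δ + a_ε` up to a negligible error, where `a_ε` is a
regular net. Near a given point, `T_ε` is therefore `S_ε * P_ε(D) T_ε - a_ε * T_ε`; the second term
is always regular, the first one as soon as `P(D) T` is regular near the point.

For both choices of regularity only the class of admissible growth exponents `N j` of the
derivatives of order `j` matters: all sequences for `𝓖`, the constant ones for `𝓖^∞`.
-/

noncomputable section

namespace Colombeau

variable {n : ℕ}

open MeasureTheory

section Nets

variable {F : Type*} [NormedAddCommGroup F]

theorem eventually_le_atZero (η : Idx) : ∀ᶠ ε in atZero, ε ≤ η :=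
  ((eventually_lt_nhds η.2.1).comap Subtype.val).mono fun _ hε => le_of_lt hε

theorem exists_forall_le_of_eventually_atZero {p : Idx → Prop} (h : ∀ᶠ ε in atZero, p ε) :
    ∃ η : Idx, ∀ ε ≤ η, p ε := by
  obtain ⟨s, hs, hsp⟩ := mem_comap.1 h
  obtain ⟨r, hr, hrs⟩ := Metric.mem_nhds_iff.1 hs
  refine ⟨⟨min (r / 2) 1, lt_min (by positivity) one_pos, min_le_right _ _⟩, fun ε hε => ?_⟩
  have hεr : (ε : ℝ) ≤ r / 2 := le_trans hε (min_le_left _ _)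
  refine hsp (hrs ?_)
  rw [Metric.mem_ball, Real.dist_eq, sub_zero, abs_of_pos ε.2.1]
  linarith

theorem inv_coe_pow_pos (ε : Idx) (N : ℕ) : 0 < ((ε : ℝ)⁻¹) ^ N :=
  pow_pos (inv_pos.2 ε.2.1) N

theorem IsNegligible.isModerate {u : Idx → F} (hu : IsNegligible u) : IsModerate u :=
  ⟨0, by simpa using hu 0⟩

theorem IsNegligible.congr' {u v : Idx → F} (hu : IsNegligible u) (h : u =ᶠ[atZero] v) :
    IsNegligible v :=
  fun q => (hu q).congr' h (EventuallyEq.refl _ _)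

theorem IsNegligible.neg {u : Idx → F} (hu : IsNegligible u) : IsNegligible fun ε => -u ε :=
  hu.of_le fun ε => by simp

theorem IsNegligible.sub {u v : Idx → F} (hu : IsNegligible u) (hv : IsNegligible v) :
    IsNegligible fun ε => u ε - v ε := by
  simpa only [sub_eq_add_neg] using hu.add hv.neg

theorem IsNegligible.sum {ι : Type*} (s : Finset ι) {u : ι → Idx → F}
    (h : ∀ i ∈ s, IsNegligible (u i)) : IsNegligible fun ε => ∑ i ∈ s, u i ε :=
  fun q => IsBigO.fun_sum fun i hi => h i hi q

theorem isModerate_inv_pow (N : ℕ) : IsModerate fun ε : Idx => ((ε : ℝ)⁻¹) ^ N :=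
  ⟨N, isBigO_refl _ _⟩

theorem IsModerate.exists_eventually_norm_le {u : Idx → F} (hu : IsModerate u) :
    ∃ N : ℕ, ∀ᶠ ε in atZero, ‖u ε‖ ≤ ((ε : ℝ)⁻¹) ^ N := by
  obtain ⟨N, hN⟩ := hu
  obtain ⟨C, hC⟩ := hN.bound
  have hC' : (0 : ℝ) < |C| + 1 := by positivity
  let η : Idx := ⟨(|C| + 1)⁻¹, by positivity, inv_le_one_of_one_le₀ (by simp)⟩
  refine ⟨N + 1, ?_⟩
  filter_upwards [hC, eventually_le_atZero η] with ε hε hεη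
  rw [Real.norm_of_nonneg (inv_coe_pow_pos ε N).le] at hε
  have hCε : |C| + 1 ≤ (ε : ℝ)⁻¹ := (le_inv_comm₀ hC' ε.2.1).2 hεη
  rw [pow_succ']
  exact hε.trans (mul_le_mul_of_nonneg_right (by linarith [le_abs_self C])
    (inv_coe_pow_pos ε N).le)

end Nets

section GeneralizedNumbers

variable {𝕜 : Type} [RCLike 𝕜]

theorem GenNum.mk_eq_mk_iff {r s : moderateNets 𝕜} :
    GenNum.mk r = GenNum.mk s ↔ IsNegligible fun ε => r.1 ε - s.1 ε :=
  Ideal.Quotient.eq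

theorem GenNum.mk_surjective : Function.Surjective (GenNum.mk (𝕜 := 𝕜)) :=
  Ideal.Quotient.mk_surjective

theorem GenNum.const_mul (a b : ℂ) :
    (GenNum.const (a * b) : GenC) = GenNum.const a * GenNum.const b :=
  rfl

/-- A chosen representative of a generalized number. -/
def GenNum.rep (z : GenNum 𝕜) : moderateNets 𝕜 := (GenNum.mk_surjective z).choose

theorem GenNum.mk_rep (z : GenNum 𝕜) : GenNum.mk z.rep = z := (GenNum.mk_surjective z).choose_spec

theorem GenNum.represents_rep (z : GenNum 𝕜) : Represents (z.rep : Idx → 𝕜) z :=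
  ⟨z.rep.2, z.mk_rep⟩

variable {r s : Idx → 𝕜} {z w : GenNum 𝕜}

theorem Represents.isModerate (h : Represents r z) : IsModerate r := h.1

theorem Represents.isNegligible_sub (hr : Represents r z) (hs : Represents s z) :
    IsNegligible fun ε => r ε - s ε := by
  obtain ⟨hr, rfl⟩ := hr
  obtain ⟨hs, h⟩ := hs
  exact GenNum.mk_eq_mk_iff.1 h.symm

theorem Represents.of_isNegligible_sub (hr : Represents r z)
    (h : IsNegligible fun ε => r ε - s ε) : Represents s z := by
  obtain ⟨hr, rfl⟩ := hr
  have hs : IsModerate s := by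
    simpa using IsModerate.add (u := r) (v := fun ε => -(r ε - s ε)) hr h.neg.isModerate
  exact ⟨hs, (GenNum.mk_eq_mk_iff (r := ⟨r, hr⟩) (s := ⟨s, hs⟩).2 h).symm⟩

theorem Represents.congr' (hr : Represents r z) (h : r =ᶠ[atZero] s) : Represents s z :=
  hr.of_isNegligible_sub ((isNegligible_zero (F := 𝕜)).congr'
    (h.mono fun _ hε => (sub_eq_zero_of_eq hε).symm))

theorem Represents.unique (hr : Represents r z) (hs : Represents r w) : z = w := by
  obtain ⟨hr, rfl⟩ := hr
  obtain ⟨hs, rfl⟩ := hs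
  rfl

theorem Represents.add (hr : Represents r z) (hs : Represents s w) :
    Represents (fun ε => r ε + s ε) (z + w) := by
  obtain ⟨hr, rfl⟩ := hr
  obtain ⟨hs, rfl⟩ := hs
  exact ⟨hr.add hs, map_add GenNum.mk ⟨r, hr⟩ ⟨s, hs⟩⟩

theorem Represents.sub (hr : Represents r z) (hs : Represents s w) :
    Represents (fun ε => r ε - s ε) (z - w) := by
  obtain ⟨hr, rfl⟩ := hr
  obtain ⟨hs, rfl⟩ := hs
  exact ⟨(moderateNets 𝕜).sub_mem hr hs, map_sub GenNum.mk ⟨r, hr⟩ ⟨s, hs⟩⟩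

theorem Represents.mul (hr : Represents r z) (hs : Represents s w) :
    Represents (fun ε => r ε * s ε) (z * w) := by
  obtain ⟨hr, rfl⟩ := hr
  obtain ⟨hs, rfl⟩ := hs
  exact ⟨hr.mul hs, map_mul GenNum.mk ⟨r, hr⟩ ⟨s, hs⟩⟩

theorem represents_zero : Represents (fun _ => (0 : 𝕜)) 0 :=
  ⟨isModerate_const 0, map_zero GenNum.mk⟩

theorem represents_one : Represents (fun _ => (1 : 𝕜)) 1 :=
  ⟨isModerate_const 1, map_one GenNum.mk⟩

theorem Represents.sum {ι : Type*} (s : Finset ι) {r : ι → Idx → 𝕜} {z : ι → GenNum 𝕜}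
    (h : ∀ i ∈ s, Represents (r i) (z i)) :
    Represents (fun ε => ∑ i ∈ s, r i ε) (∑ i ∈ s, z i) := by
  classical
  induction s using Finset.induction_on with
  | empty => simpa using represents_zero
  | insert a s ha ih =>
    simp only [Finset.sum_insert ha]
    exact (h a (by simp)).add (ih fun i hi => h i (by simp [hi]))

theorem Represents.abs {r : Idx → ℂ} {z : GenC} (h : Represents r z) :
    Represents (fun ε => ‖r ε‖) z.abs := by
  obtain ⟨h, rfl⟩ := h
  exact ⟨IsModerate.of_le h fun ε => by simp, rfl⟩

theorem Represents.sqrt {r : Idx → ℝ} {z : GenR} (h : Represents r z) :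
    Represents (fun ε => √(r ε)) z.sqrt := by
  obtain ⟨h, rfl⟩ := h
  exact ⟨_, rfl⟩

theorem Represents.le_val_of_isBigO (hr : Represents r z) {a : ℝ}
    (h : r =O[atZero] fun ε => (ε : ℝ) ^ a) : (a : EReal) ≤ z.val :=
  le_sSup_of_le ⟨r, hr, rfl⟩ (le_sSup ⟨a, rfl, h.norm_left⟩)

end GeneralizedNumbers

section ModerateDistNets

variable {Ω : Opens (Eu n)} {S : Idx → 𝓓(Ω, ℂ) →L[ℂ] ℂ}

instance (Ω : Opens (Eu n)) : SMul (moderateNets ℂ) (EcM Ω) :=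
  (Submodule.module (EcM Ω)).toSMul

theorem Gc.mk_surjective : Function.Surjective (Gc.mk (Ω := Ω)) :=
  Submodule.Quotient.mk_surjective _

theorem Gc.mk_smul (c : moderateNets ℂ) (u : EcM Ω) :
    Gc.mk (c • u : EcM Ω) = GenNum.mk c • Gc.mk u :=
  rfl

theorem Gc.mk_sum {ι : Type*} (s : Finset ι) (u : ι → EcM Ω) :
    Gc.mk (∑ i ∈ s, u i) = ∑ i ∈ s, Gc.mk (u i) :=
  map_sum (Nc Ω).mkQ u s

theorem IsModerateDistNet.exists_isBigO (hS : IsModerateDistNet S) {K : Set (Eu n)}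
    (hK : IsCompact K) (hKΩ : K ⊆ Ω) :
    ∃ j N : ℕ, ∀ u : Idx → 𝓓(Ω, ℂ), (∀ ε, tsupport (u ε) ⊆ K) →
      (fun ε => S ε (u ε)) =O[atZero] fun ε => ((ε : ℝ)⁻¹) ^ N * supNorm K j (u ε) := by
  obtain ⟨j, N, c, η, -, h⟩ := hS K hK hKΩ
  refine ⟨j, N, fun u hu => IsBigO.of_bound c ((eventually_le_atZero η).mono fun ε hε => ?_)⟩
  rw [Real.norm_of_nonneg (mul_nonneg (inv_coe_pow_pos ε N).le (supNorm_nonneg _)), ← mul_assoc]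
  exact h (u ε) (hu ε) ε hε

theorem IsModerateDistNet.isModerate (hS : IsModerateDistNet S) (u : EcM Ω) :
    IsModerate fun ε => S ε (u.1 ε) := by
  obtain ⟨⟨K, hK, hKΩ, hu⟩, -, hm⟩ := u.2
  obtain ⟨j, N, h⟩ := hS.exists_isBigO hK hKΩ
  obtain ⟨M, hM⟩ := hm K hK hKΩ j
  exact ⟨N + M, by simpa only [pow_add] using (h u.1 hu).trans ((isBigO_refl _ _).mul hM)⟩

theorem IsModerateDistNet.isNegligible (hS : IsModerateDistNet S) {u : EcM Ω} (hn : u ∈ Nc Ω) :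
    IsNegligible fun ε => S ε (u.1 ε) := by
  obtain ⟨⟨K, hK, hKΩ, hu⟩, -, -⟩ := u.2
  obtain ⟨j, N, h⟩ := hS.exists_isBigO hK hKΩ
  exact fun q => (h u.1 hu).trans
    (IsModerate.mul_isNegligible (isModerate_inv_pow N) (hn.2 K hK hKΩ j) q)

/-- The functional `[(u_ε)] ↦ [(S_ε u_ε)]` given by a moderate net `(S_ε)` of distributions. -/
def Functional.ofNet (S : Idx → 𝓓(Ω, ℂ) →L[ℂ] ℂ) (hS : IsModerateDistNet S) : Functional Ω where
  toFun := Quotient.map' (s₁ := Submodule.quotientRel _) (s₂ := Submodule.quotientRel _)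
    (fun u : EcM Ω => (⟨fun ε => S ε (u.1 ε), hS.isModerate u⟩ : moderateNets ℂ))
    (by
      intro u v h
      rw [Submodule.quotientRel_def] at h ⊢
      refine (hS.isNegligible h).of_le fun ε => ?_
      change ‖S ε (u.1 ε) - S ε (v.1 ε)‖ ≤ ‖S ε (u.1 ε - v.1 ε)‖
      rw [map_sub])
  map_add' := by
    rintro ⟨u⟩ ⟨v⟩
    exact congrArg GenNum.mk (Subtype.ext (funext fun ε => map_add (S ε) (u.1 ε) (v.1 ε)))
  map_smul' := by
    rintro ⟨c⟩ ⟨u⟩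
    exact congrArg GenNum.mk (Subtype.ext (funext fun ε => map_smul (S ε) (c.1 ε) (u.1 ε)))

theorem Functional.represents_ofNet (hS : IsModerateDistNet S) (u : EcM Ω) :
    Represents (fun ε => S ε (u.1 ε)) (Functional.ofNet S hS (Gc.mk u)) :=
  ⟨hS.isModerate u, rfl⟩

theorem IsModerateDistNet.isContinuousFunctional (hS : IsModerateDistNet S) {T : Functional Ω}
    (hT : ∀ u : EcM Ω, Represents (fun ε => S ε (u.1 ε)) (T (Gc.mk u))) :
    IsContinuousFunctional T := by
  intro K hK hKΩ
  obtain ⟨j, N, h⟩ := hS.exists_isBigO hK hKΩ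
  refine ⟨j, N, fun u hu => sSup_le ?_⟩
  rintro _ ⟨a, rfl, ha⟩
  have hval : ((a - N : ℝ) : EReal) ≤ (T (Gc.mk u)).val := by
    refine (hT u).le_val_of_isBigO ((h u.1 hu).trans (((isBigO_refl _ _).mul ha).trans ?_))
    refine IsBigO.of_bound 1 (Eventually.of_forall fun ε => ?_)
    rw [one_mul, Real.rpow_sub ε.2.1, Real.rpow_natCast, inv_pow, div_eq_inv_mul]
  calc (a : EReal) = ((a - N : ℝ) : EReal) + ((N : ℝ) : EReal) := by
        rw [← EReal.coe_add, sub_add_cancel]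
    _ ≤ _ := add_le_add_left hval _

theorem Functional.isBasic_ofNet (hS : IsModerateDistNet S) : IsBasic (Functional.ofNet S hS) :=
  ⟨hS.isContinuousFunctional (Functional.represents_ofNet hS), S, hS,
    Functional.represents_ofNet hS⟩

theorem represents_delta (u : EcM (⊤ : Opens (Eu n))) :
    Represents (fun ε => u.1 ε 0) (delta n (Gc.mk u)) :=
  ⟨_, rfl⟩

theorem restrict_mk {V : Opens (Eu n)} (h : V ≤ Ω) (T : Functional Ω) (u : EcM V) :
    T.restrict h (Gc.mk u) = T (Gc.mk (EcM.extend h u)) :=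
  rfl

end ModerateDistNets

/-! ### Partial derivatives and the seminorms -/

/-- The partial derivative `∂_k f`. -/
def partialDeriv (k : Fin n) (f : Eu n → ℂ) : Eu n → ℂ :=
  fun x => fderiv ℝ f x (EuclideanSpace.single k (1 : ℝ))

/-- The iterated partial derivative `∂_{k₁} ⋯ ∂_{k_r} f` along a word `[k₁, …, k_r]`. -/
def iterPartialDeriv (I : List (Fin n)) (f : Eu n → ℂ) : Eu n → ℂ := I.foldr partialDeriv f

@[simp] theorem iterPartialDeriv_nil (f : Eu n → ℂ) : iterPartialDeriv [] f = f := rfl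

@[simp] theorem iterPartialDeriv_cons (k : Fin n) (I : List (Fin n)) (f : Eu n → ℂ) :
    iterPartialDeriv (k :: I) f = partialDeriv k (iterPartialDeriv I f) := rfl

theorem iterPartialDeriv_append (I J : List (Fin n)) (f : Eu n → ℂ) :
    iterPartialDeriv (I ++ J) f = iterPartialDeriv I (iterPartialDeriv J f) := by
  simp [iterPartialDeriv]

section Calculus

variable {f g : Eu n → ℂ} {U K : Set (Eu n)} {x : Eu n}

theorem fderiv_apply_eq_sum_partialDeriv (f : Eu n → ℂ) (x v : Eu n) :
    fderiv ℝ f x v = ∑ k, (v k : ℂ) * partialDeriv k f x := by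
  have hv : v = ∑ k, v k • EuclideanSpace.single k (1 : ℝ) := by
    ext i
    simp [Finset.sum_apply, Pi.single_apply]
  conv_lhs => rw [hv]
  rw [map_sum]
  refine Finset.sum_congr rfl fun k _ => ?_
  rw [map_smul, partialDeriv, Complex.real_smul]

theorem contDiffOn_partialDeriv (hU : IsOpen U) (hf : ContDiffOn ℝ ∞ f U) (k : Fin n) :
    ContDiffOn ℝ ∞ (partialDeriv k f) U :=
  (hf.fderiv_of_isOpen hU (by simp)).clm_apply contDiffOn_const

theorem contDiff_partialDeriv (hf : ContDiff ℝ ∞ f) (k : Fin n) : ContDiff ℝ ∞ (partialDeriv k f) :=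
  (hf.fderiv_right (by simp)).clm_apply contDiff_const

theorem contDiffOn_iterPartialDeriv (hU : IsOpen U) (hf : ContDiffOn ℝ ∞ f U) (I : List (Fin n)) :
    ContDiffOn ℝ ∞ (iterPartialDeriv I f) U := by
  induction I with
  | nil => exact hf
  | cons k I ih => exact contDiffOn_partialDeriv hU ih k

theorem contDiff_iterPartialDeriv (hf : ContDiff ℝ ∞ f) (I : List (Fin n)) :
    ContDiff ℝ ∞ (iterPartialDeriv I f) := by
  induction I with
  | nil => exact hf
  | cons k I ih => exact contDiff_partialDeriv ih k

theorem contDiffAt_of_isOpen (hU : IsOpen U) (hf : ContDiffOn ℝ ∞ f U) (hx : x ∈ U) :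
    ContDiffAt ℝ ∞ f x :=
  hf.contDiffAt (hU.mem_nhds hx)

theorem tsupport_partialDeriv_subset (k : Fin n) (f : Eu n → ℂ) :
    tsupport (partialDeriv k f) ⊆ tsupport f :=
  tsupport_fderiv_apply_subset ℝ _

theorem tsupport_iterPartialDeriv_subset (I : List (Fin n)) (f : Eu n → ℂ) :
    tsupport (iterPartialDeriv I f) ⊆ tsupport f := by
  induction I with
  | nil => exact subset_rfl
  | cons k I ih => exact (tsupport_partialDeriv_subset k _).trans ih

theorem partialDeriv_add (k : Fin n) (hf : ContDiff ℝ ∞ f) (hg : ContDiff ℝ ∞ g) :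
    partialDeriv k (f + g) = partialDeriv k f + partialDeriv k g := by
  funext x
  simp only [partialDeriv, Pi.add_apply]
  rw [fderiv_add (hf.differentiable (by simp) x) (hg.differentiable (by simp) x)]
  rfl

theorem partialDeriv_const_smul (k : Fin n) (c : ℂ) (hf : ContDiff ℝ ∞ f) :
    partialDeriv k (c • f) = c • partialDeriv k f := by
  funext x
  simp only [partialDeriv, Pi.smul_apply]
  rw [fderiv_const_smul (hf.differentiable (by simp) x)]
  rfl

theorem partialDeriv_translate (k : Fin n) (y : Eu n) (f : Eu n → ℂ) :
    partialDeriv k (fun z => f (y + z)) = fun z => partialDeriv k f (y + z) := by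
  funext z
  simp only [partialDeriv]
  rw [fderiv_comp_add_left]

theorem iterPartialDeriv_translate (I : List (Fin n)) (y : Eu n) (f : Eu n → ℂ) :
    iterPartialDeriv I (fun z => f (y + z)) = fun z => iterPartialDeriv I f (y + z) := by
  induction I with
  | nil => rfl
  | cons k I ih => rw [iterPartialDeriv_cons, ih, partialDeriv_translate]; rfl

theorem partialDeriv_comm (hf : ContDiff ℝ ∞ f) (k l : Fin n) : partialDeriv k (partialDeriv l f) =
    partialDeriv l (partialDeriv k f) := by
  have key : ∀ (k l : Fin n) (x : Eu n), partialDeriv k (partialDeriv l f) x =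
      fderiv ℝ (fderiv ℝ f) x (EuclideanSpace.single k 1) (EuclideanSpace.single l 1) := by
    intro k l x
    have hd : DifferentiableAt ℝ (fderiv ℝ f) x :=
      ((hf.fderiv_right (m := ∞) (by simp)).differentiable (by simp)) x
    change fderiv ℝ (fun y => fderiv ℝ f y (EuclideanSpace.single l 1)) x _ = _
    rw [fderiv_clm_apply hd (differentiableAt_const _)]
    simp
  funext x
  rw [key, key]
  have := (hf.contDiffAt (x := x)).isSymmSndFDerivAt (n := ∞)
    (by simpa using show ((2 : ℕ∞) : ℕ∞ω) ≤ ((⊤ : ℕ∞) : ℕ∞ω) from WithTop.coe_le_coe.2 le_top)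
  exact this.eq _ _

theorem iterPartialDeriv_partialDeriv_comm (hf : ContDiff ℝ ∞ f) (I : List (Fin n)) (k : Fin n) :
    iterPartialDeriv I (partialDeriv k f) = partialDeriv k (iterPartialDeriv I f) := by
  induction I with
  | nil => rfl
  | cons l I ih => rw [iterPartialDeriv_cons, iterPartialDeriv_cons, ih, partialDeriv_comm
    (contDiff_iterPartialDeriv hf I)]

theorem norm_iteratedFDeriv_partialDeriv_le (hf : ContDiffAt ℝ ∞ f x) (k : Fin n) (i : ℕ) :
    ‖iteratedFDeriv ℝ i (partialDeriv k f) x‖ ≤ ‖iteratedFDeriv ℝ (i + 1) f x‖ := by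
  have hf' : ContDiffAt ℝ ∞ (fderiv ℝ f) x := hf.fderiv_right (by simp)
  have h := norm_iteratedFDeriv_clm_apply_const (𝕜 := ℝ) (c := EuclideanSpace.single k (1 : ℝ))
    (n := i) (N := ∞) (x := x) hf' (mod_cast le_top)
  rwa [show ‖EuclideanSpace.single k (1 : ℝ)‖ = 1 by simp, one_mul, norm_iteratedFDeriv_fderiv] at h

theorem norm_smulRightL_proj_le (k : Fin n) :
    ‖ContinuousLinearMap.smulRightL ℝ (Eu n) ℂ (EuclideanSpace.proj k)‖ ≤ 1 := by
  refine ContinuousLinearMap.opNorm_le_bound _ zero_le_one fun z => ?_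
  refine ContinuousLinearMap.opNorm_le_bound _ (by positivity) fun v => ?_
  change ‖(v k : ℝ) • z‖ ≤ _
  rw [norm_smul, one_mul, mul_comm]
  exact mul_le_mul_of_nonneg_left (PiLp.norm_apply_le v k) (norm_nonneg _)

theorem norm_iteratedFDeriv_succ_le (hf : ContDiffAt ℝ ∞ f x) (i : ℕ) :
    ‖iteratedFDeriv ℝ (i + 1) f x‖ ≤ ∑ k, ‖iteratedFDeriv ℝ i (partialDeriv k f) x‖ := by
  have hpartial : ∀ k, ContDiffAt ℝ ∞ (partialDeriv k f) x := fun k =>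
    (hf.fderiv_right (m := ∞) (by simp)).clm_apply contDiffAt_const
  let dx : Fin n → (ℂ →L[ℝ] Eu n →L[ℝ] ℂ) := fun k =>
    ContinuousLinearMap.smulRightL ℝ (Eu n) ℂ (EuclideanSpace.proj k)
  have hfderiv : fderiv ℝ f = fun y => ∑ k, (dx k ∘ partialDeriv k f) y := by
    funext y
    ext v
    rw [fderiv_apply_eq_sum_partialDeriv, _root_.sum_apply]
    exact Finset.sum_congr rfl fun k _ => (Complex.real_smul (x := v k)).symm
  rw [← norm_iteratedFDeriv_fderiv, hfderiv, iteratedFDeriv_fun_sum_apply fun k _ =>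
    ((dx k).contDiff.contDiffAt.comp x (hpartial k)).of_le (mod_cast le_top)]
  refine (norm_sum_le _ _).trans (Finset.sum_le_sum fun k _ => ?_)
  exact ((dx k).norm_iteratedFDeriv_comp_left (hpartial k) (mod_cast le_top)).trans
    (mul_le_of_le_one_left (norm_nonneg _) (norm_smulRightL_proj_le k))

theorem norm_iteratedFDeriv_le_of_norm_iterPartialDeriv_le (hU : IsOpen U)
    (hf : ContDiffOn ℝ ∞ f U) (hx : x ∈ U) {B : ℝ}
    (hB : 0 ≤ B) (i : ℕ) (h : ∀ I : List (Fin n), I.length ≤ i → ‖iterPartialDeriv I f x‖ ≤ B) :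
    ‖iteratedFDeriv ℝ i f x‖ ≤ (n + 1) ^ i * B := by
  induction i generalizing f with
  | zero => simpa using h [] le_rfl
  | succ i ih =>
    refine (norm_iteratedFDeriv_succ_le (contDiffAt_of_isOpen hU hf hx) i).trans ?_
    have : ∀ k, ‖iteratedFDeriv ℝ i (partialDeriv k f) x‖ ≤ (n + 1) ^ i * B := fun k =>
      ih (contDiffOn_partialDeriv hU hf k) fun I hI => by
        have := h (I ++ [k]) (by simpa using hI)
        rwa [iterPartialDeriv_append] at this
    refine (Finset.sum_le_sum fun k _ => this k).trans ?_
    rw [Finset.sum_const, Finset.card_univ, Fintype.card_fin, nsmul_eq_mul, pow_succ]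
    nlinarith [mul_nonneg (pow_nonneg (show (0 : ℝ) ≤ n + 1 by positivity) i) hB]

theorem supNorm_le_of_norm_iterPartialDeriv_le (hU : IsOpen U) (hf : ContDiffOn ℝ ∞ f U)
    (hK : K ⊆ U) {B : ℝ}
    (hB : 0 ≤ B) (j : ℕ)
    (h : ∀ x ∈ K, ∀ I : List (Fin n), I.length ≤ j → ‖iterPartialDeriv I f x‖ ≤ B) :
    supNorm K j f ≤ (n + 1) ^ j * B := by
  refine supNorm_le (by positivity) fun x hx i hi => ?_
  refine (norm_iteratedFDeriv_le_of_norm_iterPartialDeriv_le hU hf (hK hx) hB i fun I hI =>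
    h x hx I (by omega)).trans ?_
  exact mul_le_mul_of_nonneg_right (pow_le_pow_right₀ (by simp) hi) hB

theorem norm_iteratedFDeriv_iterPartialDeriv_le (hU : IsOpen U) (hf : ContDiffOn ℝ ∞ f U)
    (hx : x ∈ U) (I : List (Fin n)) (i : ℕ) :
    ‖iteratedFDeriv ℝ i (iterPartialDeriv I f) x‖ ≤ ‖iteratedFDeriv ℝ (i + I.length) f x‖ := by
  induction I generalizing i with
  | nil => rfl
  | cons k I ih =>
    refine (norm_iteratedFDeriv_partialDeriv_le
      (contDiffAt_of_isOpen hU (contDiffOn_iterPartialDeriv hU hf I) hx) k i).trans ?_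
    refine (ih (i + 1)).trans (le_of_eq ?_)
    rw [List.length_cons, add_right_comm, add_assoc]

theorem le_supNorm_of_contDiffOn (hU : IsOpen U) (hf : ContDiffOn ℝ ∞ f U) (hK : IsCompact K)
    (hKU : K ⊆ U) (hx : x ∈ K) {i j : ℕ} (hi : i ≤ j) :
    ‖iteratedFDeriv ℝ i f x‖ ≤ supNorm K j f := by
  have hb : ∀ i : ℕ, ∃ C, ∀ y ∈ K, ‖iteratedFDeriv ℝ i f y‖ ≤ C := fun i => by
    refine hK.exists_bound_of_continuousOn fun y hy => ContinuousAt.continuousWithinAt ?_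
    exact ((contDiffAt_of_isOpen hU hf (hKU hy)).iteratedFDeriv_right (m := 0) (i := i)
      (mod_cast le_top)).continuousAt
  choose C hC using hb
  refine le_ciSup (f := fun p : K × Fin (j + 1) => ‖iteratedFDeriv ℝ (p.2 : ℕ) f p.1‖)
    ⟨∑ i : Fin (j + 1), |C i|, ?_⟩ (⟨x, hx⟩, ⟨i, Nat.lt_succ_iff.2 hi⟩)
  rintro _ ⟨p, rfl⟩
  exact ((hC _ _ p.1.2).trans (le_abs_self _)).trans
    (Finset.single_le_sum (f := fun i : Fin (j + 1) => |C i|) (fun _ _ => abs_nonneg _)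
      (Finset.mem_univ p.2))

theorem norm_iterPartialDeriv_le_supNorm (hU : IsOpen U) (hf : ContDiffOn ℝ ∞ f U)
    (hK : IsCompact K)
    (hKU : K ⊆ U) (hx : x ∈ K) {I : List (Fin n)} {j : ℕ} (hI : I.length ≤ j) :
    ‖iterPartialDeriv I f x‖ ≤ supNorm K j f := by
  have := norm_iteratedFDeriv_iterPartialDeriv_le hU hf (hKU hx) I 0
  rw [norm_iteratedFDeriv_zero] at this
  exact this.trans (le_supNorm_of_contDiffOn hU hf hK hKU hx (by omega))

theorem norm_le_supNorm (hU : IsOpen U) (hf : ContDiffOn ℝ ∞ f U) (hK : IsCompact K)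
    (hKU : K ⊆ U) (hx : x ∈ K) (j : ℕ) : ‖f x‖ ≤ supNorm K j f :=
  norm_iterPartialDeriv_le_supNorm hU hf hK hKU hx (I := []) (Nat.zero_le _)

theorem supNorm_iterPartialDeriv_le (hU : IsOpen U) (hf : ContDiffOn ℝ ∞ f U) (hK : IsCompact K)
    (hKU : K ⊆ U) (I : List (Fin n)) (j : ℕ) :
    supNorm K j (iterPartialDeriv I f) ≤ supNorm K (j + I.length) f :=
  supNorm_le (supNorm_nonneg _) fun _ hx i hi =>
    (norm_iteratedFDeriv_iterPartialDeriv_le hU hf (hKU hx) I i).trans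
    (le_supNorm_of_contDiffOn hU hf hK hKU hx (by omega))

theorem supNorm_mono (hU : IsOpen U) (hf : ContDiffOn ℝ ∞ f U) {L : Set (Eu n)} (hL : IsCompact L)
    (hLU : L ⊆ U) (hKL : K ⊆ L) {i j : ℕ} (hij : i ≤ j) : supNorm K i f ≤ supNorm L j f :=
  supNorm_le (supNorm_nonneg _) fun _ hx _ hi =>
    le_supNorm_of_contDiffOn hU hf hL hLU (hKL hx) (hi.trans hij)

theorem supNorm_translate_le (hf : ContDiff ℝ ∞ f) {L : Set (Eu n)} (hL : IsCompact L) (y : Eu n)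
    (h : ∀ z ∈ K, y + z ∈ L) (j : ℕ) : supNorm K j (fun z => f (y + z)) ≤ supNorm L j f := by
  refine supNorm_le (supNorm_nonneg _) fun z hz i hi => ?_
  rw [iteratedFDeriv_comp_add_left]
  exact le_supNorm hL hf (h z hz) hi

theorem supNorm_mul_le (hU : IsOpen U) (hf : ContDiffOn ℝ ∞ f U) (hg : ContDiffOn ℝ ∞ g U)
    (hK : IsCompact K) (hKU : K ⊆ U) (j : ℕ) :
    supNorm K j (fun x => f x * g x) ≤ 2 ^ j * supNorm K j f * supNorm K j g := by
  have h0 : 0 ≤ supNorm K j f * supNorm K j g := mul_nonneg (supNorm_nonneg _) (supNorm_nonneg _)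
  refine supNorm_le (by rw [mul_assoc]; positivity) fun x hx i hi => ?_
  have hx' := hKU hx
  have h := (ContinuousLinearMap.mul ℝ ℂ).norm_iteratedFDerivWithin_le_of_bilinear_of_le_one hf hg
    hU.uniqueDiffOn hx' (n := i) (mod_cast le_top) (ContinuousLinearMap.opNorm_mul_le ℝ ℂ)
  simp only [iteratedFDerivWithin_of_isOpen _ hU hx', ContinuousLinearMap.mul_apply'] at h
  refine h.trans ?_
  calc _ ≤ ∑ l ∈ Finset.range (i + 1), (i.choose l : ℝ) * (supNorm K j f * supNorm K j g) := by
        refine Finset.sum_le_sum fun l hl => ?_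
        rw [mul_assoc]
        have hl' : l ≤ i := Nat.lt_succ_iff.1 (Finset.mem_range.1 hl)
        exact mul_le_mul_of_nonneg_left (mul_le_mul
          (le_supNorm_of_contDiffOn hU hf hK hKU hx (by omega))
          (le_supNorm_of_contDiffOn hU hg hK hKU hx (by omega)) (norm_nonneg _)
          (supNorm_nonneg _)) (Nat.cast_nonneg _)
    _ = 2 ^ i * (supNorm K j f * supNorm K j g) := by
        rw [← Finset.sum_mul]
        congr 1
        exact_mod_cast Nat.sum_range_choose i
    _ ≤ 2 ^ j * supNorm K j f * supNorm K j g := by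
        rw [mul_assoc]
        exact mul_le_mul_of_nonneg_right (pow_le_pow_right₀ one_le_two hi) h0

end Calculus

/-! ### Compactly supported distributions -/

/-- The space `C^∞(ℝⁿ)`. -/
def SmoothFun (n : ℕ) : Submodule ℂ (Eu n → ℂ) where
  carrier := {f | ContDiff ℝ ∞ f}
  zero_mem' := (contDiff_const : ContDiff ℝ ∞ fun _ : Eu n => (0 : ℂ))
  add_mem' {f _} hf hg := (show ContDiff ℝ ∞ f from hf).add hg
  smul_mem' c f hf := (show ContDiff ℝ ∞ f from hf).const_smul c

theorem SmoothFun.contDiff (u : SmoothFun n) : ContDiff ℝ ∞ u.1 := u.2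

theorem SmoothFun.contDiffOn (u : SmoothFun n) (U : Set (Eu n)) : ContDiffOn ℝ ∞ u.1 U :=
  (SmoothFun.contDiff u).contDiffOn

theorem iterPartialDeriv_add {f g : Eu n → ℂ} (I : List (Fin n)) (hf : ContDiff ℝ ∞ f)
    (hg : ContDiff ℝ ∞ g) :
    iterPartialDeriv I (f + g) = iterPartialDeriv I f + iterPartialDeriv I g := by
  induction I with
  | nil => rfl
  | cons k I ih =>
    rw [iterPartialDeriv_cons, ih, partialDeriv_add k (contDiff_iterPartialDeriv hf I)
      (contDiff_iterPartialDeriv hg I)]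
    rfl

theorem iterPartialDeriv_const_smul {f : Eu n → ℂ} (I : List (Fin n)) (c : ℂ)
    (hf : ContDiff ℝ ∞ f) : iterPartialDeriv I (c • f) = c • iterPartialDeriv I f := by
  induction I with
  | nil => rfl
  | cons k I ih =>
    rw [iterPartialDeriv_cons, ih, partialDeriv_const_smul k c (contDiff_iterPartialDeriv hf I)]
    rfl

/-- The translation `u ↦ u (y + ·)` on `C^∞(ℝⁿ)`. -/
def SmoothFun.translate (y : Eu n) : SmoothFun n →ₗ[ℂ] SmoothFun n where
  toFun u := ⟨fun z => u.1 (y + z), (SmoothFun.contDiff u).comp (contDiff_const.add contDiff_id)⟩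
  map_add' _ _ := rfl
  map_smul' _ _ := rfl

/-- The reflection `u ↦ u (-·)` on `C^∞(ℝⁿ)`. -/
def SmoothFun.reflect : SmoothFun n →ₗ[ℂ] SmoothFun n where
  toFun u := ⟨fun z => u.1 (-z), (SmoothFun.contDiff u).comp contDiff_neg⟩
  map_add' _ _ := rfl
  map_smul' _ _ := rfl

/-- The partial derivative `∂_k` on `C^∞(ℝⁿ)`. -/
def SmoothFun.partialDeriv (k : Fin n) : SmoothFun n →ₗ[ℂ] SmoothFun n where
  toFun u := ⟨Colombeau.partialDeriv k u.1, contDiff_partialDeriv u.2 k⟩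
  map_add' u v := Subtype.ext (partialDeriv_add k u.2 v.2)
  map_smul' c u := Subtype.ext (partialDeriv_const_smul k c u.2)

/-- The iterated partial derivative along a word on `C^∞(ℝⁿ)`. -/
def SmoothFun.iterPartialDeriv (I : List (Fin n)) : SmoothFun n →ₗ[ℂ] SmoothFun n where
  toFun u := ⟨Colombeau.iterPartialDeriv I u.1, contDiff_iterPartialDeriv u.2 I⟩
  map_add' u v := Subtype.ext (iterPartialDeriv_add I u.2 v.2)
  map_smul' c u := Subtype.ext (iterPartialDeriv_const_smul I c u.2)

/-- The linear form `S` on `C^∞(ℝⁿ)` is dominated by the seminorm `C · p_{K,j}`. -/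
def DominatedBy (S : SmoothFun n →ₗ[ℂ] ℂ) (K : Set (Eu n)) (j : ℕ) (C : ℝ) : Prop :=
  ∀ f : SmoothFun n, ‖S f‖ ≤ C * supNorm K j f.1

theorem DominatedBy.mono {S : SmoothFun n →ₗ[ℂ] ℂ} {K L : Set (Eu n)} {i j : ℕ} {C C' : ℝ}
    (hS : DominatedBy S K i C) (hL : IsCompact L) (hKL : K ⊆ L) (hij : i ≤ j) (hC : C ≤ C')
    (hC' : 0 ≤ C') : DominatedBy S L j C' := fun f =>
  (hS f).trans (mul_le_mul hC
    (supNorm_mono isOpen_univ (SmoothFun.contDiffOn f _) hL (Set.subset_univ _) hKL hij)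
    (supNorm_nonneg _) hC')

/-- The space `𝓔'(ℝⁿ)` of compactly supported distributions, as linear forms on `C^∞(ℝⁿ)`. -/
def compactDistributions (n : ℕ) : Submodule ℂ (SmoothFun n →ₗ[ℂ] ℂ) where
  carrier := {S | ∃ (K : Set (Eu n)) (j : ℕ) (C : ℝ), IsCompact K ∧ DominatedBy S K j C}
  zero_mem' := ⟨∅, 0, 0, isCompact_empty, fun f => by simp⟩
  add_mem' := by
    rintro S S' ⟨K, i, C, hK, hS⟩ ⟨K', i', C', hK', hS'⟩
    refine ⟨K ∪ K', max i i', |C| + |C'|, hK.union hK', fun f => ?_⟩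
    rw [LinearMap.add_apply, add_mul]
    exact (norm_add_le _ _).trans (add_le_add
      (hS.mono (hK.union hK') Set.subset_union_left (le_max_left _ _) (le_abs_self C)
        (abs_nonneg C) f)
      (hS'.mono (hK.union hK') Set.subset_union_right (le_max_right _ _) (le_abs_self C')
        (abs_nonneg C') f))
  smul_mem' := by
    rintro c S ⟨K, j, C, hK, hS⟩
    refine ⟨K, j, ‖c‖ * C, hK, fun f => ?_⟩
    rw [LinearMap.smul_apply, norm_smul, mul_assoc]
    exact mul_le_mul_of_nonneg_left (hS f) (norm_nonneg _)

/-- The function `y ↦ S (u (y + ·))`, that is, the convolution of `u` with the reflection of the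
compactly supported distribution `S`. -/
def correlation (S : SmoothFun n →ₗ[ℂ] ℂ) (u : SmoothFun n) : Eu n → ℂ :=
  fun y => S (SmoothFun.translate y u)

theorem exists_taylor_bound {E F : Type*} [NormedAddCommGroup E] [NormedSpace ℝ E] [ProperSpace E]
    [NormedAddCommGroup F] [NormedSpace ℝ F] {g : E → F} (hg : ContDiff ℝ 2 g) (R : ℝ) :
    ∃ M : ℝ, ∀ x v : E, ‖x‖ ≤ R → ‖v‖ ≤ 1 →
      ‖g (x + v) - g x - fderiv ℝ g x v‖ ≤ M * ‖v‖ ^ 2 := by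
  have hg1 : ContDiff ℝ 1 (fderiv ℝ g) := hg.fderiv_right (by norm_num)
  obtain ⟨M, hM⟩ := (isCompact_closedBall (0 : E) (R + 1)).exists_bound_of_continuousOn
    (hg1.continuous_fderiv (by simp)).continuousOn
  refine ⟨|M|, fun x v hx hv => ?_⟩
  have hseg : segment ℝ x (x + v) ⊆ Metric.closedBall 0 (R + 1) := by
    refine (convex_closedBall _ _).segment_subset ?_ ?_
    · rw [mem_closedBall_zero_iff]; linarith
    · rw [mem_closedBall_zero_iff]; linarith [norm_add_le x v]
  have hfderiv : ∀ z ∈ segment ℝ x (x + v), ‖fderiv ℝ g z - fderiv ℝ g x‖ ≤ |M| * ‖v‖ := by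
    intro z hz
    refine ((convex_segment x (x + v)).norm_image_sub_le_of_norm_fderiv_le (𝕜 := ℝ)
      (fun w _ => hg1.differentiable (by simp) w)
      (fun w hw => (hM w (hseg hw)).trans (le_abs_self M)) (left_mem_segment ℝ _ _) hz).trans
      (mul_le_mul_of_nonneg_left ?_ (abs_nonneg M))
    obtain ⟨t, ht, rfl⟩ := segment_eq_image' ℝ x (x + v) ▸ hz
    simp only [add_sub_cancel_left, norm_smul, Real.norm_eq_abs, abs_of_nonneg ht.1]
    exact mul_le_of_le_one_left (norm_nonneg _) ht.2
  have hmain := (convex_segment x (x + v)).norm_image_sub_le_of_norm_fderiv_le' (𝕜 := ℝ)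
    (fun w _ => hg.differentiable (by simp) w)
    hfderiv (left_mem_segment ℝ _ _) (right_mem_segment ℝ _ _)
  rw [add_sub_cancel_left] at hmain
  exact hmain.trans (le_of_eq (by ring))

/-- The remainder of the first order Taylor expansion of `y ↦ u (y + ·)`. -/
def taylorRemainder (u : SmoothFun n) (y v : Eu n) : SmoothFun n :=
  SmoothFun.translate (y + v) u - SmoothFun.translate y u -
    ∑ k, (v k : ℂ) • SmoothFun.translate y (SmoothFun.partialDeriv k u)

theorem iterPartialDeriv_taylorRemainder (u : SmoothFun n) (y v z : Eu n) (I : List (Fin n)) :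
    iterPartialDeriv I (taylorRemainder u y v).1 z =
      iterPartialDeriv I u.1 (y + z + v) - iterPartialDeriv I u.1 (y + z) -
        fderiv ℝ (iterPartialDeriv I u.1) (y + z) v := by
  have htranslate : ∀ (w : SmoothFun n) (y z : Eu n),
      (SmoothFun.iterPartialDeriv I (SmoothFun.translate y w)).1 z =
        iterPartialDeriv I w.1 (y + z) :=
    fun w y z => congrFun (iterPartialDeriv_translate I y w.1) z
  change (SmoothFun.iterPartialDeriv I (taylorRemainder u y v)).1 z = _
  simp only [taylorRemainder, map_sub, map_sum, map_smul, fderiv_apply_eq_sum_partialDeriv,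
    Submodule.coe_sub, Submodule.coe_sum, Submodule.coe_smul, Pi.sub_apply,
    Finset.sum_apply, Pi.smul_apply, htranslate, smul_eq_mul, add_right_comm y v z]
  congr 1
  refine Finset.sum_congr rfl fun k _ => ?_
  rw [← iterPartialDeriv_partialDeriv_comm u.2 I k]
  rfl

theorem exists_supNorm_taylorRemainder_le {K : Set (Eu n)} (hK : IsCompact K) (j : ℕ)
    (u : SmoothFun n) (y : Eu n) :
    ∃ M : ℝ, ∀ v : Eu n, ‖v‖ ≤ 1 → supNorm K j (taylorRemainder u y v).1 ≤ M * ‖v‖ ^ 2 := by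
  obtain ⟨R, hR⟩ := hK.isBounded.exists_norm_le
  choose M hM using fun I : List (Fin n) =>
    exists_taylor_bound
      ((contDiff_iterPartialDeriv u.2 I).of_le (WithTop.coe_le_coe.2 le_top)) (‖y‖ + R)
  obtain ⟨B, hB⟩ := ((List.finite_length_le (Fin n) j : Set.Finite _).image M).bddAbove
  have hMB : ∀ I : List (Fin n), I.length ≤ j → M I ≤ |B| := fun I hI =>
    (hB ⟨I, hI, rfl⟩).trans (le_abs_self B)
  refine ⟨(n + 1) ^ j * |B|, fun v hv => ?_⟩
  rw [mul_assoc]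
  refine supNorm_le_of_norm_iterPartialDeriv_le isOpen_univ (SmoothFun.contDiffOn _ _)
    (Set.subset_univ _) (by positivity) j fun z hz I hI => ?_
  rw [iterPartialDeriv_taylorRemainder]
  refine (hM I _ v ((norm_add_le _ _).trans (by linarith [hR z hz])) hv).trans ?_
  exact mul_le_mul_of_nonneg_right (hMB I hI) (by positivity)

section Correlation

variable {S : SmoothFun n →ₗ[ℂ] ℂ}

/-- The derivative of `correlation S u` at `y`. -/
def correlationFDeriv (S : SmoothFun n →ₗ[ℂ] ℂ) (u : SmoothFun n) (y : Eu n) : Eu n →L[ℝ] ℂ :=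
  ∑ k, (EuclideanSpace.proj k : Eu n →L[ℝ] ℝ).smulRight
    (correlation S (SmoothFun.partialDeriv k u) y)

theorem map_taylorRemainder (S : SmoothFun n →ₗ[ℂ] ℂ) (u : SmoothFun n) (y v : Eu n) :
    S (taylorRemainder u y v) =
      correlation S u (y + v) - correlation S u y - correlationFDeriv S u y v := by
  rw [taylorRemainder, map_sub, map_sub, map_sum, correlationFDeriv, _root_.sum_apply]
  simp only [map_smul, smul_eq_mul]
  rfl

theorem hasFDerivAt_correlation (hS : S ∈ compactDistributions n) (u : SmoothFun n)
    (y : Eu n) : HasFDerivAt (correlation S u) (correlationFDeriv S u y) y := by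
  obtain ⟨K, j, C, hK, hS⟩ := hS
  obtain ⟨M, hM⟩ := exists_supNorm_taylorRemainder_le hK j u y
  rw [hasFDerivAt_iff_isLittleO_nhds_zero]
  have hquadratic : (fun v : Eu n =>
      correlation S u (y + v) - correlation S u y - correlationFDeriv S u y v)
      =O[𝓝 0] fun v => ‖v‖ ^ 2 := by
    refine IsBigO.of_bound (|C| * M) ?_
    filter_upwards [Metric.closedBall_mem_nhds (0 : Eu n) one_pos] with v hv
    rw [← map_taylorRemainder, norm_pow, norm_norm, mul_assoc]
    exact (hS _).trans (mul_le_mul (le_abs_self C) (hM v (mem_closedBall_zero_iff.1 hv))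
      (supNorm_nonneg _) (abs_nonneg C))
  have hlittle : (fun v : Eu n => ‖v‖ ^ 2) =o[𝓝 0] fun v => ‖v‖ ^ 1 :=
    (isLittleO_pow_pow one_lt_two).comp_tendsto (tendsto_norm_zero (E := Eu n))
  exact hquadratic.trans_isLittleO (isLittleO_norm_right.1 (by simpa using hlittle))

theorem contDiff_correlation (hS : S ∈ compactDistributions n) (u : SmoothFun n) :
    ContDiff ℝ ∞ (correlation S u) := by
  rw [contDiff_infty]
  intro m
  induction m generalizing u with
  | zero =>
    exact contDiff_zero.2 (continuous_iff_continuousAt.2 fun y =>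
      (hasFDerivAt_correlation hS u y).continuousAt)
  | succ m ih =>
    have hd : fderiv ℝ (correlation S u) = correlationFDeriv S u :=
      funext fun y => (hasFDerivAt_correlation hS u y).fderiv
    rw [show ((m + 1 : ℕ) : ℕ∞ω) = (m : ℕ∞ω) + 1 by push_cast; rfl, contDiff_succ_iff_fderiv]
    refine ⟨fun y => (hasFDerivAt_correlation hS u y).differentiableAt, by simp, ?_⟩
    rw [hd]
    exact ContDiff.sum fun k _ => contDiff_const.smulRight (ih (SmoothFun.partialDeriv k u))

theorem partialDeriv_correlation (hS : S ∈ compactDistributions n) (u : SmoothFun n)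
    (k : Fin n) :
    partialDeriv k (correlation S u) = correlation S (SmoothFun.partialDeriv k u) := by
  funext y
  rw [partialDeriv, (hasFDerivAt_correlation hS u y).fderiv, correlationFDeriv,
    _root_.sum_apply, Finset.sum_eq_single k]
  · simp
  · intro l _ hl
    simp [hl]
  · simp

theorem iterPartialDeriv_correlation (hS : S ∈ compactDistributions n)
    (u : SmoothFun n) (I : List (Fin n)) :
    iterPartialDeriv I (correlation S u) = correlation S (SmoothFun.iterPartialDeriv I u) := by
  induction I with
  | nil => rfl
  | cons k I ih => rw [iterPartialDeriv_cons, ih, partialDeriv_correlation hS]; rfl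

/-- `correlation S u` as an element of `C^∞(ℝⁿ)`. -/
def SmoothFun.correlation (hS : S ∈ compactDistributions n) (u : SmoothFun n) :
    SmoothFun n :=
  ⟨Colombeau.correlation S u, contDiff_correlation hS u⟩

end Correlation

/-! ### Fubini for compactly supported distributions -/

theorem exists_comp_eq_of_norm_le_seminorm {𝕜 V W : Type*} [RCLike 𝕜] [AddCommGroup V] [Module 𝕜 V]
    [AddCommGroup W] [Module 𝕜 W] (A : V →ₗ[𝕜] W) (S : V →ₗ[𝕜] 𝕜) (p : Seminorm 𝕜 W)
    (h : ∀ v, ‖S v‖ ≤ p (A v)) :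
    ∃ L : W →ₗ[𝕜] 𝕜, (∀ v, L (A v) = S v) ∧ ∀ w, ‖L w‖ ≤ p w := by
  obtain ⟨σ, hσ⟩ := A.rangeRestrict.exists_rightInverse_of_surjective A.range_rangeRestrict
  have hAσ : ∀ w, A (σ w) = w := fun w => congrArg Subtype.val (LinearMap.congr_fun hσ w)
  have hS : ∀ v, S (σ (A.rangeRestrict v)) = S v := fun v => by
    rw [← sub_eq_zero, ← map_sub, ← norm_le_zero_iff]
    refine (h _).trans_eq ?_
    rw [map_sub, hAσ]
    change p (A v - A v) = 0
    rw [sub_self, map_zero]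
  obtain ⟨L, hL, hLp⟩ := Module.Dual.exists_extension_of_le_seminorm (LinearMap.range A) (S ∘ₗ σ)
    (p := p) fun w => (h (σ w)).trans_eq (by rw [hAσ])
  exact ⟨L, fun v => (hL (A.rangeRestrict v)).trans (hS v), hLp⟩

theorem integrable_mul_of_hasCompactSupport {g f : Eu n → ℂ} (hg : Continuous g)
    (hc : HasCompactSupport g) (hf : Continuous f) : Integrable fun x => g x * f x :=
  (hg.mul hf).integrable_of_hasCompactSupport hc.mul_right

/-- The functional `f ↦ ∫ g f` on `C^∞(ℝⁿ)`. -/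
def integralAgainst (g : Eu n → ℂ) (hg : Continuous g) (hc : HasCompactSupport g) :
    SmoothFun n →ₗ[ℂ] ℂ where
  toFun f := ∫ x, g x * f.1 x
  map_add' f f' := by
    rw [← integral_add
      (integrable_mul_of_hasCompactSupport hg hc (SmoothFun.contDiff f).continuous)
      (integrable_mul_of_hasCompactSupport hg hc (SmoothFun.contDiff f').continuous)]
    exact integral_congr_ae (.of_forall fun x => mul_add _ _ _)
  map_smul' c f := by
    rw [RingHom.id_apply, smul_eq_mul, ← integral_const_mul]
    exact integral_congr_ae (.of_forall fun x => mul_left_comm _ _ _)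

theorem norm_integral_mul_le {g f : Eu n → ℂ} {B : ℝ} (hg : Continuous g)
    (hc : HasCompactSupport g) (hf : ∀ x ∈ tsupport g, ‖f x‖ ≤ B) :
    ‖∫ x, g x * f x‖ ≤ (∫ x, ‖g x‖) * B := by
  rw [← integral_mul_const]
  refine norm_integral_le_of_norm_le
    ((hg.integrable_of_hasCompactSupport hc).norm.mul_const B) (.of_forall fun x => ?_)
  rw [norm_mul]
  by_cases hx : x ∈ tsupport g
  · exact mul_le_mul_of_nonneg_left (hf x hx) (norm_nonneg _)
  · simp [image_eq_zero_of_notMem_tsupport hx]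

theorem dominatedBy_integralAgainst {g : Eu n → ℂ} (hg : Continuous g)
    (hc : HasCompactSupport g) :
    DominatedBy (integralAgainst g hg hc) (tsupport g) 0 (∫ x, ‖g x‖) := fun f =>
  norm_integral_mul_le hg hc fun _ hx =>
    norm_le_supNorm isOpen_univ (SmoothFun.contDiffOn f _) hc (Set.subset_univ _) hx 0

theorem integralAgainst_mem_compactDistributions {g : Eu n → ℂ} (hg : Continuous g)
    (hc : HasCompactSupport g) : integralAgainst g hg hc ∈ compactDistributions n :=
  ⟨_, _, _, hc, dominatedBy_integralAgainst hg hc⟩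

/-- The words in the coordinate indices of length at most `j`. -/
abbrev BoundedWord (n j : ℕ) : Type := {I : List (Fin n) // I.length ≤ j}

instance (n j : ℕ) : Fintype (BoundedWord n j) :=
  @Fintype.ofFinite _ (List.finite_length_le (Fin n) j)

/-- The jet `(∂^I f|_K)_I` of order `j` of a smooth function on `K`. -/
def jetMap (K : Set (Eu n)) (j : ℕ) : SmoothFun n →ₗ[ℂ] (BoundedWord n j → C(K, ℂ)) where
  toFun f I := ⟨fun x => iterPartialDeriv I.1 f.1 x,
    (contDiff_iterPartialDeriv f.2 I.1).continuous.comp continuous_subtype_val⟩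
  map_add' f g := by
    funext I
    ext x
    exact congrFun (iterPartialDeriv_add I.1 f.2 g.2) x
  map_smul' c f := by
    funext I
    ext x
    exact congrFun (iterPartialDeriv_const_smul I.1 c f.2) x

section JetMap

variable {K : Set (Eu n)} {j : ℕ}

theorem continuous_jetMap_translate (u : SmoothFun n) :
    Continuous fun y => jetMap K j (SmoothFun.translate y u) := by
  refine continuous_pi fun I => ContinuousMap.continuous_of_continuous_uncurry _ ?_
  have huncurry : (Function.uncurry fun (y : Eu n) (x : K) =>
      jetMap K j (SmoothFun.translate y u) I x) =
        fun p : Eu n × K => iterPartialDeriv I.1 u.1 (p.1 + p.2) :=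
    funext fun p => congrFun (iterPartialDeriv_translate I.1 p.1 u.1) p.2
  exact huncurry ▸ (contDiff_iterPartialDeriv u.2 I.1).continuous.comp
    (continuous_fst.add (continuous_subtype_val.comp continuous_snd))

variable [CompactSpace K]

theorem supNorm_le_norm_jetMap (f : SmoothFun n) :
    supNorm K j f.1 ≤ (n + 1) ^ j * ‖jetMap K j f‖ :=
  supNorm_le_of_norm_iterPartialDeriv_le isOpen_univ (SmoothFun.contDiffOn f _)
    (Set.subset_univ _) (norm_nonneg _) j fun x hx I hI =>
      ((jetMap K j f ⟨I, hI⟩).norm_coe_le_norm ⟨x, hx⟩).trans (norm_le_pi_norm _ _)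

theorem exists_continuousLinearMap_comp_jetMap {S : SmoothFun n →ₗ[ℂ] ℂ} {C : ℝ}
    (hS : DominatedBy S K j C) :
    ∃ L : (BoundedWord n j → C(K, ℂ)) →L[ℂ] ℂ, ∀ f, L (jetMap K j f) = S f := by
  have hC : 0 ≤ |C| * (n + 1) ^ j := by positivity
  obtain ⟨L, hL, hLp⟩ := exists_comp_eq_of_norm_le_seminorm (jetMap K j) S
    (Real.toNNReal (|C| * (n + 1) ^ j) • normSeminorm ℂ (BoundedWord n j → C(K, ℂ))) fun f => by
      change _ ≤ ((|C| * (n + 1) ^ j).toNNReal : ℝ) * ‖jetMap K j f‖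
      rw [Real.coe_toNNReal _ hC, mul_assoc]
      exact (hS f).trans (mul_le_mul (le_abs_self C) (supNorm_le_norm_jetMap f)
        (supNorm_nonneg _) (abs_nonneg C))
  exact ⟨L.mkContinuous _ hLp, hL⟩

variable {g : Eu n → ℂ} (hg : Continuous g) (hc : HasCompactSupport g) (u : SmoothFun n)

include hg hc in
theorem integrable_smul_jetMap_translate :
    Integrable fun y => g y • jetMap K j (SmoothFun.translate y u) :=
  (hg.smul (continuous_jetMap_translate u)).integrable_of_hasCompactSupport hc.smul_right

theorem integral_smul_jetMap_translate :
    ∫ y, g y • jetMap K j (SmoothFun.translate y u) =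
      jetMap K j (SmoothFun.correlation (integralAgainst_mem_compactDistributions hg hc) u) := by
  funext I
  ext x
  refine (((ContinuousMap.evalCLM ℂ x).comp
    (ContinuousLinearMap.proj (R := ℂ) (φ := fun _ => C(K, ℂ)) I)).integral_comp_comm
      (integrable_smul_jetMap_translate hg hc u)).symm.trans ?_
  change _ = iterPartialDeriv I.1 (correlation (integralAgainst g hg hc) u) x
  rw [iterPartialDeriv_correlation (integralAgainst_mem_compactDistributions hg hc)]
  refine integral_congr_ae (.of_forall fun y => ?_)
  change g y * iterPartialDeriv I.1 (fun z => u.1 (y + z)) x =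
    g y * iterPartialDeriv I.1 u.1 (x + y)
  rw [iterPartialDeriv_translate, add_comm]

end JetMap

theorem integral_mul_correlation {S : SmoothFun n →ₗ[ℂ] ℂ} (hS : S ∈ compactDistributions n)
    {g : Eu n → ℂ} (hg : Continuous g) (hc : HasCompactSupport g) (u : SmoothFun n) :
    ∫ y, g y * correlation S u y =
      S (SmoothFun.correlation (integralAgainst_mem_compactDistributions hg hc) u) := by
  obtain ⟨K, j, C, hK, hS⟩ := hS
  have : CompactSpace K := isCompact_iff_compactSpace.1 hK
  obtain ⟨L, hL⟩ := exists_continuousLinearMap_comp_jetMap hS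
  rw [← hL, ← integral_smul_jetMap_translate hg hc,
    ← L.integral_comp_comm (integrable_smul_jetMap_translate hg hc u)]
  refine integral_congr_ae (.of_forall fun y => ?_)
  simp only [map_smul, hL, smul_eq_mul, correlation]

/-! ### Lower bounds for polynomials -/

theorem norm_sub_le_mul_norm_sub {a w z : ℂ} {δ : ℝ} (hδ : 0 < δ) (hz : ‖z‖ ≤ 1)
    (hza : δ / 2 ≤ ‖z - a‖) : ‖w - a‖ ≤ (1 + 2 * (1 + ‖w‖) / δ) * ‖z - a‖ := by
  have htriangle : ‖w - a‖ ≤ (‖w‖ + ‖z‖) + ‖z - a‖ := by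
    rw [← sub_add_sub_cancel w z a]
    exact (norm_add_le _ _).trans (add_le_add_left (norm_sub_le _ _) _)
  have hfar : 1 + ‖w‖ ≤ 2 * (1 + ‖w‖) / δ * ‖z - a‖ := by
    rw [div_mul_eq_mul_div, le_div_iff₀ hδ]
    nlinarith [norm_nonneg w]
  linarith

/-- Close to `a`, where division by `z - a` is lossy, the maximum principle on a small disc around
`a` replaces the direct estimate. -/
theorem norm_sub_mul_le_of_forall_norm_sub_mul_le {h : ℂ → ℂ} (hh : Differentiable ℂ h)
    {a w : ℂ} {R δ B : ℝ} (hδ : 0 < δ) (hR : R ≤ 1)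
    (hB : ∀ z, ‖z‖ ≤ R → ‖(z - a) * h z‖ ≤ B) {z : ℂ} (hz : ‖z‖ ≤ R - δ) :
    ‖(w - a) * h z‖ ≤ (1 + 2 * (1 + ‖w‖) / δ) * B := by
  have hfar : ∀ ζ : ℂ, ‖ζ‖ ≤ R → δ / 2 ≤ ‖ζ - a‖ →
      ‖(w - a) * h ζ‖ ≤ (1 + 2 * (1 + ‖w‖) / δ) * B := fun ζ hζ hζa =>
    calc ‖(w - a) * h ζ‖ = ‖w - a‖ * ‖h ζ‖ := norm_mul _ _
      _ ≤ (1 + 2 * (1 + ‖w‖) / δ) * ‖ζ - a‖ * ‖h ζ‖ := by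
        gcongr
        exact norm_sub_le_mul_norm_sub hδ (hζ.trans hR) hζa
      _ = (1 + 2 * (1 + ‖w‖) / δ) * ‖(ζ - a) * h ζ‖ := by rw [norm_mul, mul_assoc]
      _ ≤ (1 + 2 * (1 + ‖w‖) / δ) * B := mul_le_mul_of_nonneg_left (hB ζ hζ) (by positivity)
  rcases le_or_gt (δ / 2) ‖z - a‖ with hza | hza
  · exact hfar z (by linarith) hza
  · refine Complex.norm_le_of_forall_mem_frontier_norm_le (U := Metric.ball a (δ / 2))
      Metric.isBounded_ball ((hh.const_mul (w - a)).diffContOnCl) (fun ζ hζ => ?_)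
      (subset_closure (mem_ball_iff_norm.2 hza))
    rw [frontier_ball a (by positivity), mem_sphere_iff_norm] at hζ
    refine hfar ζ ?_ hζ.ge
    rw [show ζ = (ζ - a) - (z - a) + z by ring]
    linarith [norm_add_le ((ζ - a) - (z - a)) z, norm_sub_le (ζ - a) (z - a)]

theorem differentiable_multiset_prod_sub (s : Multiset ℂ) :
    Differentiable ℂ fun z => (s.map (z - ·)).prod := by
  induction s using Multiset.induction_on with
  | empty => simp
  | cons b s ih =>
    simp only [Multiset.map_cons, Multiset.prod_cons]
    exact (differentiable_id.sub_const b).mul ih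

/-- One root is moved from `z` to `w` at a time, at the cost of shrinking the disc by `δ`. -/
theorem norm_multiset_prod_sub_mul_le (s : Multiset ℂ) {w : ℂ} {R δ B : ℝ} (hδ : 0 < δ)
    (hR : R ≤ 1) (hs : δ * s.card ≤ R) {g : ℂ → ℂ} (hg : Differentiable ℂ g)
    (hB : ∀ z, ‖z‖ ≤ R → ‖(s.map (z - ·)).prod * g z‖ ≤ B) :
    ‖(s.map (w - ·)).prod * g 0‖ ≤ (1 + 2 * (1 + ‖w‖) / δ) ^ s.card * B := by
  induction s using Multiset.induction_on generalizing g R B with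
  | empty => simpa using hB 0 (by simpa using hs)
  | cons a s ih =>
    rw [Multiset.card_cons, Nat.cast_succ] at hs
    have hmoved : ∀ z, ‖z‖ ≤ R - δ → ‖(s.map (z - ·)).prod * ((w - a) * g z)‖ ≤
        (1 + 2 * (1 + ‖w‖) / δ) * B := fun z hz => by
      rw [mul_left_comm]
      exact norm_sub_mul_le_of_forall_norm_sub_mul_le
        ((differentiable_multiset_prod_sub s).mul hg) hδ hR
        (fun z hz => by simpa [mul_assoc] using hB z hz) hz
    have hrest := ih (by linarith) (by linarith) (hg.const_mul (w - a)) hmoved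
    rw [Multiset.map_cons, Multiset.prod_cons, Multiset.card_cons, pow_succ, mul_assoc (_ ^ _)]
    rwa [mul_assoc, mul_left_comm]

theorem norm_polynomial_eval_mul_le (p : Polynomial ℂ) {m : ℕ} (hp : p.natDegree ≤ m) {g : ℂ → ℂ}
    (hg : Differentiable ℂ g) {B : ℝ} (hB : ∀ z, ‖z‖ ≤ 1 → ‖p.eval z * g z‖ ≤ B) (w : ℂ) :
    ‖p.eval w * g 0‖ ≤ (1 + 2 * (m + 1) * (1 + ‖w‖)) ^ m * B := by
  have hB0 : 0 ≤ B := (norm_nonneg _).trans (hB 0 (by simp))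
  have heval : ∀ z, p.eval z = p.leadingCoeff * (p.roots.map (z - ·)).prod := fun z => by
    rw [(IsAlgClosed.splits p).eval_eq_prod_roots]
  have hcard : p.roots.card ≤ m := (Polynomial.card_roots' p).trans hp
  have hroots : 1 / ((m : ℝ) + 1) * p.roots.card ≤ 1 := by
    rw [one_div_mul_eq_div, div_le_one (by positivity)]
    exact_mod_cast hcard.trans (Nat.le_succ m)
  have hprod := norm_multiset_prod_sub_mul_le p.roots (w := w) (by positivity) le_rfl hroots
    (hg.const_mul p.leadingCoeff) (fun z hz => by
      rw [mul_left_comm, ← mul_assoc, ← heval]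
      exact hB z hz)
  rw [heval w, mul_assoc, mul_left_comm]
  refine hprod.trans (mul_le_mul_of_nonneg_right ?_ hB0)
  rw [show 2 * (1 + ‖w‖) / (1 / ((m : ℝ) + 1)) = 2 * (m + 1) * (1 + ‖w‖) by field_simp]
  exact pow_le_pow_right₀ (le_add_of_nonneg_right (by positivity)) hcard

/-- The `ℓ¹` norm of the coefficients of a polynomial. -/
def coeffNorm (Q : MvPolynomial (Fin n) ℂ) : ℝ := ∑ α ∈ Q.support, ‖Q.coeff α‖

theorem coeffNorm_nonneg (Q : MvPolynomial (Fin n) ℂ) : 0 ≤ coeffNorm Q :=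
  Finset.sum_nonneg fun _ _ => norm_nonneg _

theorem coeffNorm_eq_sum_of_support_subset {Q : MvPolynomial (Fin n) ℂ} {s : Finset (Fin n →₀ ℕ)}
    (hs : Q.support ⊆ s) : coeffNorm Q = ∑ α ∈ s, ‖Q.coeff α‖ :=
  Finset.sum_subset hs fun α _ hα => by rw [MvPolynomial.notMem_support_iff.1 hα, norm_zero]

/-- The values of a polynomial on the grid `{0, …, d}ⁿ`. -/
def gridEval (n d : ℕ) : MvPolynomial (Fin n) ℂ →ₗ[ℂ] ((Fin n → Fin (d + 1)) → ℂ) where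
  toFun Q k := Q.eval fun i => ((k i : ℕ) : ℂ)
  map_add' _ _ := funext fun _ => map_add _ _ _
  map_smul' c Q := funext fun _ => MvPolynomial.smul_eval _ Q c

theorem eq_zero_of_gridEval_eq_zero {d : ℕ} {Q : MvPolynomial (Fin n) ℂ} (hd : Q.totalDegree ≤ d)
    (hQ : gridEval n d Q = 0) : Q = 0 := by
  refine MvPolynomial.eq_zero_of_eval_zero_at_prod_finset _
    (fun _ => (Finset.range (d + 1)).image fun k : ℕ => (k : ℂ)) (fun i => ?_) fun x hx => ?_
  · rw [Finset.card_image_of_injective _ Nat.cast_injective, Finset.card_range]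
    exact Nat.lt_succ_of_le ((MvPolynomial.degreeOf_le_totalDegree _ _).trans hd)
  · have hgrid : ∀ i, ∃ k : Fin (d + 1), ((k : ℕ) : ℂ) = x i := fun i => by
      obtain ⟨k, hk, hkx⟩ := Finset.mem_image.1 (hx i)
      exact ⟨⟨k, Finset.mem_range.1 hk⟩, hkx⟩
    choose k hk using hgrid
    rw [← funext hk]
    exact congrFun hQ k

theorem exists_coeffNorm_le_norm_gridEval (n d : ℕ) : ∃ C : ℝ, 0 ≤ C ∧
    ∀ Q : MvPolynomial (Fin n) ℂ, Q.totalDegree ≤ d → coeffNorm Q ≤ C * ‖gridEval n d Q‖ := by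
  let V := MvPolynomial.restrictTotalDegree (Fin n) ℂ d
  obtain ⟨L, hL⟩ := LinearMap.exists_leftInverse_of_injective (gridEval n d ∘ₗ V.subtype)
    (LinearMap.ker_eq_bot'.2 fun Q hQ => Subtype.ext (eq_zero_of_gridEval_eq_zero
      ((MvPolynomial.mem_restrictTotalDegree _ _ _).1 Q.2) hQ))
  let coeffForm : (Fin n →₀ ℕ) → ((Fin n → Fin (d + 1)) → ℂ) →L[ℂ] ℂ := fun α =>
    (MvPolynomial.lcoeff ℂ α ∘ₗ V.subtype ∘ₗ L).toContinuousLinearMap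
  have hcoeff : ∀ (Q : MvPolynomial (Fin n) ℂ), Q.totalDegree ≤ d → ∀ α,
      ‖Q.coeff α‖ ≤ ‖coeffForm α‖ * ‖gridEval n d Q‖ := fun Q hQ α => by
    have hLQ := congrArg (fun q : V => q.1.coeff α)
      (LinearMap.congr_fun hL ⟨Q, (MvPolynomial.mem_restrictTotalDegree _ _ _).2 hQ⟩)
    exact hLQ ▸ (coeffForm α).le_opNorm (gridEval n d Q)
  have hfin : {α : Fin n →₀ ℕ | α.degree ≤ d}.Finite := Finsupp.finite_of_degree_le d
  refine ⟨∑ α ∈ hfin.toFinset, ‖coeffForm α‖, Finset.sum_nonneg fun _ _ => norm_nonneg _,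
    fun Q hQ => ?_⟩
  have hsupp : Q.support ⊆ hfin.toFinset := fun α hα =>
    hfin.mem_toFinset.2 ((MvPolynomial.le_totalDegree hα).trans hQ)
  rw [coeffNorm_eq_sum_of_support_subset hsupp, Finset.sum_mul]
  exact Finset.sum_le_sum fun α _ => hcoeff Q hQ α

theorem exists_norm_gridEval_eq (d : ℕ) (Q : MvPolynomial (Fin n) ℂ) :
    ∃ k : Fin n → Fin (d + 1), ‖gridEval n d Q‖ = ‖Q.eval fun i => ((k i : ℕ) : ℂ)‖ := by
  obtain ⟨k, -, hk⟩ := Finset.exists_max_image Finset.univ (fun k => ‖gridEval n d Q k‖)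
    Finset.univ_nonempty
  exact ⟨k, ((pi_norm_le_iff_of_nonneg (norm_nonneg _)).2 fun i =>
    hk i (Finset.mem_univ i)).antisymm
    (norm_le_pi_norm (gridEval n d Q) k)⟩

/-! ### Integration by parts -/

theorem contDiff_of_forall_mem_tsupport {f : Eu n → ℂ} (h : ∀ x ∈ tsupport f, ContDiffAt ℝ ∞ f x) :
    ContDiff ℝ ∞ f :=
  contDiff_iff_contDiffAt.2 fun x => by
    by_cases hx : x ∈ tsupport f
    · exact h x hx
    · exact (contDiffAt_const (c := (0 : ℂ))).congr_of_eventuallyEq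
        (notMem_tsupport_iff_eventuallyEq.1 hx)

theorem contDiff_mul_of_tsupport_subset {U : Set (Eu n)} (hU : IsOpen U) {g u : Eu n → ℂ}
    (hg : ContDiffOn ℝ ∞ g U) (hu : ContDiff ℝ ∞ u) (hs : tsupport u ⊆ U) :
    ContDiff ℝ ∞ fun x => g x * u x :=
  contDiff_of_forall_mem_tsupport fun _ hx =>
    (contDiffAt_of_isOpen hU hg (hs (tsupport_mul_subset_right hx))).mul hu.contDiffAt

theorem integrable_mul_of_tsupport_subset {U : Set (Eu n)} (hU : IsOpen U) {g u : Eu n → ℂ}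
    (hg : ContDiffOn ℝ ∞ g U) (hu : ContDiff ℝ ∞ u) (hc : HasCompactSupport u)
    (hs : tsupport u ⊆ U) : Integrable fun x => g x * u x :=
  (contDiff_mul_of_tsupport_subset hU hg hu hs).continuous.integrable_of_hasCompactSupport
    hc.mul_left

theorem integral_mul_partialDeriv {U : Set (Eu n)} (hU : IsOpen U) {g u : Eu n → ℂ}
    (hg : ContDiffOn ℝ ∞ g U) (hu : ContDiff ℝ ∞ u) (hc : HasCompactSupport u)
    (hs : tsupport u ⊆ U) (k : Fin n) :
    ∫ x, g x * partialDeriv k u x = -∫ x, partialDeriv k g x * u x := by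
  have hc' : HasCompactSupport (partialDeriv k u) :=
    hc.mono' (subset_closure.trans (tsupport_partialDeriv_subset k u))
  refine integral_mul_fderiv_eq_neg_fderiv_mul_of_integrable
    (integrable_mul_of_tsupport_subset hU (contDiffOn_partialDeriv hU hg k) hu hc hs)
    (integrable_mul_of_tsupport_subset hU hg (contDiff_partialDeriv hu k) hc'
      ((tsupport_partialDeriv_subset k u).trans hs))
    (integrable_mul_of_tsupport_subset hU hg hu hc hs)
    (fun x hx => (contDiffAt_of_isOpen hU hg (hs hx)).differentiableAt (by simp))
    (fun x _ => hu.differentiable (by simp) x)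

theorem hasCompactSupport_iterPartialDeriv {u : Eu n → ℂ} (hc : HasCompactSupport u)
    (I : List (Fin n)) :
    HasCompactSupport (iterPartialDeriv I u) :=
  hc.mono' (subset_closure.trans (tsupport_iterPartialDeriv_subset I u))

theorem integral_mul_iterPartialDeriv {U : Set (Eu n)} (hU : IsOpen U) {g u : Eu n → ℂ}
    (hg : ContDiffOn ℝ ∞ g U) (hu : ContDiff ℝ ∞ u) (hc : HasCompactSupport u)
    (hs : tsupport u ⊆ U) (I : List (Fin n)) :
    ∫ x, g x * iterPartialDeriv I u x = (-1) ^ I.length * ∫ x, iterPartialDeriv I.reverse g x * u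
      x := by
  induction I generalizing g with
  | nil => simp
  | cons k I ih =>
    rw [iterPartialDeriv_cons, integral_mul_partialDeriv hU hg (contDiff_iterPartialDeriv hu I)
      (hasCompactSupport_iterPartialDeriv hc I)
      ((tsupport_iterPartialDeriv_subset I u).trans hs) k, ih (contDiffOn_partialDeriv hU hg k),
        List.reverse_cons,
      iterPartialDeriv_append, List.length_cons, pow_succ]
    simp

/-! ### The Fourier–Laplace transform -/

/-- The linear form `x ↦ i ∑_k x_k ζ_k`. -/
def phase (ζ : Fin n → ℂ) : Eu n →L[ℝ] ℂ :=
  Complex.I • ∑ k, ζ k • Complex.ofRealCLM.comp (EuclideanSpace.proj k)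

theorem phase_apply (ζ : Fin n → ℂ) (x : Eu n) : phase ζ x = Complex.I * ∑ k, (x k : ℂ) * ζ k := by
  simp [phase, mul_comm]

theorem phase_add_smul (ξ θ : Fin n → ℂ) (z : ℂ) (x : Eu n) :
    phase (fun k => ξ k + z * θ k) x = phase ξ x + z * phase θ x := by
  simp only [phase_apply, mul_add, Finset.sum_add_distrib, Finset.mul_sum]
  congr 1
  exact Finset.sum_congr rfl fun k _ => by ring

theorem re_phase (ζ : Fin n → ℂ) (x : Eu n) : (phase ζ x).re = ∑ k, -(x k * (ζ k).im) := by
  simp [phase_apply, Complex.re_sum, Complex.im_sum]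

theorem contDiff_exp_phase (ζ : Fin n → ℂ) : ContDiff ℝ ∞ fun x => Complex.exp (phase ζ x) :=
  (phase ζ).contDiff.cexp

theorem partialDeriv_exp_phase (ζ : Fin n → ℂ) (k : Fin n) :
    partialDeriv k (fun x => Complex.exp (phase ζ x)) =
      fun x => Complex.I * ζ k * Complex.exp (phase ζ x) := by
  funext x
  have hcoord : ∑ l, (((EuclideanSpace.single k (1 : ℝ) : Eu n) l : ℝ) : ℂ) * ζ l = ζ k := by
    rw [Finset.sum_eq_single k] <;> simp +contextual
  rw [partialDeriv, (phase ζ).hasFDerivAt.cexp.fderiv, _root_.smul_apply,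
    phase_apply ζ (EuclideanSpace.single k 1), hcoord, smul_eq_mul, mul_comm]

/-- The Fourier–Laplace transform `∫ f(x) exp(i ∑_k x_k ζ_k) dx`. -/
def fourierLaplace (f : Eu n → ℂ) (ζ : Fin n → ℂ) : ℂ := ∫ x, f x * Complex.exp (phase ζ x)

theorem integrable_mul_exp_phase {f : Eu n → ℂ} (hf : Continuous f) (hc : HasCompactSupport f)
    (ζ : Fin n → ℂ) : Integrable fun x => f x * Complex.exp (phase ζ x) :=
  integrable_mul_of_hasCompactSupport hf hc (contDiff_exp_phase ζ).continuous

theorem fourierLaplace_add {f g : Eu n → ℂ} (hf : Continuous f) (hfc : HasCompactSupport f)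
    (hg : Continuous g) (hgc : HasCompactSupport g) (ζ : Fin n → ℂ) :
    fourierLaplace (f + g) ζ = fourierLaplace f ζ + fourierLaplace g ζ := by
  rw [fourierLaplace, fourierLaplace, fourierLaplace,
    ← integral_add (integrable_mul_exp_phase hf hfc ζ) (integrable_mul_exp_phase hg hgc ζ)]
  simp only [Pi.add_apply, add_mul]

theorem fourierLaplace_const_smul (c : ℂ) (f : Eu n → ℂ) (ζ : Fin n → ℂ) :
    fourierLaplace (c • f) ζ = c * fourierLaplace f ζ := by
  rw [fourierLaplace, fourierLaplace, ← integral_const_mul]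
  simp only [Pi.smul_apply, smul_eq_mul, mul_assoc]

theorem fourierLaplace_partialDeriv {f : Eu n → ℂ} (hf : ContDiff ℝ ∞ f)
    (hc : HasCompactSupport f) (k : Fin n) (ζ : Fin n → ℂ) :
    fourierLaplace (partialDeriv k f) ζ = -(Complex.I * ζ k) * fourierLaplace f ζ := by
  have hparts := integral_mul_partialDeriv isOpen_univ (contDiff_exp_phase ζ).contDiffOn hf hc
    (Set.subset_univ _) k
  rw [partialDeriv_exp_phase] at hparts
  rw [fourierLaplace, fourierLaplace, neg_mul, ← integral_const_mul]
  simp only [mul_comm (partialDeriv k f _), mul_comm (f _)]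
  rw [hparts]
  simp only [mul_assoc]

theorem fourierLaplace_iterPartialDeriv {f : Eu n → ℂ} (hf : ContDiff ℝ ∞ f)
    (hc : HasCompactSupport f) (I : List (Fin n)) (ζ : Fin n → ℂ) :
    fourierLaplace (iterPartialDeriv I f) ζ =
      (-Complex.I) ^ I.length * (I.map ζ).prod * fourierLaplace f ζ := by
  induction I with
  | nil => simp
  | cons k I ih =>
    rw [iterPartialDeriv_cons, fourierLaplace_partialDeriv (contDiff_iterPartialDeriv hf I)
      (hasCompactSupport_iterPartialDeriv hc I), ih, List.map_cons, List.prod_cons,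
      List.length_cons]
    ring

theorem norm_exp_add_mul_mul_le {a b z z₀ : ℂ} (hz : ‖z - z₀‖ ≤ 1) :
    ‖Complex.exp (a + z * b) * b‖ ≤ Real.exp (‖a‖ + (‖z₀‖ + 1) * ‖b‖) * ‖b‖ := by
  have hz' : ‖z‖ ≤ ‖z₀‖ + 1 := by
    rw [← sub_add_cancel z z₀]
    exact (norm_add_le _ _).trans (by linarith)
  rw [norm_mul, Complex.norm_exp]
  gcongr
  calc (a + z * b).re ≤ ‖a + z * b‖ := Complex.re_le_norm _
    _ ≤ ‖a‖ + ‖z‖ * ‖b‖ := (norm_add_le _ _).trans_eq (by rw [norm_mul])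
    _ ≤ ‖a‖ + (‖z₀‖ + 1) * ‖b‖ := by gcongr

theorem differentiable_integral_mul_exp_add_mul {X : Type*} [TopologicalSpace X]
    [MeasurableSpace X] [OpensMeasurableSpace X] {μ : Measure X} [IsFiniteMeasureOnCompacts μ]
    {f a b : X → ℂ} (hf : Continuous f) (hc : HasCompactSupport f) (ha : Continuous a)
    (hb : Continuous b) :
    Differentiable ℂ fun z : ℂ => ∫ x, f x * Complex.exp (a x + z * b x) ∂μ := by
  intro z₀
  have hcont : ∀ z : ℂ, Continuous fun x => f x * Complex.exp (a x + z * b x) := fun z => by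
    fun_prop
  have hbound : Integrable
      (fun x => ‖f x‖ * (Real.exp (‖a x‖ + (‖z₀‖ + 1) * ‖b x‖) * ‖b x‖)) μ :=
    Continuous.integrable_of_hasCompactSupport (by fun_prop) hc.norm.mul_right
  refine (hasDerivAt_integral_of_dominated_loc_of_deriv_le
    (F' := fun z x => f x * (Complex.exp (a x + z * b x) * b x))
    (Metric.ball_mem_nhds z₀ one_pos)
    (.of_forall fun z =>
      ((hcont z).integrable_of_hasCompactSupport hc.mul_right).aestronglyMeasurable)
    ((hcont z₀).integrable_of_hasCompactSupport hc.mul_right)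
    (Continuous.integrable_of_hasCompactSupport (by fun_prop) hc.mul_right).aestronglyMeasurable
    (.of_forall fun x z hz => ?_) hbound (.of_forall fun x z _ => ?_)).2.differentiableAt
  · rw [norm_mul]
    exact mul_le_mul_of_nonneg_left (norm_exp_add_mul_mul_le (mem_ball_iff_norm.1 hz).le)
      (norm_nonneg _)
  · have hlin : HasDerivAt (fun z : ℂ => a x + z * b x) (b x) z := by
      simpa using ((hasDerivAt_id z).mul_const (b x)).const_add (a x)
    exact hlin.cexp.const_mul (f x)

theorem differentiable_fourierLaplace_line {f : Eu n → ℂ} (hf : Continuous f)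
    (hc : HasCompactSupport f) (ξ θ : Fin n → ℂ) :
    Differentiable ℂ fun z : ℂ => fourierLaplace f fun k => ξ k + z * θ k := by
  simp only [fourierLaplace, phase_add_smul]
  exact differentiable_integral_mul_exp_add_mul hf hc (phase ξ).continuous (phase θ).continuous

open FourierTransform in
theorem apply_zero_eq_integral_fourierLaplace {f : Eu n → ℂ} (hf : ContDiff ℝ ∞ f)
    (hc : HasCompactSupport f) :
    f 0 = ∫ ξ : Eu n, fourierLaplace f fun k => ((2 * Real.pi * ξ k : ℝ) : ℂ) := by
  let g : SchwartzMap (Eu n) ℂ := hc.toSchwartzMap hf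
  have hinv : (𝓕 (𝓕⁻ g)) 0 = f 0 := by
    rw [FourierTransform.fourier_fourierInv_eq g]
    rfl
  rw [← hinv, SchwartzMap.fourier_coe, Real.fourier_eq']
  refine integral_congr_ae (.of_forall fun ξ => ?_)
  simp only [inner_zero_right, mul_zero, Complex.ofReal_zero, zero_mul, Complex.exp_zero, one_smul]
  rw [SchwartzMap.fourierInv_coe, Real.fourierInv_eq', fourierLaplace]
  refine integral_congr_ae (.of_forall fun x => ?_)
  change Complex.exp _ * f x = f x * Complex.exp (phase _ x)
  rw [mul_comm, phase_apply, PiLp.inner_apply, mul_comm Complex.I]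
  congr 3
  push_cast
  rw [Finset.mul_sum]
  refine Finset.sum_congr rfl fun k _ => ?_
  simp only [RCLike.inner_apply, conj_trivial]
  push_cast
  ring

/-- The weight `1 + ∑_k |ζ_k|` measuring decay of Fourier–Laplace transforms. -/
def frequencyWeight (ζ : Fin n → ℂ) : ℝ := 1 + ∑ k, ‖ζ k‖

theorem one_le_frequencyWeight (ζ : Fin n → ℂ) : 1 ≤ frequencyWeight ζ :=
  le_add_of_nonneg_right (Finset.sum_nonneg fun _ _ => norm_nonneg _)

theorem frequencyWeight_pos (ζ : Fin n → ℂ) : 0 < frequencyWeight ζ :=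
  zero_lt_one.trans_le (one_le_frequencyWeight ζ)

theorem frequencyWeight_pow_mul_norm_fourierLaplace_le {f : Eu n → ℂ} (hf : ContDiff ℝ ∞ f)
    (hc : HasCompactSupport f) (ζ : Fin n → ℂ) {B : ℝ} (M : ℕ)
    (h : ∀ I : List (Fin n), I.length ≤ M → ‖fourierLaplace (iterPartialDeriv I f) ζ‖ ≤ B) :
    frequencyWeight ζ ^ M * ‖fourierLaplace f ζ‖ ≤ (n + 1) ^ M * B := by
  induction M generalizing f with
  | zero => simpa using h [] le_rfl
  | succ M ih =>
    have hone := ih hf hc fun I hI => h I (by omega)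
    have hcoord : ∀ k, frequencyWeight ζ ^ M * (‖ζ k‖ * ‖fourierLaplace f ζ‖) ≤
        (n + 1) ^ M * B := fun k => by
      have hk := ih (contDiff_partialDeriv hf k) (hasCompactSupport_iterPartialDeriv hc [k])
        fun I hI => iterPartialDeriv_append I [k] f ▸ h (I ++ [k]) (by simpa using hI)
      rwa [fourierLaplace_partialDeriv hf hc, norm_mul, norm_neg, norm_mul, Complex.norm_I,
        one_mul] at hk
    calc frequencyWeight ζ ^ (M + 1) * ‖fourierLaplace f ζ‖
        = frequencyWeight ζ ^ M * ‖fourierLaplace f ζ‖ +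
            ∑ k, frequencyWeight ζ ^ M * (‖ζ k‖ * ‖fourierLaplace f ζ‖) := by
          rw [← Finset.mul_sum, ← Finset.sum_mul, ← mul_add, ← one_add_mul, pow_succ, mul_assoc]
          rfl
      _ ≤ (n + 1) ^ M * B + ∑ _k : Fin n, (n + 1) ^ M * B :=
          add_le_add hone (Finset.sum_le_sum fun k _ => hcoord k)
      _ = (n + 1) ^ (M + 1) * B := by
          rw [Finset.sum_const, Finset.card_univ, Fintype.card_fin, nsmul_eq_mul]
          ring

/-- The strip of all `ζ` with `|Im ζ_k| ≤ 1` for all `k`. -/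
def strip (n : ℕ) : Set (Fin n → ℂ) := {ζ | ∀ k, |(ζ k).im| ≤ 1}

instance (n : ℕ) : Nonempty (strip n) := ⟨⟨0, fun _ => by simp⟩⟩

theorem re_phase_le {ζ : Fin n → ℂ} (hζ : ζ ∈ strip n) {x : Eu n} {R : ℝ} (hx : ‖x‖ ≤ R) :
    (phase ζ x).re ≤ n * R := by
  rw [re_phase]
  refine (Finset.sum_le_sum (g := fun _ => R) fun k _ => ?_).trans (by simp)
  calc -(x k * (ζ k).im) ≤ |x k| * |(ζ k).im| := (neg_le_abs _).trans_eq (abs_mul _ _)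
    _ ≤ |x k| := mul_le_of_le_one_right (abs_nonneg _) (hζ k)
    _ ≤ R := (PiLp.norm_apply_le x k).trans hx

theorem exists_norm_fourierLaplace_le {K : Set (Eu n)} (hK : IsCompact K) : ∃ C : ℝ, 0 ≤ C ∧
    ∀ (f : Eu n → ℂ) (B : ℝ), tsupport f ⊆ K → (∀ x ∈ K, ‖f x‖ ≤ B) → ∀ ζ ∈ strip n,
      ‖fourierLaplace f ζ‖ ≤ C * B := by
  obtain ⟨R, hR⟩ := hK.isBounded.exists_norm_le
  refine ⟨Real.exp (n * R) * volume.real K, by positivity, fun f B hf hB ζ hζ => ?_⟩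
  have hzero : ∀ x ∉ K, f x * Complex.exp (phase ζ x) = 0 := fun x hx => by
    rw [image_eq_zero_of_notMem_tsupport fun h => hx (hf h), zero_mul]
  rw [fourierLaplace, ← setIntegral_eq_integral_of_forall_compl_eq_zero hzero]
  refine (norm_setIntegral_le_of_norm_le_const hK.measure_lt_top
    (C := B * Real.exp (n * R)) fun x hx => ?_).trans (le_of_eq (by ring))
  rw [norm_mul, Complex.norm_exp]
  exact mul_le_mul (hB x hx) (Real.exp_le_exp.2 (re_phase_le hζ (hR x hx))) (Real.exp_pos _).le
    ((norm_nonneg _).trans (hB x hx))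

theorem exists_frequencyWeight_pow_mul_norm_fourierLaplace_le {K : Set (Eu n)} (hK : IsCompact K)
    (M : ℕ) : ∃ C : ℝ, 0 ≤ C ∧ ∀ f : Eu n → ℂ, ContDiff ℝ ∞ f → tsupport f ⊆ K →
      ∀ ζ ∈ strip n, frequencyWeight ζ ^ M * ‖fourierLaplace f ζ‖ ≤ C * supNorm K M f := by
  obtain ⟨C, hC, h⟩ := exists_norm_fourierLaplace_le hK
  refine ⟨(n + 1) ^ M * C, by positivity, fun f hf hfK ζ hζ => ?_⟩
  rw [mul_assoc]
  refine frequencyWeight_pow_mul_norm_fourierLaplace_le hf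
    (hK.of_isClosed_subset (isClosed_tsupport f) hfK) ζ M fun I hI => ?_
  refine h _ _ ((tsupport_iterPartialDeriv_subset I f).trans hfK) (fun x hx => ?_) ζ hζ
  exact norm_iterPartialDeriv_le_supNorm isOpen_univ hf.contDiffOn hK (Set.subset_univ _) hx hI

/-! ### Transposed differential operators -/

/-- The word that lists each variable `k` with multiplicity `α k`, in the order in which `dualDPow`
applies the derivatives. -/
def directions (α : Fin n →₀ ℕ) : List (Fin n) :=
  ((List.finRange n).flatMap fun k => List.replicate (α k) k).reverse

theorem prod_map_directions {M : Type*} [CommMonoid M] (α : Fin n →₀ ℕ) (f : Fin n → M) :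
    ((directions α).map f).prod = ∏ k, f k ^ α k := by
  rw [directions, List.map_reverse, List.prod_reverse, Fin.prod_univ_def]
  induction List.finRange n with
  | nil => rfl
  | cons k l ih => simp [List.flatMap_cons, List.map_append, List.prod_append, ih]

/-- The coefficient of `∂^α` in the transpose of `Q(D)`. -/
def transposeCoeff (Q : MvPolynomial (Fin n) ℂ) (α : Fin n →₀ ℕ) : ℂ :=
  Q.coeff α * Complex.I ^ (directions α).length

/-- The transpose `Q(-D) = ∑_α q_α (i∂)^α` of the operator `Q(D) = ∑_α q_α D^α`. -/
def transposeOp (Q : MvPolynomial (Fin n) ℂ) (f : Eu n → ℂ) : Eu n → ℂ :=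
  ∑ α ∈ Q.support, transposeCoeff Q α • iterPartialDeriv (directions α) f

theorem transposeOp_apply (Q : MvPolynomial (Fin n) ℂ) (f : Eu n → ℂ) (x : Eu n) :
    transposeOp Q f x =
      ∑ α ∈ Q.support, transposeCoeff Q α * iterPartialDeriv (directions α) f x := by
  simp [transposeOp, Finset.sum_apply]

theorem tsupport_transposeOp_subset (Q : MvPolynomial (Fin n) ℂ) (f : Eu n → ℂ) :
    tsupport (transposeOp Q f) ⊆ tsupport f := by
  refine closure_minimal (fun x hx => ?_) (isClosed_tsupport f)
  by_contra h
  refine hx ?_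
  rw [transposeOp_apply]
  refine Finset.sum_eq_zero fun α _ => ?_
  rw [image_eq_zero_of_notMem_tsupport fun h' => h (tsupport_iterPartialDeriv_subset _ _ h'),
    mul_zero]

/-- The operator `transposeOp Q` on `C^∞(ℝⁿ)`. -/
def SmoothFun.transposeOp (Q : MvPolynomial (Fin n) ℂ) : SmoothFun n →ₗ[ℂ] SmoothFun n :=
  ∑ α ∈ Q.support, transposeCoeff Q α • SmoothFun.iterPartialDeriv (directions α)

theorem SmoothFun.coe_transposeOp (Q : MvPolynomial (Fin n) ℂ) (f : SmoothFun n) :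
    (SmoothFun.transposeOp Q f).1 = Colombeau.transposeOp Q f.1 := by
  simp only [SmoothFun.transposeOp, Colombeau.transposeOp, LinearMap.sum_apply,
    LinearMap.smul_apply, Submodule.coe_sum, Submodule.coe_smul]
  rfl

/-- The iterated partial derivative along a word on test functions. -/
def testIterPartial (Ω : Opens (Eu n)) (I : List (Fin n)) : 𝓓(Ω, ℂ) →ₗ[ℂ] 𝓓(Ω, ℂ) :=
  I.foldr (fun k A => (testPartial Ω k).toLinearMap ∘ₗ A) LinearMap.id

theorem coe_testIterPartial (Ω : Opens (Eu n)) (I : List (Fin n)) (f : 𝓓(Ω, ℂ)) :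
    (testIterPartial Ω I f : Eu n → ℂ) = iterPartialDeriv I f := by
  induction I with
  | nil => rfl
  | cons k I ih =>
    rw [iterPartialDeriv_cons, ← ih]
    exact coe_testPartial k (testIterPartial Ω I f)

/-- The operator `transposeOp Q` on test functions. -/
def testTransposeOp (Ω : Opens (Eu n)) (Q : MvPolynomial (Fin n) ℂ) : 𝓓(Ω, ℂ) →ₗ[ℂ] 𝓓(Ω, ℂ) :=
  ∑ α ∈ Q.support, transposeCoeff Q α • testIterPartial Ω (directions α)

theorem coe_test_sum {ι : Type*} {Ω : Opens (Eu n)} (s : Finset ι) (f : ι → 𝓓(Ω, ℂ)) :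
    ((∑ i ∈ s, f i : 𝓓(Ω, ℂ)) : Eu n → ℂ) = ∑ i ∈ s, (f i : Eu n → ℂ) := by
  classical
  induction s using Finset.induction_on with
  | empty => rfl
  | insert a s ha ih => rw [Finset.sum_insert ha, Finset.sum_insert ha, ← ih]; rfl

theorem coe_testTransposeOp (Ω : Opens (Eu n)) (Q : MvPolynomial (Fin n) ℂ) (f : 𝓓(Ω, ℂ)) :
    (testTransposeOp Ω Q f : Eu n → ℂ) = transposeOp Q f := by
  rw [testTransposeOp, LinearMap.sum_apply, coe_test_sum, transposeOp]
  refine Finset.sum_congr rfl fun α _ => ?_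
  rw [← coe_testIterPartial]
  rfl

theorem fourierLaplace_transposeOp {f : Eu n → ℂ} (hf : ContDiff ℝ ∞ f) (hc : HasCompactSupport f)
    (Q : MvPolynomial (Fin n) ℂ) (ζ : Fin n → ℂ) :
    fourierLaplace (transposeOp Q f) ζ = Q.eval ζ * fourierLaplace f ζ := by
  have hsum : fourierLaplace (transposeOp Q f) ζ = ∑ α ∈ Q.support,
      transposeCoeff Q α * fourierLaplace (iterPartialDeriv (directions α) f) ζ := by
    simp only [fourierLaplace, transposeOp_apply, Finset.sum_mul, mul_assoc]
    rw [integral_finsetSum _ fun α _ =>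
      (integrable_mul_exp_phase (contDiff_iterPartialDeriv hf _).continuous
        (hasCompactSupport_iterPartialDeriv hc _) ζ).const_mul _]
    simp only [integral_const_mul]
  have hI : ∀ l : ℕ, Complex.I ^ l * (-Complex.I) ^ l = 1 := fun l => by
    rw [← mul_pow, mul_neg, Complex.I_mul_I, neg_neg, one_pow]
  rw [hsum, MvPolynomial.eval_eq', Finset.sum_mul]
  refine Finset.sum_congr rfl fun α _ => ?_
  rw [fourierLaplace_iterPartialDeriv hf hc, prod_map_directions, transposeCoeff]
  linear_combination (Q.coeff α * (∏ k, ζ k ^ α k) * fourierLaplace f ζ) *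
    hI (directions α).length

/-! ### Malgrange's inequality -/

theorem frequencyWeight_le_mul_of_norm_sub_le {ξ η : Fin n → ℂ} (h : ∀ k, ‖ξ k - η k‖ ≤ 1) :
    frequencyWeight ξ ≤ (n + 1) * frequencyWeight η := by
  have hsum : ∑ k, ‖ξ k‖ ≤ ∑ k, (1 + ‖η k‖) := Finset.sum_le_sum fun k _ => by
    linarith [norm_le_norm_add_norm_sub (η k) (ξ k), norm_sub_rev (η k) (ξ k), h k]
  have hn : (n : ℝ) ≤ n * frequencyWeight η :=
    le_mul_of_one_le_right (Nat.cast_nonneg _) (one_le_frequencyWeight η)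
  rw [Finset.sum_add_distrib, Finset.sum_const, Finset.card_univ, Fintype.card_fin,
    nsmul_eq_mul, mul_one] at hsum
  rw [add_one_mul]
  unfold frequencyWeight at *
  linarith

theorem one_add_norm_le_frequencyWeight (ξ : Eu n) :
    1 + ‖ξ‖ ≤ frequencyWeight fun k => ((2 * Real.pi * ξ k : ℝ) : ℂ) := by
  have hnorm : ‖ξ‖ ≤ ∑ k, ‖ξ k‖ := by
    conv_lhs => rw [← (EuclideanSpace.basisFun (Fin n) ℝ).sum_repr ξ]
    exact (norm_sum_le _ _).trans_eq (by simp [norm_smul])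
  refine add_le_add_right (hnorm.trans (Finset.sum_le_sum fun k _ => ?_)) 1
  rw [Complex.norm_real, norm_mul]
  refine le_mul_of_one_le_left (norm_nonneg _) ?_
  rw [Real.norm_of_nonneg (by positivity)]
  linarith [Real.pi_gt_three]

theorem exists_direction_norm_le_one {m : ℕ} {η : Fin n → ℝ} (hη : ∀ k, |η k| ≤ m)
    (ξ : Fin n → ℝ) : ∃ (t : ℝ) (θ : Fin n → ℝ), 0 ≤ t ∧
      t ≤ (n * m + 1) * frequencyWeight (fun k => (ξ k : ℂ)) ∧
      (∀ k, |θ k| ≤ 1) ∧ ∀ k, ξ k + t * θ k = η k := by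
  have hsum0 : 0 ≤ ∑ k, |η k - ξ k| := Finset.sum_nonneg fun _ _ => abs_nonneg _
  have ht : 0 < 1 + ∑ k, |η k - ξ k| := by linarith
  refine ⟨1 + ∑ k, |η k - ξ k|, fun k => (η k - ξ k) / (1 + ∑ k, |η k - ξ k|), ht.le, ?_,
    fun k => ?_, fun k => by rw [mul_div_cancel₀ _ ht.ne']; ring⟩
  · have hsum : ∑ k, |η k - ξ k| ≤ n * m + ∑ k, |ξ k| := by
      refine (Finset.sum_le_sum fun k _ => (abs_sub _ _).trans
        (add_le_add_left (hη k) |ξ k|)).trans_eq ?_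
      rw [Finset.sum_add_distrib, Finset.sum_const, Finset.card_univ, Fintype.card_fin,
        nsmul_eq_mul]
    have hW : frequencyWeight (fun k => (ξ k : ℂ)) = 1 + ∑ k, |ξ k| := by simp [frequencyWeight]
    have hnm : (n * m : ℝ) ≤ n * m * frequencyWeight (fun k => (ξ k : ℂ)) :=
      le_mul_of_one_le_right (by positivity) (one_le_frequencyWeight _)
    linarith
  · rw [abs_div, abs_of_pos ht, div_le_one ht]
    have hk := Finset.single_le_sum (f := fun k => |η k - ξ k|)
      (fun _ _ => abs_nonneg _) (Finset.mem_univ k)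
    linarith

/-- The restriction `z ↦ Q(ξ + zθ)` of a polynomial to a complex line. -/
def lineSection (Q : MvPolynomial (Fin n) ℂ) (ξ θ : Fin n → ℂ) : Polynomial ℂ :=
  MvPolynomial.aeval (fun k => Polynomial.C (ξ k) + Polynomial.C (θ k) * Polynomial.X) Q

theorem eval_lineSection (Q : MvPolynomial (Fin n) ℂ) (ξ θ : Fin n → ℂ) (z : ℂ) :
    (lineSection Q ξ θ).eval z = Q.eval fun k => ξ k + z * θ k := by
  rw [lineSection, ← Polynomial.coe_aeval_eq_eval, ← AlgHom.comp_apply, MvPolynomial.comp_aeval,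
    ← MvPolynomial.coe_aeval_eq_eval]
  simp only [map_add, map_mul, Polynomial.aeval_C, Polynomial.aeval_X, Algebra.algebraMap_self,
    RingHom.id_apply, mul_comm z]
  rfl

theorem natDegree_lineSection_le (Q : MvPolynomial (Fin n) ℂ) (ξ θ : Fin n → ℂ) :
    (lineSection Q ξ θ).natDegree ≤ Q.totalDegree := by
  have h := MvPolynomial.aeval_natDegree_le Q le_rfl
    (fun k => Polynomial.C (ξ k) + Polynomial.C (θ k) * Polynomial.X) (n := 1)
    (fun k => by compute_degree)
  rwa [mul_one] at h

section

variable {Q : MvPolynomial (Fin n) ℂ} {f : Eu n → ℂ} (hf : ContDiff ℝ ∞ f)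
  (hc : HasCompactSupport f) {M : ℕ} {B : ℝ}
  (hB : ∀ ζ ∈ strip n, frequencyWeight ζ ^ M * ‖fourierLaplace (transposeOp Q f) ζ‖ ≤ B)

include hf hc hB

theorem norm_eval_mul_fourierLaplace_line_le (ξ : Fin n → ℝ) {θ : Fin n → ℝ}
    (hθ : ∀ k, |θ k| ≤ 1) {z : ℂ} (hz : ‖z‖ ≤ 1) :
    ‖(Q.eval fun k => (ξ k : ℂ) + z * θ k) * fourierLaplace f fun k => (ξ k : ℂ) + z * θ k‖ ≤
      (n + 1) ^ M * B / frequencyWeight (fun k => (ξ k : ℂ)) ^ M := by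
  have hstrip : (fun k => (ξ k : ℂ) + z * θ k) ∈ strip n := fun k => by
    rw [Complex.add_im, Complex.ofReal_im, zero_add, Complex.im_mul_ofReal, abs_mul]
    exact mul_le_one₀ ((Complex.abs_im_le_norm z).trans hz) (abs_nonneg _) (hθ k)
  have hweight : frequencyWeight (fun k => (ξ k : ℂ)) ≤
      (n + 1) * frequencyWeight fun k => (ξ k : ℂ) + z * θ k :=
    frequencyWeight_le_mul_of_norm_sub_le fun k => by
      rw [sub_add_cancel_left, norm_neg, norm_mul, Complex.norm_real]
      exact mul_le_one₀ hz (norm_nonneg _) (hθ k)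
  rw [← fourierLaplace_transposeOp hf hc, le_div_iff₀ (pow_pos (frequencyWeight_pos _) M),
    mul_comm]
  calc frequencyWeight (fun k => (ξ k : ℂ)) ^ M * ‖fourierLaplace (transposeOp Q f) _‖
      ≤ ((n + 1) * frequencyWeight fun k => (ξ k : ℂ) + z * θ k) ^ M *
          ‖fourierLaplace (transposeOp Q f) fun k => (ξ k : ℂ) + z * θ k‖ := by
        gcongr
        exact (frequencyWeight_pos _).le
    _ ≤ (n + 1) ^ M * B := by
        rw [mul_pow, mul_assoc]
        exact mul_le_mul_of_nonneg_left (hB _ hstrip) (by positivity)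

theorem norm_eval_mul_norm_fourierLaplace_le {m : ℕ} (hm : Q.totalDegree ≤ m) {η : Fin n → ℝ}
    (hη : ∀ k, |η k| ≤ m) (ξ : Fin n → ℝ) :
    ‖Q.eval fun k => (η k : ℂ)‖ * ‖fourierLaplace f fun k => (ξ k : ℂ)‖ ≤
      ((1 + 2 * (m + 1) * (n * m + 2)) * frequencyWeight fun k => (ξ k : ℂ)) ^ m *
        ((n + 1) ^ M * B / frequencyWeight (fun k => (ξ k : ℂ)) ^ M) := by
  obtain ⟨t, θ, ht, htW, hθ, hend⟩ := exists_direction_norm_le_one hη ξ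
  set W := frequencyWeight fun k => (ξ k : ℂ)
  have hline : ∀ z : ℂ, ‖z‖ ≤ 1 → ‖(lineSection Q (fun k => ξ k) fun k => θ k).eval z *
      fourierLaplace f fun k => (ξ k : ℂ) + z * θ k‖ ≤ (n + 1) ^ M * B / W ^ M := fun z hz => by
    rw [eval_lineSection]
    exact norm_eval_mul_fourierLaplace_line_le hf hc hB ξ hθ hz
  have hbound := norm_polynomial_eval_mul_le _ ((natDegree_lineSection_le Q _ _).trans hm)
    (differentiable_fourierLaplace_line hf.continuous hc _ _) hline (t : ℂ)
  have hgrid : (fun k => (ξ k : ℂ) + t * θ k) = fun k => (η k : ℂ) := funext fun k => by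
    rw [← hend k]
    push_cast
    rfl
  rw [eval_lineSection, hgrid, norm_mul, Complex.norm_real, Real.norm_of_nonneg ht] at hbound
  simp only [zero_mul, add_zero] at hbound
  refine hbound.trans (mul_le_mul_of_nonneg_right (pow_le_pow_left₀ (by positivity) ?_ m)
    ((norm_nonneg _).trans (hline 0 (by simp))))
  have hW : 1 ≤ W := one_le_frequencyWeight _
  calc 1 + 2 * ((m : ℝ) + 1) * (1 + t) ≤ W + 2 * (m + 1) * (W + (n * m + 1) * W) := by gcongr
    _ = (1 + 2 * (m + 1) * (n * m + 2)) * W := by ring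

end

theorem integrable_inv_one_add_norm_pow (n : ℕ) :
    Integrable fun ξ : Eu n => ((1 + ‖ξ‖) ^ (n + 1))⁻¹ := by
  have h := integrable_one_add_norm (E := Eu n) (μ := volume) (r := (n + 1 : ℕ)) (by simp)
  refine h.congr (.of_forall fun ξ => ?_)
  change (1 + ‖ξ‖) ^ (-((n + 1 : ℕ) : ℝ)) = _
  rw [Real.rpow_neg (by positivity), Real.rpow_natCast]

theorem norm_eval_mul_norm_apply_zero_le {Q : MvPolynomial (Fin n) ℂ} {m : ℕ}
    (hm : Q.totalDegree ≤ m) {f : Eu n → ℂ} (hf : ContDiff ℝ ∞ f) (hc : HasCompactSupport f)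
    {B : ℝ} (hB : ∀ ζ ∈ strip n,
      frequencyWeight ζ ^ (m + (n + 1)) * ‖fourierLaplace (transposeOp Q f) ζ‖ ≤ B)
    {η : Fin n → ℝ} (hη : ∀ k, |η k| ≤ m) :
    ‖Q.eval fun k => (η k : ℂ)‖ * ‖f 0‖ ≤
      (1 + 2 * (m + 1) * (n * m + 2)) ^ m * (n + 1) ^ (m + (n + 1)) *
        (∫ ξ : Eu n, ((1 + ‖ξ‖) ^ (n + 1))⁻¹) * B := by
  set D : ℝ := (1 + 2 * (m + 1) * (n * m + 2)) ^ m * (n + 1) ^ (m + (n + 1))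
  have hB0 : 0 ≤ B := by
    obtain ⟨ζ, hζ⟩ := (inferInstance : Nonempty (strip n))
    exact le_trans (by have := frequencyWeight_pos ζ; positivity) (hB ζ hζ)
  have hpoint : ∀ ξ : Eu n, ‖(Q.eval fun k => (η k : ℂ)) *
      fourierLaplace f fun k => ((2 * Real.pi * ξ k : ℝ) : ℂ)‖ ≤
        D * B * ((1 + ‖ξ‖) ^ (n + 1))⁻¹ := fun ξ => by
    have hW := one_add_norm_le_frequencyWeight ξ
    rw [norm_mul]
    refine (norm_eval_mul_norm_fourierLaplace_le hf hc hB hm hη _).trans ?_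
    set W := frequencyWeight fun k => ((2 * Real.pi * ξ k : ℝ) : ℂ)
    have hW0 : 0 < W := frequencyWeight_pos _
    calc ((1 + 2 * (m + 1) * (n * m + 2)) * W) ^ m *
          ((n + 1) ^ (m + (n + 1)) * B / W ^ (m + (n + 1)))
        = D * B * (W ^ (n + 1))⁻¹ := by
          simp only [D, mul_pow, pow_add W]
          field_simp
      _ ≤ D * B * ((1 + ‖ξ‖) ^ (n + 1))⁻¹ := by gcongr
  rw [← norm_mul, apply_zero_eq_integral_fourierLaplace hf hc, ← integral_const_mul,
    mul_right_comm, ← integral_const_mul]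
  exact norm_integral_le_of_norm_le ((integrable_inv_one_add_norm_pow n).const_mul _)
    (.of_forall hpoint)

theorem exists_malgrange_bound (n m : ℕ) : ∃ (M : ℕ) (C : ℝ), 0 ≤ C ∧
    ∀ Q : MvPolynomial (Fin n) ℂ, Q.totalDegree ≤ m →
      ∀ f : Eu n → ℂ, ContDiff ℝ ∞ f → HasCompactSupport f → ∀ B : ℝ,
        (∀ ζ ∈ strip n, frequencyWeight ζ ^ M * ‖fourierLaplace (transposeOp Q f) ζ‖ ≤ B) →
          coeffNorm Q * ‖f 0‖ ≤ C * B := by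
  obtain ⟨C, hC, hgrid⟩ := exists_coeffNorm_le_norm_gridEval n m
  refine ⟨m + (n + 1), C * ((1 + 2 * (m + 1) * (n * m + 2)) ^ m * (n + 1) ^ (m + (n + 1)) *
    ∫ ξ : Eu n, ((1 + ‖ξ‖) ^ (n + 1))⁻¹), by positivity, fun Q hQ f hf hc B hB => ?_⟩
  obtain ⟨k, hk⟩ := exists_norm_gridEval_eq m Q
  have hη : ∀ i, |((k i : ℕ) : ℝ)| ≤ m := fun i => by
    rw [Nat.abs_cast]
    exact_mod_cast Nat.lt_succ_iff.1 (k i).2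
  have hzero := norm_eval_mul_norm_apply_zero_le hQ hf hc hB hη
  simp only [Complex.ofReal_natCast, ← hk] at hzero
  calc coeffNorm Q * ‖f 0‖ ≤ C * ‖gridEval n m Q‖ * ‖f 0‖ := by gcongr; exact hgrid Q hQ
    _ ≤ _ := by
        rw [mul_assoc, mul_assoc]
        exact mul_le_mul_of_nonneg_left hzero hC

/-! ### Fundamental solutions with bounds -/

theorem continuous_of_norm_le_supNorm {Ω : Opens (Eu n)} (L : 𝓓(Ω, ℂ) →ₗ[ℂ] ℂ)
    (hL : ∀ K : Set (Eu n), IsCompact K → K ⊆ Ω → ∃ (j : ℕ) (C : ℝ), 0 ≤ C ∧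
      ∀ f : 𝓓(Ω, ℂ), tsupport f ⊆ K → ‖L f‖ ≤ C * supNorm K j f) : Continuous L := by
  rw [TestFunction.continuous_iff_continuous_comp]
  intro K hKΩ
  obtain ⟨j, C, hC, h⟩ := hL K K.isCompact hKΩ
  refine (ContDiffMapSupportedIn.mkCLMtoNormedSpace (𝕜 := ℂ)
    (fun f => L (TestFunction.ofSupportedIn hKΩ f))
    (fun f g => map_add L (TestFunction.ofSupportedIn hKΩ f) (TestFunction.ofSupportedIn hKΩ g))
    (fun c f => map_smul L c (TestFunction.ofSupportedIn hKΩ f))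
    ⟨Finset.range (j + 1), C, hC, fun f => ?_⟩).continuous
  refine (h _ f.tsupport_subset).trans (mul_le_mul_of_nonneg_left ?_ hC)
  refine supNorm_le (apply_nonneg _ _) fun x _ i hi => ?_
  exact (ContDiffMapSupportedIn.norm_iteratedFDeriv_apply_le_seminorm_top ℂ).trans
    (Seminorm.le_finset_sup_apply (Finset.mem_range.2 (Nat.lt_succ_of_le hi)))

theorem bddAbove_frequencyWeight_pow_mul_norm_fourierLaplace (M : ℕ)
    (f : 𝓓((⊤ : Opens (Eu n)), ℂ)) : BddAbove (Set.range fun ζ : strip n =>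
      frequencyWeight ζ.1 ^ M * ‖fourierLaplace f ζ.1‖) := by
  obtain ⟨C, -, h⟩ := exists_frequencyWeight_pow_mul_norm_fourierLaplace_le f.hasCompactSupport M
  exact ⟨C * supNorm (tsupport f) M f, Set.forall_mem_range.2 fun ζ =>
    h f (contDiff_test f) subset_rfl ζ ζ.2⟩

/-- The seminorm `sup_ζ (1 + |ζ|)^M |∫ f(x) exp(i ∑_k x_k ζ_k) dx|`, where `ζ` runs over the
strip. -/
def stripSeminorm (n M : ℕ) : Seminorm ℂ 𝓓((⊤ : Opens (Eu n)), ℂ) :=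
  Seminorm.of (fun f => ⨆ ζ : strip n, frequencyWeight ζ.1 ^ M * ‖fourierLaplace f ζ.1‖)
    (fun f g => by
      refine ciSup_le fun ζ => le_trans ?_ (add_le_add
        (le_ciSup (bddAbove_frequencyWeight_pow_mul_norm_fourierLaplace M f) ζ)
        (le_ciSup (bddAbove_frequencyWeight_pow_mul_norm_fourierLaplace M g) ζ))
      rw [FunLike.coe_add, fourierLaplace_add (contDiff_test f).continuous f.hasCompactSupport
        (contDiff_test g).continuous g.hasCompactSupport, ← mul_add]
      exact mul_le_mul_of_nonneg_left (norm_add_le _ _) (pow_nonneg (frequencyWeight_pos _).le M))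
    (fun c f => by
      rw [Real.mul_iSup_of_nonneg (norm_nonneg c)]
      refine iSup_congr fun ζ => ?_
      rw [FunLike.coe_smul, fourierLaplace_const_smul, norm_mul, mul_left_comm])

theorem le_stripSeminorm (M : ℕ) (f : 𝓓((⊤ : Opens (Eu n)), ℂ)) {ζ : Fin n → ℂ}
    (hζ : ζ ∈ strip n) : frequencyWeight ζ ^ M * ‖fourierLaplace f ζ‖ ≤ stripSeminorm n M f :=
  le_ciSup (bddAbove_frequencyWeight_pow_mul_norm_fourierLaplace M f) ⟨ζ, hζ⟩

theorem exists_stripSeminorm_le {K : Set (Eu n)} (hK : IsCompact K) (M : ℕ) : ∃ C : ℝ, 0 ≤ C ∧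
    ∀ f : 𝓓((⊤ : Opens (Eu n)), ℂ), tsupport f ⊆ K → stripSeminorm n M f ≤ C * supNorm K M f := by
  obtain ⟨C, hC, h⟩ := exists_frequencyWeight_pow_mul_norm_fourierLaplace_le hK M
  exact ⟨C, hC, fun f hf => ciSup_le fun ζ => h f (contDiff_test f) hf ζ ζ.2⟩

theorem continuous_of_norm_le_stripSeminorm (L : 𝓓((⊤ : Opens (Eu n)), ℂ) →ₗ[ℂ] ℂ) {C : ℝ}
    (hC : 0 ≤ C) {M : ℕ} (hL : ∀ f, ‖L f‖ ≤ C * stripSeminorm n M f) : Continuous L := by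
  refine continuous_of_norm_le_supNorm L fun K hK _ => ?_
  obtain ⟨CK, hCK, h⟩ := exists_stripSeminorm_le hK M
  refine ⟨M, C * CK, mul_nonneg hC hCK, fun f hf => (hL f).trans ?_⟩
  rw [mul_assoc]
  exact mul_le_mul_of_nonneg_left (h f hf) hC

theorem exists_fundamental_distribution (n m : ℕ) : ∃ (M : ℕ) (C : ℝ), 0 ≤ C ∧
    ∀ Q : MvPolynomial (Fin n) ℂ, Q.totalDegree ≤ m → 0 < coeffNorm Q →
      ∃ E : 𝓓((⊤ : Opens (Eu n)), ℂ) →L[ℂ] ℂ, (∀ f, E (testTransposeOp ⊤ Q f) = f 0) ∧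
        ∀ f, ‖E f‖ ≤ (coeffNorm Q)⁻¹ * C * stripSeminorm n M f := by
  obtain ⟨M, C, hC, hmalgrange⟩ := exists_malgrange_bound n m
  refine ⟨M, C, hC, fun Q hm hQ => ?_⟩
  have hcoef : 0 ≤ (coeffNorm Q)⁻¹ * C := by positivity
  let c : NNReal := ⟨_, hcoef⟩
  let evalZero : 𝓓((⊤ : Opens (Eu n)), ℂ) →ₗ[ℂ] ℂ :=
    { toFun := fun f => f 0, map_add' := fun _ _ => rfl, map_smul' := fun _ _ => rfl }
  obtain ⟨E, hE, hbound⟩ := exists_comp_eq_of_norm_le_seminorm (testTransposeOp ⊤ Q) evalZero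
    (c • stripSeminorm n M) (fun f => by
      change ‖f 0‖ ≤ (coeffNorm Q)⁻¹ * C * stripSeminorm n M (testTransposeOp ⊤ Q f)
      rw [mul_assoc, ← div_eq_inv_mul, le_div_iff₀ hQ, mul_comm]
      refine hmalgrange Q hm f (contDiff_test f) f.hasCompactSupport _ fun ζ hζ => ?_
      rw [← coe_testTransposeOp ⊤]
      exact le_stripSeminorm M _ hζ)
  exact ⟨⟨E, continuous_of_norm_le_stripSeminorm E hcoef hbound⟩, hE, hbound⟩

/-! ### Lower bounds for the coefficients -/

theorem tendsto_coe_atZero : Tendsto (fun ε : Idx => (ε : ℝ)) atZero (𝓝 0) :=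
  tendsto_comap

section DominatedIdeal

variable {𝕜 : Type} [RCLike 𝕜] {σ : Idx → ℝ}

theorem IsNegligible.tendsto_zero {F : Type*} [NormedAddCommGroup F] {u : Idx → F}
    (hu : IsNegligible u) : Tendsto u atZero (𝓝 0) :=
  (hu 1).trans_tendsto (by simpa only [pow_one] using tendsto_coe_atZero)

/-- The ideal of the generalized numbers that are `O(ε^{-N} σ_ε)` for some `N`. It serves to
exploit invertibility algebraically: if it contains a unit, then `σ_ε` is bounded below by a power
of `ε`. -/
def dominatedIdeal (𝕜 : Type) [RCLike 𝕜] (σ : Idx → ℝ) : Ideal (GenNum 𝕜) where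
  carrier := {z | ∃ r : Idx → 𝕜, Represents r z ∧
    ∃ N : ℕ, r =O[atZero] fun ε => ((ε : ℝ)⁻¹) ^ N * σ ε}
  zero_mem' := ⟨_, represents_zero, 0, isBigO_zero _ _⟩
  add_mem' := by
    rintro z w ⟨r, hr, M, hM⟩ ⟨s, hs, N, hN⟩
    exact ⟨_, hr.add hs, max M N,
      (hM.trans ((isBigO_inv_pow (le_max_left M N)).mul (isBigO_refl σ _))).add
        (hN.trans ((isBigO_inv_pow (le_max_right M N)).mul (isBigO_refl σ _)))⟩
  smul_mem' := by
    rintro a z ⟨r, hr, M, hM⟩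
    obtain ⟨N, hN⟩ := a.represents_rep.isModerate
    exact ⟨_, a.represents_rep.mul hr, N + M, by simpa only [pow_add, mul_assoc] using hN.mul hM⟩

theorem mem_dominatedIdeal_of_norm_le {r : Idx → 𝕜} {z : GenNum 𝕜} (hr : Represents r z)
    (h : ∀ ε, ‖r ε‖ ≤ σ ε) : z ∈ dominatedIdeal 𝕜 σ :=
  ⟨r, hr, 0, IsBigO.of_norm_le fun ε => by simpa only [pow_zero, one_mul] using h ε⟩

theorem abs_mem_dominatedIdeal {z : GenC} (hz : z ∈ dominatedIdeal ℂ σ) :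
    z.abs ∈ dominatedIdeal ℝ σ := by
  obtain ⟨r, hr, N, hN⟩ := hz
  exact ⟨_, hr.abs, N, hN.norm_left⟩

theorem sqrt_sum_sq_mem_dominatedIdeal {ι : Type*} {s : Finset ι} {z : ι → GenR}
    (hz : ∀ i, z i ∈ dominatedIdeal ℝ σ) :
    GenNum.sqrt (∑ i ∈ s, z i ^ 2) ∈ dominatedIdeal ℝ σ := by
  choose r hr N hN using hz
  have hsum : (fun ε => ∑ i ∈ s, ‖r i ε‖) =O[atZero]
      fun ε => ((ε : ℝ)⁻¹) ^ (s.sup N) * σ ε :=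
    IsBigO.fun_sum fun i hi => (hN i).norm_left.trans
      ((isBigO_inv_pow (Finset.le_sup hi)).mul (isBigO_refl σ _))
  refine ⟨fun ε => √(∑ i ∈ s, r i ε ^ 2), Represents.sqrt (Represents.sum _ fun i _ => ?_), _,
    (IsBigO.of_norm_le fun ε => ?_).trans hsum⟩
  · simpa only [sq] using (hr i).mul (hr i)
  · simp only [Real.norm_of_nonneg (Real.sqrt_nonneg _), ← sq_abs (r _ ε), ← Real.norm_eq_abs]
    exact Real.sqrt_le_iff.2 ⟨Finset.sum_nonneg fun _ _ => norm_nonneg _,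
      Finset.sum_sq_le_sq_sum_of_nonneg fun _ _ => norm_nonneg _⟩

theorem exists_eventually_pow_le_of_isUnit_mem {z : GenNum 𝕜} (hz : IsUnit z)
    (hzσ : z ∈ dominatedIdeal 𝕜 σ) (hσ : ∀ ε, 0 ≤ σ ε) :
    ∃ N : ℕ, ∀ᶠ ε : Idx in atZero, (ε : ℝ) ^ N ≤ σ ε := by
  have hone : (1 : GenNum 𝕜) ∈ dominatedIdeal 𝕜 σ :=
    (Ideal.eq_top_of_isUnit_mem _ hzσ hz) ▸ Submodule.mem_top
  obtain ⟨r, hr, N, hN⟩ := hone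
  obtain ⟨C, hC⟩ := hN.bound
  obtain ⟨M, hM⟩ := (isModerate_const (2 * C)).exists_eventually_norm_le
  have hr_near : ∀ᶠ ε in atZero, ‖r ε - 1‖ < 1 / 2 :=
    (hr.isNegligible_sub represents_one).tendsto_zero.norm.eventually
      (gt_mem_nhds (by rw [norm_zero]; norm_num))
  refine ⟨M + N, ?_⟩
  filter_upwards [hC, hM, hr_near] with ε hrσ h2C hr1
  have hε : (0 : ℝ) < ε := ε.2.1
  have h_one : (1 : ℝ) ≤ ((ε : ℝ)⁻¹) ^ (M + N) * σ ε := by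
    have hhalf : 1 / 2 ≤ ‖r ε‖ := by
      have := norm_sub_norm_le (1 : 𝕜) (r ε)
      rw [norm_one, norm_sub_rev] at this
      linarith
    rw [Real.norm_of_nonneg (mul_nonneg (inv_coe_pow_pos ε N).le (hσ ε))] at hrσ
    calc (1 : ℝ) ≤ 2 * ‖r ε‖ := by linarith
      _ ≤ 2 * C * (((ε : ℝ)⁻¹) ^ N * σ ε) := by linarith
      _ ≤ ((ε : ℝ)⁻¹) ^ M * (((ε : ℝ)⁻¹) ^ N * σ ε) :=
        mul_le_mul_of_nonneg_right ((le_abs_self _).trans h2C)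
          (mul_nonneg (inv_coe_pow_pos ε N).le (hσ ε))
      _ = ((ε : ℝ)⁻¹) ^ (M + N) * σ ε := by rw [pow_add, mul_assoc]
  rwa [inv_pow, inv_mul_eq_div, one_le_div (pow_pos hε _)] at h_one

end DominatedIdeal

section PolyNet

theorem coeff_pderiv_pow_mem {P : MvPolynomial (Fin n) GenC} {J : Ideal GenC}
    (hP : ∀ β, P.coeff β ∈ J) (k : Fin n) (m : ℕ) (β : Fin n →₀ ℕ) :
    ((((MvPolynomial.pderiv k).toLinearMap :
      Module.End GenC (MvPolynomial (Fin n) GenC)) ^ m) P).coeff β ∈ J := by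
  induction m generalizing β with
  | zero => exact hP β
  | succ m ih =>
    rw [pow_succ', Module.End.mul_apply, Derivation.coeFn_coe, MvPolynomial.coeff_pderiv]
    exact J.mul_mem_right _ (ih _)

theorem coeff_polyDeriv_mem {P : MvPolynomial (Fin n) GenC} {J : Ideal GenC}
    (hP : ∀ β, P.coeff β ∈ J) (α β : Fin n →₀ ℕ) : (polyDeriv P α).coeff β ∈ J := by
  rw [polyDeriv]
  induction List.finRange n generalizing β with
  | nil => exact hP β
  | cons k l ih =>
    rw [List.map_cons, List.prod_cons, Module.End.mul_apply]
    exact coeff_pderiv_pow_mem ih k _ β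

theorem eval_mem_of_coeff_mem {σ R : Type*} [CommSemiring R] {J : Ideal R} {P : MvPolynomial σ R}
    (hP : ∀ β, P.coeff β ∈ J) (x : σ → R) : P.eval x ∈ J := by
  rw [MvPolynomial.eval_eq]
  exact J.sum_mem fun β _ => J.mul_mem_right _ (hP β)

/-- Polynomials `P_ε` with complex coefficients representing the polynomial `P`. -/
def polyNet (P : MvPolynomial (Fin n) GenC) (ε : Idx) : MvPolynomial (Fin n) ℂ :=
  ∑ α ∈ P.support, MvPolynomial.monomial α ((P.coeff α).rep.1 ε)

theorem support_polyNet_subset (P : MvPolynomial (Fin n) GenC) (ε : Idx) :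
    (polyNet P ε).support ⊆ P.support := by
  classical
  intro α hα
  by_contra h
  refine MvPolynomial.mem_support_iff.1 hα ?_
  simp only [polyNet, MvPolynomial.coeff_sum, MvPolynomial.coeff_monomial,
    Finset.sum_ite_eq', if_neg h]

theorem totalDegree_polyNet_le (P : MvPolynomial (Fin n) GenC) (ε : Idx) :
    (polyNet P ε).totalDegree ≤ P.totalDegree :=
  Finset.sup_mono (support_polyNet_subset P ε)

theorem represents_coeff_polyNet (P : MvPolynomial (Fin n) GenC) (α : Fin n →₀ ℕ) :
    Represents (fun ε => (polyNet P ε).coeff α) (P.coeff α) := by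
  classical
  simp only [polyNet, MvPolynomial.coeff_sum, MvPolynomial.coeff_monomial, Finset.sum_ite_eq']
  split_ifs with hα
  · exact (P.coeff α).represents_rep
  · rw [MvPolynomial.notMem_support_iff.1 hα]
    exact represents_zero

theorem norm_coeff_le_coeffNorm (Q : MvPolynomial (Fin n) ℂ) (α : Fin n →₀ ℕ) :
    ‖Q.coeff α‖ ≤ coeffNorm Q := by
  rw [coeffNorm_eq_sum_of_support_subset (Finset.subset_insert α Q.support)]
  exact Finset.single_le_sum (f := fun β => ‖Q.coeff β‖) (fun _ _ => norm_nonneg _)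
    (Finset.mem_insert_self α _)

theorem coeff_mem_dominatedIdeal_coeffNorm (P : MvPolynomial (Fin n) GenC) (α : Fin n →₀ ℕ) :
    P.coeff α ∈ dominatedIdeal ℂ fun ε => coeffNorm (polyNet P ε) :=
  mem_dominatedIdeal_of_norm_le (represents_coeff_polyNet P α)
    fun ε => norm_coeff_le_coeffNorm (polyNet P ε) α

theorem exists_eventually_pow_le_coeffNorm {P : MvPolynomial (Fin n) GenC} {ξ : Eu n}
    (h : IsUnit (tildeFn P ξ)) :
    ∃ N : ℕ, ∀ᶠ ε : Idx in atZero, (ε : ℝ) ^ N ≤ coeffNorm (polyNet P ε) := by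
  refine exists_eventually_pow_le_of_isUnit_mem h ?_ fun ε => coeffNorm_nonneg _
  rw [tildeFn, Finset.sum_sigma']
  exact sqrt_sum_sq_mem_dominatedIdeal fun i => abs_mem_dominatedIdeal
    (eval_mem_of_coeff_mem (coeff_polyDeriv_mem (coeff_mem_dominatedIdeal_coeffNorm P) i.2) _)

end PolyNet

/-! ### `P(D)` on the level of nets -/

section TransposeNet

variable {Ω V : Opens (Eu n)}

/-- Iterated partial derivatives on `𝓔_{c,M}(Ω)`. -/
def EcM.iterPartialDeriv (Ω : Opens (Eu n)) (I : List (Fin n)) (u : EcM Ω) : EcM Ω :=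
  I.foldr (fun k v => EcM.partial Ω k v) u

theorem EcM.coe_iterPartialDeriv (I : List (Fin n)) (u : EcM Ω) (ε : Idx) :
    (EcM.iterPartialDeriv Ω I u).1 ε = testIterPartial Ω I (u.1 ε) := by
  induction I with
  | nil => rfl
  | cons k I ih => exact congrArg (testPartial Ω k) ih

theorem isModerate_transposeCoeff (P : MvPolynomial (Fin n) GenC) (α : Fin n →₀ ℕ) :
    IsModerate fun ε => transposeCoeff (polyNet P ε) α :=
  (represents_coeff_polyNet P α).isModerate.mul (isModerate_const _)

/-- The transpose of `P(D)` on `𝓔_{c,M}(Ω)`. -/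
def EcM.transposeOp (P : MvPolynomial (Fin n) GenC) (u : EcM Ω) : EcM Ω :=
  ∑ α ∈ P.support, (⟨_, isModerate_transposeCoeff P α⟩ : moderateNets ℂ) •
    EcM.iterPartialDeriv Ω (directions α) u

theorem EcM.coe_transposeOp (P : MvPolynomial (Fin n) GenC) (u : EcM Ω) (ε : Idx) :
    (EcM.transposeOp P u).1 ε = testTransposeOp Ω (polyNet P ε) (u.1 ε) := by
  have hsum : testTransposeOp Ω (polyNet P ε) (u.1 ε) = ∑ α ∈ P.support,
      transposeCoeff (polyNet P ε) α • testIterPartial Ω (directions α) (u.1 ε) := by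
    rw [testTransposeOp, LinearMap.sum_apply]
    refine Finset.sum_subset (support_polyNet_subset P ε) fun α _ hα => ?_
    rw [LinearMap.smul_apply, transposeCoeff, MvPolynomial.notMem_support_iff.1 hα, zero_mul,
      zero_smul]
  rw [hsum, EcM.transposeOp, Submodule.coe_sum, Finset.sum_apply]
  exact Finset.sum_congr rfl fun α _ =>
    congrArg (transposeCoeff (polyNet P ε) α • ·) (EcM.coe_iterPartialDeriv (directions α) u ε)

theorem dualD_mk (k : Fin n) (T : Functional Ω) (u : EcM Ω) :
    dualD Ω k T (Gc.mk u) = GenNum.const Complex.I * T (Gc.mk (EcM.partial Ω k u)) := by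
  have hneg : (GenNum.const (-Complex.I) : GenC) = -GenNum.const Complex.I := rfl
  change (GenNum.const (-Complex.I) : GenC) * -(T (Gc.mk (EcM.partial Ω k u))) = _
  rw [hneg, neg_mul_neg]

theorem prod_map_dualD_mk (L : List (Fin n)) (T : Functional Ω) (u : EcM Ω) :
    (L.map (dualD Ω)).prod T (Gc.mk u) = GenNum.const (Complex.I ^ L.length) *
      T (Gc.mk (EcM.iterPartialDeriv Ω L.reverse u)) := by
  induction L generalizing u with
  | nil =>
    have hone : (GenNum.const (Complex.I ^ 0) : GenC) = 1 := by
      rw [pow_zero]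
      rfl
    rw [List.length_nil, hone, one_mul]
    rfl
  | cons k L ih =>
    rw [List.map_cons, List.prod_cons, Module.End.mul_apply, dualD_mk, ih, ← mul_assoc,
      ← GenNum.const_mul, ← pow_succ', List.length_cons]
    congr 3
    rw [EcM.iterPartialDeriv, EcM.iterPartialDeriv, List.reverse_cons, List.foldr_append]
    rfl

theorem dualDPow_mk (α : Fin n →₀ ℕ) (T : Functional Ω) (u : EcM Ω) :
    dualDPow Ω α T (Gc.mk u) = GenNum.const (Complex.I ^ (directions α).length) *
      T (Gc.mk (EcM.iterPartialDeriv Ω (directions α) u)) := by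
  have hprod : dualDPow Ω α =
      (((List.finRange n).flatMap fun k => List.replicate (α k) k).map (dualD Ω)).prod := by
    rw [dualDPow]
    induction List.finRange n with
    | nil => rfl
    | cons k l ih =>
      rw [List.map_cons, List.prod_cons, ih, List.flatMap_cons, List.map_append,
        List.prod_append, List.map_replicate, List.prod_replicate]
  rw [hprod, prod_map_dualD_mk, directions, List.length_reverse]

theorem applyOp_mk (P : MvPolynomial (Fin n) GenC) (T : Functional Ω) (u : EcM Ω) :
    applyOp P T (Gc.mk u) = T (Gc.mk (EcM.transposeOp P u)) := by
  rw [applyOp, EcM.transposeOp, Gc.mk_sum, map_sum, LinearMap.sum_apply]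
  refine Finset.sum_congr rfl fun α _ => ?_
  rw [Gc.mk_smul, map_smul, LinearMap.smul_apply, dualDPow_mk, smul_eq_mul, smul_eq_mul,
    ← mul_assoc]
  congr 1
  obtain ⟨hr, hα⟩ := represents_coeff_polyNet P α
  rw [← hα, GenNum.const, ← map_mul]
  rfl

theorem extend_transposeOp (h : V ≤ Ω) (P : MvPolynomial (Fin n) GenC) (u : EcM V) :
    EcM.extend h (EcM.transposeOp P u) = EcM.transposeOp P (EcM.extend h u) := by
  refine Subtype.ext (funext fun ε => DFunLike.coe_injective ?_)
  change ((EcM.transposeOp P u).1 ε : Eu n → ℂ) = (EcM.transposeOp P (EcM.extend h u)).1 ε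
  rw [EcM.coe_transposeOp, EcM.coe_transposeOp, coe_testTransposeOp, coe_testTransposeOp]
  rfl

theorem restrict_applyOp (h : V ≤ Ω) (P : MvPolynomial (Fin n) GenC) (T : Functional Ω) :
    (applyOp P T).restrict h = applyOp P (T.restrict h) := by
  ext x
  obtain ⟨u, rfl⟩ := Gc.mk_surjective x
  rw [restrict_mk, applyOp_mk, applyOp_mk, restrict_mk, extend_transposeOp]

end TransposeNet

/-! ### Existence of a basic fundamental solution -/

theorem isModerateDistNet_of_norm_le_stripSeminorm
    {S : Idx → 𝓓((⊤ : Opens (Eu n)), ℂ) →L[ℂ] ℂ} {a : Idx → ℝ} (ha : IsModerate a) {M : ℕ}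
    (h : ∀ᶠ ε in atZero, ∀ f, ‖S ε f‖ ≤ a ε * stripSeminorm n M f) : IsModerateDistNet S := by
  intro K hK _
  obtain ⟨B, hB, hstrip⟩ := exists_stripSeminorm_le hK M
  obtain ⟨N, hN⟩ := ha.exists_eventually_norm_le
  obtain ⟨η, hη⟩ := exists_forall_le_of_eventually_atZero (h.and hN)
  refine ⟨M, N, B + 1, η, by positivity, fun f hf ε hε => ?_⟩
  have hsup := supNorm_nonneg (K := K) (j := M) f
  have hpos := inv_coe_pow_pos ε N
  calc ‖S ε f‖ ≤ a ε * stripSeminorm n M f := (hη ε hε).1 f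
    _ ≤ ((ε : ℝ)⁻¹) ^ N * (B * supNorm K M f) :=
      mul_le_mul ((le_abs_self _).trans (hη ε hε).2) (hstrip f hf) (apply_nonneg _ _) hpos.le
    _ = B * ((ε : ℝ)⁻¹) ^ N * supNorm K M f := by ring
    _ ≤ (B + 1) * ((ε : ℝ)⁻¹) ^ N * supNorm K M f := by
      gcongr
      linarith

theorem isModerate_inv_of_eventually_pow_le {a : Idx → ℝ} {N : ℕ}
    (h : ∀ᶠ ε : Idx in atZero, (ε : ℝ) ^ N ≤ a ε) : IsModerate fun ε => (a ε)⁻¹ := by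
  refine ⟨N, IsBigO.of_bound 1 (h.mono fun ε hε => ?_)⟩
  have hpos := pow_pos ε.2.1 N
  rw [one_mul, inv_pow, norm_inv, norm_inv, Real.norm_of_nonneg hpos.le,
    Real.norm_of_nonneg (hpos.le.trans hε)]
  exact inv_anti₀ hpos hε

theorem exists_isBasic_isFundamentalSolution {P : MvPolynomial (Fin n) GenC}
    (hP : ∃ ξ : Eu n, IsUnit (tildeFn P ξ)) :
    ∃ E : Functional (⊤ : Opens (Eu n)), IsBasic E ∧ IsFundamentalSolution P E := by
  obtain ⟨ξ, hξ⟩ := hP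
  obtain ⟨N, hN⟩ := exists_eventually_pow_le_coeffNorm hξ
  obtain ⟨M, C, -, hE⟩ := exists_fundamental_distribution n P.totalDegree
  have hS : ∀ ε : Idx, ∃ E : 𝓓((⊤ : Opens (Eu n)), ℂ) →L[ℂ] ℂ, 0 < coeffNorm (polyNet P ε) →
      (∀ f, E (testTransposeOp ⊤ (polyNet P ε) f) = f 0) ∧
      ∀ f, ‖E f‖ ≤ (coeffNorm (polyNet P ε))⁻¹ * C * stripSeminorm n M f := fun ε => by
    by_cases hpos : 0 < coeffNorm (polyNet P ε)
    · obtain ⟨E, hE⟩ := hE (polyNet P ε) (totalDegree_polyNet_le P ε) hpos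
      exact ⟨E, fun _ => hE⟩
    · exact ⟨0, fun h => absurd h hpos⟩
  choose S hS using hS
  have hpos : ∀ᶠ ε in atZero, 0 < coeffNorm (polyNet P ε) :=
    hN.mono fun ε hε => (pow_pos ε.2.1 N).trans_le hε
  have hmod : IsModerateDistNet S := isModerateDistNet_of_norm_le_stripSeminorm
    ((isModerate_inv_of_eventually_pow_le hN).mul (isModerate_const C))
    (hpos.mono fun ε hε => (hS ε hε).2)
  refine ⟨Functional.ofNet S hmod, Functional.isBasic_ofNet hmod, ?_⟩
  rw [IsFundamentalSolution]
  ext x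
  obtain ⟨u, rfl⟩ := Gc.mk_surjective x
  rw [applyOp_mk]
  refine ((Functional.represents_ofNet hmod (EcM.transposeOp P u)).congr' ?_).unique
    (represents_delta u)
  filter_upwards [hpos] with ε hε
  rw [EcM.coe_transposeOp, (hS ε hε).1]

/-! ### Regular nets -/

/-- A regular scale: a class of growth exponents `N : ℕ → ℕ`, where `ε^{-N j}` bounds the
derivatives of order `j`, that is stable under the operations that occur when nets of smooth
functions are added, multiplied by moderate constants and differentiated. -/
structure IsRegularScale (ℛ : Set (ℕ → ℕ)) : Prop where
  nonempty : ℛ.Nonempty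
  exists_shift_le : ∀ N ∈ ℛ, ∀ a M, ∃ N' ∈ ℛ, ∀ j, N (j + a) + M ≤ N' j
  directedOn : DirectedOn (· ≤ ·) ℛ

/-- The nets of smooth functions on `Ω` whose derivatives grow, on each compact set, at most at a
rate in `ℛ`. All sequences give the moderate nets of `𝓖`, the constant ones those of `𝓖^∞`. -/
def regularNets (ℛ : Set (ℕ → ℕ)) (Ω : Opens (Eu n)) : Set (Idx → Eu n → ℂ) :=
  {u | (∀ ε, ContDiffOn ℝ ∞ (u ε) Ω) ∧ ∀ K : Set (Eu n), IsCompact K → K ⊆ Ω →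
    ∃ N ∈ ℛ, ∀ j : ℕ, (fun ε => supNorm K j (u ε)) =O[atZero] fun ε => ((ε : ℝ)⁻¹) ^ N j}

theorem isRegularScale_univ : IsRegularScale Set.univ where
  nonempty := Set.univ_nonempty
  exists_shift_le N _ a M := ⟨fun j => N (j + a) + M, Set.mem_univ _, fun _ => le_rfl⟩
  directedOn N _ N' _ := ⟨N ⊔ N', Set.mem_univ _, le_sup_left, le_sup_right⟩

theorem isRegularScale_range_const :
    IsRegularScale (Set.range fun N : ℕ => (fun _ => N : ℕ → ℕ)) where
  nonempty := Set.range_nonempty _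
  exists_shift_le := by
    rintro _ ⟨N, rfl⟩ a M
    exact ⟨_, ⟨N + M, rfl⟩, fun _ => le_rfl⟩
  directedOn := by
    rintro _ ⟨N, rfl⟩ _ ⟨N', rfl⟩
    exact ⟨_, ⟨max N N', rfl⟩, fun _ => le_max_left N N', fun _ => le_max_right N N'⟩

theorem EM_eq_regularNets :
    (EM : Opens (Eu n) → Set (Idx → Eu n → ℂ)) = regularNets Set.univ := by
  funext Ω
  ext u
  simp only [EM, regularNets, Classical.skolem, Set.mem_univ, true_and]

theorem EMinf_eq_regularNets : (EMinf : Opens (Eu n) → Set (Idx → Eu n → ℂ)) =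
    regularNets (Set.range fun N : ℕ => (fun _ => N : ℕ → ℕ)) := by
  funext Ω
  ext u
  simp only [EMinf, regularNets, Set.exists_range_iff]

section Closure

variable {ℛ : Set (ℕ → ℕ)} {Ω Ω' : Opens (Eu n)} {u v : Idx → Eu n → ℂ}

theorem regularNets.of_supNorm_le (hℛ : IsRegularScale ℛ) (hu : u ∈ regularNets ℛ Ω)
    (hv : ∀ ε, ContDiffOn ℝ ∞ (v ε) Ω')
    (h : ∀ K : Set (Eu n), IsCompact K → K ⊆ Ω' → ∃ L : Set (Eu n), IsCompact L ∧ L ⊆ Ω ∧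
      ∃ a M : ℕ, ∀ j, ∃ C : ℝ, ∀ᶠ ε : Idx in atZero,
        supNorm K j (v ε) ≤ C * (((ε : ℝ)⁻¹) ^ M * supNorm L (j + a) (u ε))) :
    v ∈ regularNets ℛ Ω' := by
  refine ⟨hv, fun K hK hKΩ => ?_⟩
  obtain ⟨L, hL, hLΩ, a, M, h⟩ := h K hK hKΩ
  obtain ⟨N, hN, hO⟩ := hu.2 L hL hLΩ
  obtain ⟨N', hN', hNN'⟩ := hℛ.exists_shift_le N hN a M
  refine ⟨N', hN', fun j => ?_⟩
  obtain ⟨C, hC⟩ := h j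
  have hvu : (fun ε => supNorm K j (v ε)) =O[atZero]
      fun ε : Idx => ((ε : ℝ)⁻¹) ^ M * supNorm L (j + a) (u ε) :=
    IsBigO.of_bound C (hC.mono fun ε hε => by
      rwa [Real.norm_of_nonneg (supNorm_nonneg _),
        Real.norm_of_nonneg (mul_nonneg (inv_coe_pow_pos ε M).le (supNorm_nonneg _))])
  refine IsBigO.trans ?_ (isBigO_inv_pow (hNN' j))
  simpa only [pow_add, mul_comm] using hvu.trans ((isBigO_refl _ _).mul (hO (j + a)))

theorem regularNets.mono (hu : u ∈ regularNets ℛ Ω) (h : Ω' ≤ Ω) : u ∈ regularNets ℛ Ω' :=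
  ⟨fun ε => (hu.1 ε).mono h, fun K hK hKΩ => hu.2 K hK (hKΩ.trans h)⟩

theorem regularNets.zero (hℛ : IsRegularScale ℛ) : (fun _ _ => (0 : ℂ)) ∈ regularNets ℛ Ω := by
  obtain ⟨N, hN⟩ := hℛ.nonempty
  refine ⟨fun _ => contDiffOn_const, fun K _ _ => ⟨N, hN, fun j => ?_⟩⟩
  have hzero : supNorm K j (fun _ => (0 : ℂ)) = 0 := supNorm_zero (Ω := (⊤ : Opens (Eu n)))
  simp only [hzero]
  exact isBigO_zero _ _

theorem supNorm_add_le_of_contDiffOn {U K : Set (Eu n)} {f g : Eu n → ℂ} (hU : IsOpen U)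
    (hf : ContDiffOn ℝ ∞ f U) (hg : ContDiffOn ℝ ∞ g U) (hK : IsCompact K) (hKU : K ⊆ U) (j : ℕ) :
    supNorm K j (fun x => f x + g x) ≤ supNorm K j f + supNorm K j g := by
  refine supNorm_le (add_nonneg (supNorm_nonneg _) (supNorm_nonneg _)) fun x hx i hi => ?_
  have hderiv := iteratedFDeriv_add_apply (𝕜 := ℝ) (i := i) (x := x) (f := f) (g := g)
    ((contDiffAt_of_isOpen hU hf (hKU hx)).of_le (mod_cast le_top))
    ((contDiffAt_of_isOpen hU hg (hKU hx)).of_le (mod_cast le_top))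
  rw [show (fun x => f x + g x) = f + g from rfl, hderiv]
  exact (norm_add_le _ _).trans (add_le_add (le_supNorm_of_contDiffOn hU hf hK hKU hx hi)
    (le_supNorm_of_contDiffOn hU hg hK hKU hx hi))

theorem regularNets.add (hℛ : IsRegularScale ℛ) (hu : u ∈ regularNets ℛ Ω)
    (hv : v ∈ regularNets ℛ Ω) : (fun ε x => u ε x + v ε x) ∈ regularNets ℛ Ω := by
  refine ⟨fun ε => (hu.1 ε).add (hv.1 ε), fun K hK hKΩ => ?_⟩
  obtain ⟨N, hN, hO⟩ := hu.2 K hK hKΩ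
  obtain ⟨N', hN', hO'⟩ := hv.2 K hK hKΩ
  obtain ⟨M, hM, hNM, hNM'⟩ := hℛ.directedOn N hN N' hN'
  refine ⟨M, hM, fun j => IsBigO.trans (IsBigO.of_norm_le fun ε => ?_)
    (((hO j).trans (isBigO_inv_pow (hNM j))).add ((hO' j).trans (isBigO_inv_pow (hNM' j))))⟩
  rw [Real.norm_of_nonneg (supNorm_nonneg _)]
  exact supNorm_add_le_of_contDiffOn Ω.isOpen (hu.1 ε) (hv.1 ε) hK hKΩ j

theorem regularNets.sum (hℛ : IsRegularScale ℛ) {ι : Type*} (s : Finset ι)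
    {u : ι → Idx → Eu n → ℂ} (h : ∀ i ∈ s, u i ∈ regularNets ℛ Ω) :
    (fun ε x => ∑ i ∈ s, u i ε x) ∈ regularNets ℛ Ω := by
  classical
  induction s using Finset.induction_on with
  | empty => simpa using regularNets.zero hℛ
  | insert a s ha ih =>
    simp only [Finset.sum_insert ha]
    exact regularNets.add hℛ (h a (Finset.mem_insert_self a s))
      (ih fun i hi => h i (Finset.mem_insert_of_mem hi))

theorem supNorm_const_mul_le {U K : Set (Eu n)} {f : Eu n → ℂ} (hU : IsOpen U)
    (hf : ContDiffOn ℝ ∞ f U) (hK : IsCompact K) (hKU : K ⊆ U) (j : ℕ) (c : ℂ) :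
    supNorm K j (fun x => c * f x) ≤ ‖c‖ * supNorm K j f := by
  refine supNorm_le (mul_nonneg (norm_nonneg _) (supNorm_nonneg _)) fun x hx i hi => ?_
  have hderiv := iteratedFDeriv_const_smul_apply (𝕜 := ℝ) (i := i) (x := x) (f := f) (a := c)
    ((contDiffAt_of_isOpen hU hf (hKU hx)).of_le (mod_cast le_top))
  rw [show (fun x => c * f x) = c • f from rfl, hderiv, norm_smul]
  exact mul_le_mul_of_nonneg_left (le_supNorm_of_contDiffOn hU hf hK hKU hx hi) (norm_nonneg _)

theorem regularNets.const_mul (hℛ : IsRegularScale ℛ) (hu : u ∈ regularNets ℛ Ω) {c : Idx → ℂ}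
    (hc : IsModerate c) :
    (fun ε x => c ε * u ε x) ∈ regularNets ℛ Ω := by
  obtain ⟨M, hM⟩ := hc.exists_eventually_norm_le
  refine regularNets.of_supNorm_le hℛ hu (fun ε => contDiffOn_const.mul (hu.1 ε)) fun K hK hKΩ =>
    ⟨K, hK, hKΩ, 0, M, fun j => ⟨1, hM.mono fun ε hε => ?_⟩⟩
  rw [one_mul, add_zero]
  exact (supNorm_const_mul_le Ω.isOpen (hu.1 ε) hK hKΩ j _).trans
    (mul_le_mul_of_nonneg_right hε (supNorm_nonneg _))

theorem regularNets.sub (hℛ : IsRegularScale ℛ) (hu : u ∈ regularNets ℛ Ω)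
    (hv : v ∈ regularNets ℛ Ω) : (fun ε x => u ε x - v ε x) ∈ regularNets ℛ Ω := by
  have := regularNets.add hℛ hu (regularNets.const_mul hℛ hv (isModerate_const (-1)))
  simpa only [neg_one_mul, ← sub_eq_add_neg] using this

theorem regularNets.iterPartialDeriv (hℛ : IsRegularScale ℛ) (hu : u ∈ regularNets ℛ Ω)
    (I : List (Fin n)) : (fun ε => Colombeau.iterPartialDeriv I (u ε)) ∈ regularNets ℛ Ω :=
  regularNets.of_supNorm_le hℛ hu (fun ε => contDiffOn_iterPartialDeriv Ω.isOpen (hu.1 ε) I)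
    fun K hK hKΩ =>
    ⟨K, hK, hKΩ, I.length, 0, fun j => ⟨1, Eventually.of_forall fun ε => by
      rw [one_mul, pow_zero, one_mul]
      exact supNorm_iterPartialDeriv_le Ω.isOpen (hu.1 ε) hK hKΩ I j⟩⟩

theorem regularNets.smooth_mul (hℛ : IsRegularScale ℛ) (hu : u ∈ regularNets ℛ Ω) {χ : Eu n → ℂ}
    (hχ : ContDiff ℝ ∞ χ) :
    (fun ε x => χ x * u ε x) ∈ regularNets ℛ Ω :=
  regularNets.of_supNorm_le hℛ hu (fun ε => hχ.contDiffOn.mul (hu.1 ε)) fun K hK hKΩ =>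
    ⟨K, hK, hKΩ, 0, 0, fun j => ⟨2 ^ j * supNorm K j χ, Eventually.of_forall fun ε => by
      rw [pow_zero, one_mul]
      exact supNorm_mul_le Ω.isOpen hχ.contDiffOn (hu.1 ε) hK hKΩ j⟩⟩

theorem contDiff_cutoff_mul {U : Set (Eu n)} (hU : IsOpen U) {χ g : Eu n → ℂ}
    (hχ : ContDiff ℝ ∞ χ) (hs : tsupport χ ⊆ U) (hg : ContDiffOn ℝ ∞ g U) :
    ContDiff ℝ ∞ fun x => χ x * g x := by
  simpa only [mul_comm] using contDiff_mul_of_tsupport_subset hU hg hχ hs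

theorem regularNets.cutoff_mul (hℛ : IsRegularScale ℛ) (hu : u ∈ regularNets ℛ Ω) {χ : Eu n → ℂ}
    (hχ : ContDiff ℝ ∞ χ)
    (hc : HasCompactSupport χ) (hs : tsupport χ ⊆ Ω) :
    (fun ε x => χ x * u ε x) ∈ regularNets ℛ Ω' := by
  have hsm := fun ε => contDiff_cutoff_mul Ω.isOpen hχ hs (hu.1 ε)
  refine regularNets.of_supNorm_le hℛ hu (fun ε => (hsm ε).contDiffOn) fun K _ _ =>
    ⟨tsupport χ, hc, hs, 0, 0, fun j => ⟨2 ^ j * supNorm (tsupport χ) j χ,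
      Eventually.of_forall fun ε => ?_⟩⟩
  rw [pow_zero, one_mul]
  refine (supNorm_le_of_tsupport hc (hsm ε) tsupport_mul_subset_left).trans ?_
  exact supNorm_mul_le Ω.isOpen hχ.contDiffOn (hu.1 ε) hc hs j

/-- The operator `Q(D) = ∑_α q_α D^α` on functions. -/
def diffOp (Q : MvPolynomial (Fin n) ℂ) (g : Eu n → ℂ) : Eu n → ℂ := fun x =>
  ∑ α ∈ Q.support, Q.coeff α *
    ((-Complex.I) ^ (directions α).length * iterPartialDeriv (directions α).reverse g x)

theorem diffOp_eq_sum_of_support_subset {Q : MvPolynomial (Fin n) ℂ} {s : Finset (Fin n →₀ ℕ)}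
    (hs : Q.support ⊆ s) (g : Eu n → ℂ) : diffOp Q g = fun x => ∑ α ∈ s, Q.coeff α *
      ((-Complex.I) ^ (directions α).length * iterPartialDeriv (directions α).reverse g x) :=
  funext fun _ => Finset.sum_subset hs fun α _ hα => by
    rw [MvPolynomial.notMem_support_iff.1 hα, zero_mul]

theorem regularNets.diffOp (hℛ : IsRegularScale ℛ) (hu : u ∈ regularNets ℛ Ω)
    (P : MvPolynomial (Fin n) GenC) :
    (fun ε => diffOp (polyNet P ε) (u ε)) ∈ regularNets ℛ Ω := by
  simp only [diffOp_eq_sum_of_support_subset (support_polyNet_subset P _)]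
  exact regularNets.sum hℛ _ fun α _ => regularNets.const_mul hℛ
    (regularNets.const_mul hℛ (regularNets.iterPartialDeriv hℛ hu _) (isModerate_const _))
    (represents_coeff_polyNet P α).isModerate

end Closure

theorem integral_mul_transposeOp {U : Set (Eu n)} (hU : IsOpen U) {g u : Eu n → ℂ}
    (hg : ContDiffOn ℝ ∞ g U) (hu : ContDiff ℝ ∞ u) (hc : HasCompactSupport u)
    (hs : tsupport u ⊆ U) (Q : MvPolynomial (Fin n) ℂ) :
    ∫ x, g x * transposeOp Q u x = ∫ x, diffOp Q g x * u x := by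
  have hint_left : ∀ α, Integrable fun x =>
      transposeCoeff Q α * (g x * iterPartialDeriv (directions α) u x) := fun α =>
    (integrable_mul_of_tsupport_subset hU hg (contDiff_iterPartialDeriv hu _)
      (hasCompactSupport_iterPartialDeriv hc _)
      ((tsupport_iterPartialDeriv_subset _ u).trans hs)).const_mul _
  have hint_right : ∀ α, Integrable fun x => Q.coeff α * ((-Complex.I) ^ (directions α).length *
      (iterPartialDeriv (directions α).reverse g x * u x)) := fun α =>
    ((integrable_mul_of_tsupport_subset hU (contDiffOn_iterPartialDeriv hU hg _) hu hc
      hs).const_mul _).const_mul _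
  simp only [transposeOp_apply, diffOp, Finset.mul_sum, Finset.sum_mul, mul_left_comm (g _),
    mul_assoc]
  rw [integral_finsetSum _ fun α _ => hint_left α, integral_finsetSum _ fun α _ => hint_right α]
  refine Finset.sum_congr rfl fun α _ => ?_
  rw [integral_const_mul, integral_const_mul, integral_const_mul,
    integral_mul_iterPartialDeriv hU hg hu hc hs, transposeCoeff, neg_pow Complex.I]
  ring

theorem setIntegral_mul_test {Ω : Opens (Eu n)} (g : Eu n → ℂ) (u : 𝓓(Ω, ℂ)) :
    ∫ x in (Ω : Set (Eu n)), g x * u x = ∫ x, g x * u x :=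
  setIntegral_eq_integral_of_forall_compl_eq_zero fun x hx => by
    rw [image_eq_zero_of_notMem_tsupport fun h => hx (u.tsupport_subset h), mul_zero]

theorem IsGivenBy.applyOp {ℛ : Set (ℕ → ℕ)} (hℛ : IsRegularScale ℛ) {Ω : Opens (Eu n)}
    {T : Functional Ω} (h : IsGivenBy (regularNets ℛ) T) (P : MvPolynomial (Fin n) GenC) :
    IsGivenBy (regularNets ℛ) (Colombeau.applyOp P T) := by
  obtain ⟨g, hg, hT⟩ := h
  refine ⟨_, regularNets.diffOp hℛ hg P, fun u => ?_⟩
  rw [applyOp_mk]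
  refine (hT (EcM.transposeOp P u)).congr' (Eventually.of_forall fun ε => ?_)
  beta_reduce
  rw [setIntegral_mul_test, setIntegral_mul_test, EcM.coe_transposeOp, coe_testTransposeOp]
  exact integral_mul_transposeOp Ω.isOpen (hg.1 ε) (contDiff_test _) (u.1 ε).hasCompactSupport
    (u.1 ε).tsupport_subset _

theorem singSupp_applyOp_subset {ℛ : Set (ℕ → ℕ)} (hℛ : IsRegularScale ℛ) {Ω : Opens (Eu n)}
    (T : Functional Ω) (P : MvPolynomial (Fin n) GenC) :
    singSupp (regularNets ℛ) (applyOp P T) ⊆ singSupp (regularNets ℛ) T := by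
  rintro x ⟨hx, h⟩
  refine ⟨hx, fun ⟨V, hV, hxV, hg⟩ => h ⟨V, hV, hxV, ?_⟩⟩
  rw [restrict_applyOp]
  exact hg.applyOp hℛ P

/-! ### Nets of compactly supported distributions -/

open scoped Pointwise

section Composition

variable {S : SmoothFun n →ₗ[ℂ] ℂ} {K : Set (Eu n)} {j : ℕ} {C : ℝ}

theorem comp_iterPartialDeriv_mem_compactDistributions (hS : S ∈ compactDistributions n)
    (I : List (Fin n)) : S ∘ₗ SmoothFun.iterPartialDeriv I ∈ compactDistributions n := by
  obtain ⟨K, j, C, hK, hS⟩ := hS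
  exact ⟨K, j + I.length, |C|, hK, fun f => (hS _).trans (mul_le_mul (le_abs_self C)
    (supNorm_iterPartialDeriv_le isOpen_univ (SmoothFun.contDiffOn f _) hK (Set.subset_univ _) I j)
    (supNorm_nonneg _) (abs_nonneg C))⟩

theorem comp_transposeOp_mem_compactDistributions (hS : S ∈ compactDistributions n)
    (Q : MvPolynomial (Fin n) ℂ) : S ∘ₗ SmoothFun.transposeOp Q ∈ compactDistributions n := by
  have hsum : S ∘ₗ SmoothFun.transposeOp Q = ∑ α ∈ Q.support,
      transposeCoeff Q α • (S ∘ₗ SmoothFun.iterPartialDeriv (directions α)) := by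
    ext f
    simp [SmoothFun.transposeOp, LinearMap.sum_apply, map_sum]
  rw [hsum]
  exact sum_mem fun α _ =>
    Submodule.smul_mem _ _ (comp_iterPartialDeriv_mem_compactDistributions hS _)

/-- The Dirac distribution at the origin, as a linear form on `C^∞(ℝⁿ)`. -/
def evalZero (n : ℕ) : SmoothFun n →ₗ[ℂ] ℂ where
  toFun f := f.1 0
  map_add' _ _ := rfl
  map_smul' _ _ := rfl

theorem evalZero_mem_compactDistributions : evalZero n ∈ compactDistributions n :=
  ⟨{0}, 0, 1, isCompact_singleton, fun f => by
    rw [one_mul]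
    exact norm_le_supNorm isOpen_univ (SmoothFun.contDiffOn f _) isCompact_singleton
      (Set.subset_univ _) rfl 0⟩

theorem SmoothFun.translate_transposeOp (y : Eu n) (Q : MvPolynomial (Fin n) ℂ)
    (u : SmoothFun n) : SmoothFun.translate y (SmoothFun.transposeOp Q u) =
      SmoothFun.transposeOp Q (SmoothFun.translate y u) := by
  have hderiv : ∀ I : List (Fin n), SmoothFun.translate y (SmoothFun.iterPartialDeriv I u) =
      SmoothFun.iterPartialDeriv I (SmoothFun.translate y u) :=
    fun I => Subtype.ext (iterPartialDeriv_translate I y u.1).symm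
  simp only [SmoothFun.transposeOp, LinearMap.sum_apply, LinearMap.smul_apply, map_sum, map_smul,
    hderiv]

theorem SmoothFun.transposeOp_correlation (hS : S ∈ compactDistributions n)
    (Q : MvPolynomial (Fin n) ℂ) (u : SmoothFun n) :
    SmoothFun.transposeOp Q (SmoothFun.correlation hS u) =
      SmoothFun.correlation hS (SmoothFun.transposeOp Q u) := by
  refine Subtype.ext (funext fun y => ?_)
  change _ = S (SmoothFun.translate y (SmoothFun.transposeOp Q u))
  rw [SmoothFun.coe_transposeOp, transposeOp_apply, SmoothFun.transposeOp, LinearMap.sum_apply,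
    map_sum, map_sum]
  refine Finset.sum_congr rfl fun α _ => ?_
  change _ * Colombeau.iterPartialDeriv _ (Colombeau.correlation S u) y = _
  rw [iterPartialDeriv_correlation hS, LinearMap.smul_apply, map_smul, map_smul, smul_eq_mul]
  rfl

theorem supNorm_reflect_le (f : SmoothFun n) (hK : IsCompact K) :
    supNorm K j (SmoothFun.reflect f).1 ≤ supNorm (-K) j f.1 := by
  refine supNorm_le (supNorm_nonneg _) fun x hx i hi => ?_
  refine ((LinearIsometryEquiv.neg ℝ (E := Eu n)).norm_iteratedFDeriv_comp_right f.1 x i).le.trans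
    ?_
  exact le_supNorm hK.neg (SmoothFun.contDiff f) (by simpa using hx) hi

theorem DominatedBy.comp_reflect (hS : DominatedBy S K j C) (hK : IsCompact K) :
    DominatedBy (S ∘ₗ SmoothFun.reflect) (-K) j |C| := fun f =>
  (hS _).trans (mul_le_mul (le_abs_self C) (supNorm_reflect_le f hK) (supNorm_nonneg _)
    (abs_nonneg C))

theorem comp_reflect_mem_compactDistributions (hS : S ∈ compactDistributions n) :
    S ∘ₗ SmoothFun.reflect ∈ compactDistributions n := by
  obtain ⟨K, j, C, hK, hS⟩ := hS
  exact ⟨-K, j, |C|, hK.neg, hS.comp_reflect hK⟩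

end Composition

/-- A moderate net of compactly supported distributions: `|S_ε f| ≤ c ε^{-N} p_{K,j}(f)` for all
`ε`, with one `K`, `j`, `N` and `c`. -/
structure IsDominatedNet (S : Idx → SmoothFun n →ₗ[ℂ] ℂ) (K : Set (Eu n)) (j N : ℕ) (c : ℝ) :
    Prop where
  isCompact : IsCompact K
  nonneg : 0 ≤ c
  dominatedBy : ∀ ε : Idx, DominatedBy (S ε) K j (c * ((ε : ℝ)⁻¹) ^ N)

section Nets

variable {S : Idx → SmoothFun n →ₗ[ℂ] ℂ} {K : Set (Eu n)} {j N : ℕ} {c : ℝ}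

theorem IsDominatedNet.mem_compactDistributions (hS : IsDominatedNet S K j N c) (ε : Idx) :
    S ε ∈ compactDistributions n :=
  ⟨K, j, _, hS.isCompact, hS.dominatedBy ε⟩

theorem IsDominatedNet.comp_reflect (hS : IsDominatedNet S K j N c) :
    IsDominatedNet (fun ε => S ε ∘ₗ SmoothFun.reflect) (-K) j N c where
  isCompact := hS.isCompact.neg
  nonneg := hS.nonneg
  dominatedBy ε := by
    have h := (hS.dominatedBy ε).comp_reflect hS.isCompact
    rwa [abs_of_nonneg (mul_nonneg hS.nonneg (inv_coe_pow_pos ε N).le)] at h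

theorem IsDominatedNet.isNegligible (hS : IsDominatedNet S K j N c) {f : Idx → SmoothFun n}
    (hf : IsNegligible fun ε => supNorm K j (f ε).1) : IsNegligible fun ε => S ε (f ε) :=
  IsNegligible.of_le (IsModerate.mul_isNegligible
    (IsModerate.mul (isModerate_const c) (isModerate_inv_pow N)) hf) fun ε =>
      (hS.dominatedBy ε (f ε)).trans (le_abs_self _)

theorem IsDominatedNet.supNorm_correlation_le (hS : IsDominatedNet S K j N c) {L : Set (Eu n)}
    (hL : IsCompact L) (i : ℕ) (u : SmoothFun n) (ε : Idx) :
    supNorm L i (correlation (S ε) u) ≤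
      (n + 1) ^ i * c * (((ε : ℝ)⁻¹) ^ N * supNorm (L + K) (i + j) u.1) := by
  have hmem := hS.mem_compactDistributions ε
  have hpow := (inv_coe_pow_pos ε N).le
  have hLK := hL.add hS.isCompact
  rw [mul_assoc]
  refine supNorm_le_of_norm_iterPartialDeriv_le isOpen_univ
    (contDiff_correlation hmem u).contDiffOn (Set.subset_univ _)
    (mul_nonneg hS.nonneg (mul_nonneg hpow (supNorm_nonneg _))) i fun y hy I hI => ?_
  rw [iterPartialDeriv_correlation hmem, ← mul_assoc]
  refine (hS.dominatedBy ε _).trans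
    (mul_le_mul_of_nonneg_left ?_ (mul_nonneg hS.nonneg hpow))
  calc supNorm K j (SmoothFun.translate y (SmoothFun.iterPartialDeriv I u)).1
      ≤ supNorm (L + K) j (iterPartialDeriv I u.1) :=
        supNorm_translate_le (contDiff_iterPartialDeriv u.2 I) hLK y
          (fun z hz => Set.add_mem_add hy hz) j
    _ ≤ supNorm (L + K) (j + I.length) u.1 :=
        supNorm_iterPartialDeriv_le isOpen_univ (SmoothFun.contDiffOn u _) hLK
          (Set.subset_univ _) I j
    _ ≤ supNorm (L + K) (i + j) u.1 :=
        supNorm_mono isOpen_univ (SmoothFun.contDiffOn u _) hLK (Set.subset_univ _) subset_rfl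
          (by omega)

theorem IsDominatedNet.correlation_mem {ℛ : Set (ℕ → ℕ)} (hℛ : IsRegularScale ℛ)
    (hS : IsDominatedNet S K j N c) {u : Idx → SmoothFun n}
    (hu : (fun ε => (u ε).1) ∈ regularNets ℛ (⊤ : Opens (Eu n))) :
    (fun ε => correlation (S ε) (u ε)) ∈ regularNets ℛ (⊤ : Opens (Eu n)) :=
  regularNets.of_supNorm_le hℛ hu
    (fun ε => (contDiff_correlation (hS.mem_compactDistributions ε) (u ε)).contDiffOn)
    fun L hL _ => ⟨L + K, hL.add hS.isCompact, Set.subset_univ _, j, N, fun i =>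
      ⟨(n + 1) ^ i * c, Eventually.of_forall fun ε => hS.supNorm_correlation_le hL i (u ε) ε⟩⟩

end Nets

/-! ### Nets of test functions -/

section TestNets

variable {Ω : Opens (Eu n)}

/-- A test function as an element of `C^∞(ℝⁿ)`. -/
def SmoothFun.ofTest (f : 𝓓(Ω, ℂ)) : SmoothFun n := ⟨f, contDiff_test f⟩

/-- A smooth function that is supported in a compact subset of `Ω` as a test function. -/
def SmoothFun.toTest (f : SmoothFun n) {K : Set (Eu n)} (hK : IsCompact K) (hKΩ : K ⊆ Ω)
    (hs : tsupport f.1 ⊆ K) : 𝓓(Ω, ℂ) :=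
  ⟨f.1, SmoothFun.contDiff f, hK.of_isClosed_subset (isClosed_tsupport _) hs, hs.trans hKΩ⟩

/-- A moderate net of smooth functions supported in a compact subset of `Ω`, as a representative
of an element of `𝓖_c(Ω)`. -/
def EcM.ofSmooth (u : Idx → SmoothFun n) {K : Set (Eu n)} (hK : IsCompact K) (hKΩ : K ⊆ Ω)
    (hs : ∀ ε, tsupport (u ε).1 ⊆ K)
    (hu : (fun ε => (u ε).1) ∈ regularNets Set.univ (⊤ : Opens (Eu n))) : EcM Ω :=
  ⟨fun ε => SmoothFun.toTest (u ε) hK hKΩ (hs ε), ⟨K, hK, hKΩ, hs⟩, by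
    rw [EM_eq_regularNets]
    exact regularNets.mono hu le_top⟩

theorem EcM.mem_regularNets_univ (u : EcM Ω) :
    (fun ε => (u.1 ε : Eu n → ℂ)) ∈ regularNets Set.univ (⊤ : Opens (Eu n)) := by
  obtain ⟨⟨K, hK, hKΩ, hs⟩, hu⟩ := u.2
  rw [EM_eq_regularNets] at hu
  refine regularNets.of_supNorm_le isRegularScale_univ hu
    (fun ε => (contDiff_test _).contDiffOn) fun L _ _ =>
      ⟨K, hK, hKΩ, 0, 0, fun j => ⟨1, Eventually.of_forall fun ε => ?_⟩⟩
  rw [one_mul, pow_zero, one_mul]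
  exact supNorm_le_of_tsupport hK (contDiff_test (u.1 ε)) (hs ε)

theorem SmoothFun.mem_tsupport_translate {y z : Eu n} {u : SmoothFun n}
    (h : z ∈ tsupport (SmoothFun.translate y u).1) : y + z ∈ tsupport u.1 := by
  have hclosed : IsClosed ((fun z => y + z) ⁻¹' tsupport u.1) :=
    (isClosed_tsupport _).preimage (continuous_const.add continuous_id)
  exact closure_minimal (t := (fun z => y + z) ⁻¹' tsupport u.1)
    (fun z hz => subset_closure (s := Function.support u.1) hz) hclosed h

theorem translate_mem_regularNets {ℛ : Set (ℕ → ℕ)} (hℛ : IsRegularScale ℛ)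
    {u : Idx → SmoothFun n} (hu : (fun ε => (u ε).1) ∈ regularNets ℛ (⊤ : Opens (Eu n)))
    {K : Set (Eu n)} (hK : IsCompact K) {y : Idx → Eu n} (hy : ∀ ε, y ε ∈ K) :
    (fun ε => (SmoothFun.translate (y ε) (u ε)).1) ∈ regularNets ℛ (⊤ : Opens (Eu n)) :=
  regularNets.of_supNorm_le hℛ hu (fun ε => SmoothFun.contDiffOn _ _) fun L hL _ =>
    ⟨K + L, hK.add hL, Set.subset_univ _, 0, 0, fun j => ⟨1, Eventually.of_forall fun ε => by
      rw [one_mul, pow_zero, one_mul]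
      exact supNorm_translate_le (SmoothFun.contDiff (u ε)) (hK.add hL) (y ε)
        (fun z hz => Set.add_mem_add (hy ε) hz) j⟩⟩

theorem supNorm_succ_le {K : Set (Eu n)} {f : Eu n → ℂ} (hf : ContDiff ℝ ∞ f) (hK : IsCompact K)
    (j : ℕ) : supNorm K (j + 1) f ≤ supNorm K 0 f + ∑ k, supNorm K j (partialDeriv k f) := by
  have hsum : 0 ≤ ∑ k, supNorm K j (partialDeriv k f) :=
    Finset.sum_nonneg fun _ _ => supNorm_nonneg _
  refine supNorm_le (add_nonneg (supNorm_nonneg _) hsum) fun x hx i hi => ?_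
  cases i with
  | zero => exact (le_supNorm hK hf hx le_rfl).trans (le_add_of_nonneg_right hsum)
  | succ i =>
    refine (norm_iteratedFDeriv_succ_le hf.contDiffAt i).trans
      ((Finset.sum_le_sum fun k _ => ?_).trans (le_add_of_nonneg_left (supNorm_nonneg _)))
    exact le_supNorm hK (contDiff_partialDeriv hf k) hx (by omega)

section NegligibleCorrelation

variable {S : Idx → SmoothFun n →ₗ[ℂ] ℂ} {K B : Set (Eu n)}

theorem isNegligible_supNorm_zero_correlation (hS : ∀ ε, S ε ∈ compactDistributions n)
    (hK : IsCompact K) (hB : IsCompact B)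
    (hneg : ∀ w : EcM (⊤ : Opens (Eu n)), (∀ ε, tsupport (w.1 ε) ⊆ B) →
      IsNegligible fun ε => S ε (SmoothFun.ofTest (w.1 ε)))
    (u : EcM (⊤ : Opens (Eu n))) (hu : ∀ ε, ∀ y ∈ K, ∀ z, y + z ∈ tsupport (u.1 ε) → z ∈ B) :
    IsNegligible fun ε => supNorm K 0 (correlation (S ε) (SmoothFun.ofTest (u.1 ε))) := by
  rcases K.eq_empty_or_nonempty with rfl | hne
  · have hempty : ∀ f : Eu n → ℂ, supNorm ∅ 0 f = 0 := fun f =>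
      le_antisymm (supNorm_le le_rfl fun x hx => hx.elim) (supNorm_nonneg _)
    simp only [hempty]
    exact isNegligible_zero
  -- the translates of `u_ε` by points where the maximum is attained form a net of test functions
  choose y hyK hy using fun ε => hK.exists_isMaxOn hne
    (contDiff_correlation (hS ε) (SmoothFun.ofTest (u.1 ε))).continuous.norm.continuousOn
  have hsupp : ∀ ε, tsupport (SmoothFun.translate (y ε) (SmoothFun.ofTest (u.1 ε))).1 ⊆ B :=
    fun ε z hz => hu ε _ (hyK ε) z (SmoothFun.mem_tsupport_translate hz)
  have hmod := translate_mem_regularNets isRegularScale_univ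
    (u := fun ε => SmoothFun.ofTest (u.1 ε)) (EcM.mem_regularNets_univ u) hK hyK
  refine IsNegligible.of_le (hneg (EcM.ofSmooth _ hB (Set.subset_univ _) hsupp hmod) hsupp)
    fun ε => ?_
  rw [Real.norm_of_nonneg (supNorm_nonneg _)]
  refine supNorm_le (norm_nonneg _) fun x hx i hi => ?_
  obtain rfl : i = 0 := by omega
  rw [norm_iteratedFDeriv_zero]
  exact hy ε hx

theorem isNegligible_supNorm_correlation (hS : ∀ ε, S ε ∈ compactDistributions n)
    (hK : IsCompact K) (hB : IsCompact B)
    (hneg : ∀ w : EcM (⊤ : Opens (Eu n)), (∀ ε, tsupport (w.1 ε) ⊆ B) →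
      IsNegligible fun ε => S ε (SmoothFun.ofTest (w.1 ε)))
    (j : ℕ) (u : EcM (⊤ : Opens (Eu n)))
    (hu : ∀ ε, ∀ y ∈ K, ∀ z, y + z ∈ tsupport (u.1 ε) → z ∈ B) :
    IsNegligible fun ε => supNorm K j (correlation (S ε) (SmoothFun.ofTest (u.1 ε))) := by
  induction j generalizing u with
  | zero => exact isNegligible_supNorm_zero_correlation hS hK hB hneg u hu
  | succ j ih =>
    have hpartial : ∀ k, IsNegligible fun ε =>
        supNorm K j (partialDeriv k (correlation (S ε) (SmoothFun.ofTest (u.1 ε)))) := by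
      intro k
      refine IsNegligible.congr' (ih (EcM.partial ⊤ k u) fun ε y hy z hz =>
        hu ε y hy z (tsupport_testPartial k _ hz)) (Eventually.of_forall fun ε => ?_)
      have htest : SmoothFun.ofTest ((EcM.partial ⊤ k u).1 ε) =
          SmoothFun.partialDeriv k (SmoothFun.ofTest (u.1 ε)) :=
        Subtype.ext (coe_testPartial k (u.1 ε))
      simp only [htest, partialDeriv_correlation (hS ε)]
    refine IsNegligible.of_le ((isNegligible_supNorm_zero_correlation hS hK hB hneg u hu).add
      (IsNegligible.sum Finset.univ fun k _ => hpartial k)) fun ε => ?_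
    rw [Real.norm_of_nonneg (supNorm_nonneg _)]
    exact (supNorm_succ_le (contDiff_correlation (hS ε) _) hK j).trans (le_abs_self _)

end NegligibleCorrelation

/-- Multiplication of smooth functions by the test function `χ`. -/
def cutoffTest (χ : 𝓓(Ω, ℂ)) : SmoothFun n →ₗ[ℂ] 𝓓(Ω, ℂ) where
  toFun f := ⟨fun x => χ x * f.1 x, (contDiff_test χ).mul (SmoothFun.contDiff f),
    χ.hasCompactSupport.mul_right, tsupport_mul_subset_left.trans χ.tsupport_subset⟩
  map_add' f g := DFunLike.coe_injective (funext fun x => mul_add (χ x) (f.1 x) (g.1 x))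
  map_smul' c f := DFunLike.coe_injective (funext fun x => mul_left_comm (χ x) c (f.1 x))

theorem IsModerateDistNet.exists_isDominatedNet_cutoff {T : Idx → 𝓓(Ω, ℂ) →L[ℂ] ℂ}
    (hT : IsModerateDistNet T) (χ : 𝓓(Ω, ℂ)) :
    ∃ (S : Idx → SmoothFun n →ₗ[ℂ] ℂ) (j N : ℕ) (c : ℝ), IsDominatedNet S (tsupport χ) j N c ∧
      ∀ᶠ ε in atZero, S ε = (T ε).toLinearMap ∘ₗ cutoffTest χ := by
  obtain ⟨j, N, c, η, hc, hT⟩ := hT (tsupport χ) χ.hasCompactSupport χ.tsupport_subset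
  have hχ : 0 ≤ c * (2 ^ j * supNorm (tsupport χ) j χ) :=
    mul_nonneg hc.le (mul_nonneg (by positivity) (supNorm_nonneg _))
  classical
  refine ⟨fun ε => if ε ≤ η then (T ε).toLinearMap ∘ₗ cutoffTest χ else 0, j, N,
    c * (2 ^ j * supNorm (tsupport χ) j χ), ⟨χ.hasCompactSupport, hχ, fun ε f => ?_⟩,
    (eventually_le_atZero η).mono fun ε hε => if_pos hε⟩
  have hpow := (inv_coe_pow_pos ε N).le
  by_cases hε : ε ≤ η
  · simp only [if_pos hε]
    calc ‖T ε (cutoffTest χ f)‖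
        ≤ c * ((ε : ℝ)⁻¹) ^ N * supNorm (tsupport χ) j (cutoffTest χ f) :=
          hT (cutoffTest χ f) tsupport_mul_subset_left ε hε
      _ ≤ c * ((ε : ℝ)⁻¹) ^ N * (2 ^ j * supNorm (tsupport χ) j χ * supNorm (tsupport χ) j f.1) :=
          mul_le_mul_of_nonneg_left (supNorm_mul_le isOpen_univ (contDiff_test χ).contDiffOn
            (SmoothFun.contDiffOn f _) χ.hasCompactSupport (Set.subset_univ _) j)
            (mul_nonneg hc.le hpow)
      _ = _ := by ring
  · simp only [if_neg hε, LinearMap.zero_apply, norm_zero]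
    exact mul_nonneg (mul_nonneg hχ hpow) (supNorm_nonneg _)

end TestNets

/-! ### Localization of functionals -/

theorem exists_smooth_eq_one_tsupport_subset (x : Eu n) {r R : ℝ} (hr : 0 < r) (hrR : r < R) :
    ∃ χ : SmoothFun n, (∀ y ∈ Metric.closedBall x r, χ.1 y = 1) ∧
      tsupport χ.1 ⊆ Metric.closedBall x R := by
  let f : ContDiffBump x := ⟨r, R, hr, hrR⟩
  refine ⟨⟨fun y => (f y : ℂ), Complex.ofRealCLM.contDiff.comp f.contDiff⟩, fun y hy => ?_, ?_⟩
  · change ((f y : ℝ) : ℂ) = 1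
    rw [f.one_of_mem_closedBall hy, Complex.ofReal_one]
  · refine (closure_mono fun y hy => ?_).trans f.tsupport_eq.le
    exact fun h => hy (congrArg ((↑) : ℝ → ℂ) h)

section Localization

variable {Ω V : Opens (Eu n)} {ℛ : Set (ℕ → ℕ)} {F G : Functional Ω}

/-- Multiplication of nets of test functions by a smooth function. -/
def EcM.smoothMul (ψ : SmoothFun n) : EcM Ω →ₗ[moderateNets ℂ] EcM Ω where
  toFun u := ⟨fun ε => cutoffTest (u.1 ε) ψ, by
    obtain ⟨⟨K, hK, hKΩ, hs⟩, -⟩ := u.2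
    exact ⟨K, hK, hKΩ, fun ε => tsupport_mul_subset_left.trans (hs ε)⟩, by
    rw [EM_eq_regularNets]
    have hmem := regularNets.smooth_mul isRegularScale_univ (EcM.mem_regularNets_univ u)
      (SmoothFun.contDiff ψ)
    refine (congrArg (· ∈ regularNets Set.univ Ω) (funext₂ fun ε x => ?_)).mpr
      (regularNets.mono hmem le_top)
    exact mul_comm _ _⟩
  map_add' u v := Subtype.ext (funext fun ε => DFunLike.coe_injective (funext fun x =>
    add_mul (u.1 ε x) (v.1 ε x) (ψ.1 x)))
  map_smul' c u := Subtype.ext (funext fun ε => DFunLike.coe_injective (funext fun x =>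
    mul_assoc (c.1 ε) (u.1 ε x) (ψ.1 x)))

theorem EcM.smoothMul_apply (ψ : SmoothFun n) (u : EcM Ω) (ε : Idx) (x : Eu n) :
    (EcM.smoothMul ψ u).1 ε x = u.1 ε x * ψ.1 x := rfl

theorem EcM.ext_apply {u v : EcM Ω} (h : ∀ ε x, u.1 ε x = v.1 ε x) : u = v :=
  Subtype.ext (funext fun ε => DFunLike.coe_injective (funext (h ε)))

theorem EcM.smoothMul_eq_self {ψ : SmoothFun n} {u : EcM Ω}
    (h : ∀ ε, ∀ x ∈ tsupport (u.1 ε), ψ.1 x = 1) : EcM.smoothMul ψ u = u := by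
  refine EcM.ext_apply fun ε x => ?_
  rw [EcM.smoothMul_apply]
  by_cases hx : x ∈ tsupport (u.1 ε)
  · rw [h ε x hx, mul_one]
  · rw [image_eq_zero_of_notMem_tsupport hx, zero_mul]

theorem EcM.smoothMul_mem_Nc (ψ : SmoothFun n) {u : EcM Ω} (hu : u ∈ Nc Ω) :
    EcM.smoothMul ψ u ∈ Nc Ω := by
  refine ⟨fun ε => (contDiff_test _).contDiffOn, fun K hK hKΩ j => ?_⟩
  refine IsNegligible.of_le (IsModerate.mul_isNegligible
    (isModerate_const (2 ^ j * supNorm K j ψ.1)) (hu.2 K hK hKΩ j)) fun ε => ?_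
  rw [Real.norm_of_nonneg (supNorm_nonneg _)]
  refine le_trans (le_of_eq ?_) ((supNorm_mul_le isOpen_univ (SmoothFun.contDiffOn ψ _)
    (contDiff_test (u.1 ε)).contDiffOn hK (Set.subset_univ _) j).trans (le_abs_self _))
  exact congrArg (supNorm K j) (funext fun x => mul_comm _ _)

/-- Multiplication by a smooth function on `𝓖_c(Ω)`. -/
def Gc.smoothMul (ψ : SmoothFun n) : Gc Ω →ₗ[GenC] Gc Ω :=
  Gc.map (EcM.smoothMul ψ) fun _ hu => EcM.smoothMul_mem_Nc ψ hu

/-- The product `ψ F` of a functional with a smooth function, `(ψ F)(u) = F(ψ u)`. -/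
def Functional.smoothMul (ψ : SmoothFun n) (F : Functional Ω) : Functional Ω :=
  F ∘ₗ Gc.smoothMul ψ

theorem Functional.smoothMul_mk (ψ : SmoothFun n) (F : Functional Ω) (u : EcM Ω) :
    F.smoothMul ψ (Gc.mk u) = F (Gc.mk (EcM.smoothMul ψ u)) := rfl

theorem Functional.smoothMul_zero (F : Functional Ω) : F.smoothMul 0 = 0 := by
  refine LinearMap.ext (Gc.mk_surjective.forall.2 fun u => ?_)
  have hu : EcM.smoothMul 0 u = 0 := EcM.ext_apply fun ε x => mul_zero _
  rw [Functional.smoothMul_mk, hu]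
  exact map_zero F

theorem Functional.smoothMul_eq_add_smoothMul {ψ ψ' θ χ : SmoothFun n}
    (hχ : ∀ x, χ.1 x = ψ.1 x + θ.1 x * ψ'.1 x) (F : Functional Ω) :
    F.smoothMul χ = F.smoothMul ψ + (F.smoothMul ψ').smoothMul θ := by
  refine LinearMap.ext (Gc.mk_surjective.forall.2 fun u => ?_)
  have hu : EcM.smoothMul χ u =
      EcM.smoothMul ψ u + EcM.smoothMul ψ' (EcM.smoothMul θ u) := by
    refine EcM.ext_apply fun ε x => ?_
    change u.1 ε x * χ.1 x = u.1 ε x * ψ.1 x + u.1 ε x * θ.1 x * ψ'.1 x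
    rw [hχ, mul_add, mul_assoc]
  rw [Functional.smoothMul_mk, hu]
  exact map_add F (Gc.mk (EcM.smoothMul ψ u)) (Gc.mk (EcM.smoothMul ψ' (EcM.smoothMul θ u)))

theorem integrable_mul_test {g : Eu n → ℂ} (hg : ContDiffOn ℝ ∞ g Ω) (u : 𝓓(Ω, ℂ)) :
    Integrable fun x => g x * u x :=
  integrable_mul_of_tsupport_subset Ω.isOpen hg (contDiff_test u) u.hasCompactSupport
    u.tsupport_subset

theorem integral_sub_mul_test {g h : Eu n → ℂ} (hg : ContDiffOn ℝ ∞ g Ω) (hh : ContDiffOn ℝ ∞ h Ω)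
    (u : 𝓓(Ω, ℂ)) : ∫ x, (g x - h x) * u x = (∫ x, g x * u x) - ∫ x, h x * u x := by
  simp only [sub_mul]
  exact integral_sub (integrable_mul_test hg u) (integrable_mul_test hh u)

theorem isGivenBy_zero (hℛ : IsRegularScale ℛ) :
    IsGivenBy (regularNets ℛ) (0 : Functional Ω) :=
  ⟨_, regularNets.zero hℛ, fun u => by
    simp only [zero_mul, integral_zero]
    exact represents_zero⟩

theorem IsGivenBy.add (hℛ : IsRegularScale ℛ) (hF : IsGivenBy (regularNets ℛ) F)
    (hG : IsGivenBy (regularNets ℛ) G) : IsGivenBy (regularNets ℛ) (F + G) := by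
  obtain ⟨f, hf, hF⟩ := hF
  obtain ⟨g, hg, hG⟩ := hG
  refine ⟨_, regularNets.add hℛ hf hg, fun u =>
    ((hF u).add (hG u)).congr' (Eventually.of_forall fun ε => ?_)⟩
  simp only [add_mul]
  exact (integral_add (integrable_mul_test (hf.1 ε) _).integrableOn
    (integrable_mul_test (hg.1 ε) _).integrableOn).symm

theorem IsGivenBy.sub (hℛ : IsRegularScale ℛ) (hF : IsGivenBy (regularNets ℛ) F)
    (hG : IsGivenBy (regularNets ℛ) G) : IsGivenBy (regularNets ℛ) (F - G) := by
  obtain ⟨f, hf, hF⟩ := hF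
  obtain ⟨g, hg, hG⟩ := hG
  refine ⟨_, regularNets.sub hℛ hf hg, fun u =>
    ((hF u).sub (hG u)).congr' (Eventually.of_forall fun ε => ?_)⟩
  simp only [setIntegral_mul_test]
  exact (integral_sub_mul_test (hf.1 ε) (hg.1 ε) _).symm

theorem IsGivenBy.smoothMul (hℛ : IsRegularScale ℛ) (hF : IsGivenBy (regularNets ℛ) F)
    (ψ : SmoothFun n) : IsGivenBy (regularNets ℛ) (F.smoothMul ψ) := by
  obtain ⟨f, hf, hF⟩ := hF
  refine ⟨_, regularNets.smooth_mul hℛ hf (SmoothFun.contDiff ψ), fun u =>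
    (hF (EcM.smoothMul ψ u)).congr' (Eventually.of_forall fun ε =>
      integral_congr_ae (Eventually.of_forall fun x => ?_))⟩
  simp only [EcM.smoothMul_apply]
  ring

theorem IsGivenBy.smoothMul_of_restrict (hℛ : IsRegularScale ℛ) {h : V ≤ Ω}
    (hF : IsGivenBy (regularNets ℛ) (F.restrict h)) {ψ : SmoothFun n} (hc : HasCompactSupport ψ.1)
    (hs : tsupport ψ.1 ⊆ V) : IsGivenBy (regularNets ℛ) (F.smoothMul ψ) := by
  obtain ⟨f, hf, hF⟩ := hF
  refine ⟨_, regularNets.cutoff_mul hℛ hf (SmoothFun.contDiff ψ) hc hs, fun u => ?_⟩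
  let ψu : EcM V := EcM.ofSmooth (fun ε => SmoothFun.ofTest ((EcM.smoothMul ψ u).1 ε)) hc hs
    (fun ε => tsupport_mul_subset_right) (EcM.mem_regularNets_univ (EcM.smoothMul ψ u))
  refine (hF ψu).congr' (Eventually.of_forall fun ε => ?_)
  beta_reduce
  rw [setIntegral_mul_test, setIntegral_mul_test]
  refine integral_congr_ae (Eventually.of_forall fun x => ?_)
  change f ε x * (u.1 ε x * ψ.1 x) = ψ.1 x * f ε x * u.1 ε x
  ring

theorem exists_isGivenBy_smoothMul_of_disjoint_singSupp (hℛ : IsRegularScale ℛ) {A : Set (Eu n)}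
    (hA : IsCompact A) (hAΩ : A ⊆ Ω) (hsing : Disjoint A (singSupp (regularNets ℛ) F)) :
    ∃ ψ : SmoothFun n, (∀ x ∈ A, ψ.1 x = 1) ∧ IsGivenBy (regularNets ℛ) (F.smoothMul ψ) := by
  refine hA.induction_on (p := fun A => ∃ ψ : SmoothFun n, (∀ x ∈ A, ψ.1 x = 1) ∧
    IsGivenBy (regularNets ℛ) (F.smoothMul ψ)) ?_ ?_ ?_ ?_
  · refine ⟨0, fun x hx => hx.elim, ?_⟩
    rw [Functional.smoothMul_zero]
    exact isGivenBy_zero hℛ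
  · rintro s t hst ⟨ψ, hψ, hF⟩
    exact ⟨ψ, fun x hx => hψ x (hst hx), hF⟩
  · rintro s t ⟨ψ, hψ, hF⟩ ⟨ψ', hψ', hF'⟩
    let θ : SmoothFun n := ⟨fun x => 1 - ψ.1 x, contDiff_const.sub (SmoothFun.contDiff ψ)⟩
    let χ : SmoothFun n := ⟨fun x => ψ.1 x + θ.1 x * ψ'.1 x,
      (SmoothFun.contDiff ψ).add ((SmoothFun.contDiff θ).mul (SmoothFun.contDiff ψ'))⟩
    refine ⟨χ, fun x hx => ?_, ?_⟩
    · change ψ.1 x + (1 - ψ.1 x) * ψ'.1 x = 1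
      rcases hx with hx | hx
      · rw [hψ x hx]; ring
      · rw [hψ' x hx]; ring
    · rw [Functional.smoothMul_eq_add_smoothMul (χ := χ) fun _ => rfl]
      exact hF.add hℛ (hF'.smoothMul hℛ θ)
  · intro x hx
    obtain ⟨V, hV, hxV, hF⟩ : ∃ (V : Opens (Eu n)) (h : V ≤ Ω), x ∈ V ∧
        IsGivenBy (regularNets ℛ) (F.restrict h) := by
      by_contra h
      exact Set.disjoint_left.1 hsing hx ⟨hAΩ hx, h⟩
    obtain ⟨r, hr, hrV⟩ := Metric.isOpen_iff.1 V.isOpen x hxV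
    obtain ⟨ψ, hψ, hs⟩ := exists_smooth_eq_one_tsupport_subset x (r := r / 3) (R := r / 2)
      (by positivity) (by linarith)
    exact ⟨Metric.closedBall x (r / 3), mem_nhdsWithin_of_mem_nhds
      (Metric.closedBall_mem_nhds x (by positivity)), ψ, hψ, hF.smoothMul_of_restrict hℛ
      ((isCompact_closedBall _ _).of_isClosed_subset (isClosed_tsupport _) hs)
      (hs.trans ((Metric.closedBall_subset_ball (by linarith)).trans hrV))⟩

theorem IsBasic.exists_isDominatedNet {T : Functional Ω} (hT : IsBasic T) (χ : 𝓓(Ω, ℂ)) :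
    ∃ (S : Idx → SmoothFun n →ₗ[ℂ] ℂ) (j N : ℕ) (c : ℝ), IsDominatedNet S (tsupport χ) j N c ∧
      ∀ u : EcM Ω, Represents (fun ε => S ε (SmoothFun.ofTest (u.1 ε)))
        (T.smoothMul (SmoothFun.ofTest χ) (Gc.mk u)) := by
  obtain ⟨-, Tn, hTn, hrep⟩ := hT
  obtain ⟨S, j, N, c, hS, hST⟩ := hTn.exists_isDominatedNet_cutoff χ
  refine ⟨S, j, N, c, hS, fun u =>
    (hrep (EcM.smoothMul (SmoothFun.ofTest χ) u)).congr' (hST.mono fun ε hε => ?_)⟩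
  beta_reduce
  rw [hε]
  exact congrArg (Tn ε) (DFunLike.coe_injective (funext fun x => mul_comm _ _))

end Localization

theorem EcM.coe_transposeOp_apply_eq_zero {Ω : Opens (Eu n)} {P : MvPolynomial (Fin n) GenC}
    {u : EcM Ω} {ε : Idx} {x : Eu n} (hx : x ∉ tsupport (u.1 ε)) :
    (EcM.transposeOp P u).1 ε x = 0 := by
  rw [EcM.coe_transposeOp, coe_testTransposeOp]
  exact image_eq_zero_of_notMem_tsupport fun h => hx (tsupport_transposeOp_subset _ _ h)

-- With `ψ = 1` on the annulus `ρ ≤ |x| ≤ R`, the part `(1 - φ) F` of the parametrix that is cut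
-- off agrees there with `(1 - φ) ψ F`, which is regular.
theorem exists_isGivenBy_applyOp_smoothMul_sub_delta {ℛ : Set (ℕ → ℕ)} (hℛ : IsRegularScale ℛ)
    {P : MvPolynomial (Fin n) GenC} {F : Functional (⊤ : Opens (Eu n))}
    (hpar : IsParametrix (regularNets ℛ) P F) (hsing : singSupp (regularNets ℛ) F ⊆ {0})
    {φ : SmoothFun n} {ρ : ℝ} (hρ : 0 < ρ)
    (hφ : ∀ x ∈ Metric.closedBall (0 : Eu n) ρ, φ.1 x = 1) (R : ℝ) :
    ∃ H : Functional (⊤ : Opens (Eu n)), IsGivenBy (regularNets ℛ) H ∧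
      ∀ w : EcM (⊤ : Opens (Eu n)), (∀ ε, tsupport (w.1 ε) ⊆ Metric.closedBall 0 R) →
        applyOp P (F.smoothMul φ) (Gc.mk w) - delta n (Gc.mk w) = H (Gc.mk w) := by
  have hdisj : Disjoint (Metric.closedBall (0 : Eu n) R \ Metric.ball 0 ρ)
      (singSupp (regularNets ℛ) F) := Set.disjoint_left.2 fun x hx hx' => hx.2 (by
    rw [Set.mem_singleton_iff.1 (hsing hx')]
    exact Metric.mem_ball_self hρ)
  obtain ⟨ψ, hψ, hFψ⟩ := exists_isGivenBy_smoothMul_of_disjoint_singSupp hℛ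
    ((isCompact_closedBall _ _).diff Metric.isOpen_ball) (Set.subset_univ _) hdisj
  let θ : SmoothFun n := ⟨fun x => 1 - φ.1 x, contDiff_const.sub (SmoothFun.contDiff φ)⟩
  refine ⟨(applyOp P F - delta n) - applyOp P ((F.smoothMul ψ).smoothMul θ),
    IsGivenBy.sub hℛ hpar ((hFψ.smoothMul hℛ θ).applyOp hℛ P), fun w hw => ?_⟩
  have hcut : EcM.smoothMul φ (EcM.transposeOp P w) = EcM.transposeOp P w -
      EcM.smoothMul ψ (EcM.smoothMul θ (EcM.transposeOp P w)) := by
    refine EcM.ext_apply fun ε x => ?_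
    change (EcM.transposeOp P w).1 ε x * φ.1 x = (EcM.transposeOp P w).1 ε x -
      (EcM.transposeOp P w).1 ε x * (1 - φ.1 x) * ψ.1 x
    by_cases hxρ : x ∈ Metric.closedBall (0 : Eu n) ρ
    · rw [hφ x hxρ]; ring
    by_cases hxR : x ∈ Metric.closedBall (0 : Eu n) R
    · rw [hψ x ⟨hxR, fun h => hxρ (Metric.ball_subset_closedBall h)⟩]; ring
    · rw [EcM.coe_transposeOp_apply_eq_zero fun h => hxR (hw ε h)]; ring
  have hFcut : F (Gc.mk (EcM.smoothMul φ (EcM.transposeOp P w))) = F (Gc.mk (EcM.transposeOp P w)) -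
      F (Gc.mk (EcM.smoothMul ψ (EcM.smoothMul θ (EcM.transposeOp P w)))) :=
    (congrArg (fun v => F (Gc.mk v)) hcut).trans (map_sub F (Gc.mk (EcM.transposeOp P w))
      (Gc.mk (EcM.smoothMul ψ (EcM.smoothMul θ (EcM.transposeOp P w)))))
  simp only [LinearMap.sub_apply, applyOp_mk, Functional.smoothMul_mk, hFcut]
  ring

/-! ### Hypoellipticity from a parametrix -/

section Convolution

variable {S : SmoothFun n →ₗ[ℂ] ℂ} {K : Set (Eu n)} {j : ℕ} {C : ℝ}

theorem DominatedBy.apply_eq_zero (hS : DominatedBy S K j C) {f : SmoothFun n}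
    (h : Disjoint K (tsupport f.1)) : S f = 0 := by
  have hzero : supNorm K j f.1 = 0 := by
    refine le_antisymm (supNorm_le le_rfl fun x hx i _ => ?_) (supNorm_nonneg _)
    refine (norm_eq_zero.2 (Function.notMem_support.1 fun hxi => ?_)).le
    exact Set.disjoint_left.1 h hx (support_iteratedFDeriv_subset i hxi)
  have hSf := hS f
  rw [hzero, mul_zero] at hSf
  exact norm_le_zero_iff.1 hSf

theorem DominatedBy.tsupport_correlation_subset_closedBall {r s : ℝ} (hS : DominatedBy S K j C)
    (hK : K ⊆ Metric.closedBall 0 r) {u : SmoothFun n} {x : Eu n}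
    (hu : tsupport u.1 ⊆ Metric.closedBall x s) :
    tsupport (correlation S u) ⊆ Metric.closedBall x (r + s) := by
  refine closure_minimal (fun y hy => ?_) Metric.isClosed_closedBall
  by_contra h
  refine hy (hS.apply_eq_zero (Set.disjoint_left.2 fun z hzK hz => h ?_))
  have hzr := mem_closedBall_zero_iff.1 (hK hzK)
  have hzs := mem_closedBall_iff_norm.1 (hu (SmoothFun.mem_tsupport_translate hz))
  rw [mem_closedBall_iff_norm]
  calc ‖y - x‖ = ‖(y + z - x) - z‖ := by congr 1; abel
    _ ≤ ‖y + z - x‖ + ‖z‖ := norm_sub_le _ _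
    _ ≤ r + s := by linarith

theorem correlation_integralAgainst_comm {a b : SmoothFun n} (ha : HasCompactSupport a.1)
    (hb : HasCompactSupport b.1) (y : Eu n) :
    correlation (integralAgainst a.1 (SmoothFun.contDiff a).continuous ha) b y =
      correlation (integralAgainst b.1 (SmoothFun.contDiff b).continuous hb) a (-y) := by
  change ∫ z, a.1 z * b.1 (y + z) = ∫ z, b.1 z * a.1 (-y + z)
  rw [← integral_add_left_eq_self (fun z => b.1 z * a.1 (-y + z)) y]
  refine integral_congr_ae (Eventually.of_forall fun z => ?_)
  simp only [neg_add_cancel_left, mul_comm]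

theorem apply_correlation_integralAgainst (hS : S ∈ compactDistributions n) {a u : SmoothFun n}
    (ha : HasCompactSupport a.1) (hu : HasCompactSupport u.1) :
    S (SmoothFun.correlation (integralAgainst_mem_compactDistributions
      (SmoothFun.contDiff a).continuous ha) u) =
      ∫ x, u.1 x * correlation (S ∘ₗ SmoothFun.reflect) a x := by
  rw [integral_mul_correlation (comp_reflect_mem_compactDistributions hS)
    (SmoothFun.contDiff u).continuous hu a]
  exact congrArg S (Subtype.ext (funext fun y => correlation_integralAgainst_comm ha hu y))

theorem integral_mul_correlation_comm (hS : S ∈ compactDistributions n) {g u : SmoothFun n}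
    (hg : HasCompactSupport g.1) (hu : HasCompactSupport u.1) :
    ∫ x, g.1 x * correlation S u x = ∫ x, u.1 x * correlation (S ∘ₗ SmoothFun.reflect) g x :=
  (integral_mul_correlation hS (SmoothFun.contDiff g).continuous hg u).trans
    (apply_correlation_integralAgainst hS hg hu)

/-- The error `Q(D) S - δ - a` of `S` as a parametrix of `Q(D)` with smooth remainder `a`. -/
def parametrixError (Q : MvPolynomial (Fin n) ℂ) (S : SmoothFun n →ₗ[ℂ] ℂ) (a : SmoothFun n)
    (ha : HasCompactSupport a.1) : SmoothFun n →ₗ[ℂ] ℂ :=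
  S ∘ₗ SmoothFun.transposeOp Q - evalZero n -
    integralAgainst a.1 (SmoothFun.contDiff a).continuous ha

theorem parametrixError_mem_compactDistributions (hS : S ∈ compactDistributions n)
    (Q : MvPolynomial (Fin n) ℂ) {a : SmoothFun n} (ha : HasCompactSupport a.1) :
    parametrixError Q S a ha ∈ compactDistributions n :=
  sub_mem (sub_mem (comp_transposeOp_mem_compactDistributions hS Q)
    evalZero_mem_compactDistributions) (integralAgainst_mem_compactDistributions _ ha)

theorem correlation_parametrixError (hS : S ∈ compactDistributions n)
    (Q : MvPolynomial (Fin n) ℂ) {a : SmoothFun n} (ha : HasCompactSupport a.1) (u : SmoothFun n) :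
    SmoothFun.correlation (parametrixError_mem_compactDistributions hS Q ha) u =
      SmoothFun.transposeOp Q (SmoothFun.correlation hS u) - u -
        SmoothFun.correlation (integralAgainst_mem_compactDistributions
          (SmoothFun.contDiff a).continuous ha) u := by
  rw [SmoothFun.transposeOp_correlation]
  refine Subtype.ext (funext fun y => ?_)
  change S (SmoothFun.transposeOp Q (SmoothFun.translate y u)) - u.1 (y + 0) - _ =
    S (SmoothFun.translate y (SmoothFun.transposeOp Q u)) - u.1 y - _
  rw [SmoothFun.translate_transposeOp, add_zero]
  rfl

end Convolution

theorem regularNets.exists_hasCompactSupport {ℛ : Set (ℕ → ℕ)} (hℛ : IsRegularScale ℛ)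
    {V : Opens (Eu n)} {g : Idx → Eu n → ℂ} (hg : g ∈ regularNets ℛ V) {x : Eu n} {r R : ℝ}
    (hr : 0 < r) (hrR : r < R) (hV : Metric.closedBall x R ⊆ V) :
    ∃ q : Idx → SmoothFun n, (∀ ε, HasCompactSupport (q ε).1) ∧
      (fun ε => (q ε).1) ∈ regularNets ℛ (⊤ : Opens (Eu n)) ∧
      ∀ ε, ∀ v : Eu n → ℂ, tsupport v ⊆ Metric.closedBall x r →
        ∫ y, (q ε).1 y * v y = ∫ y, g ε y * v y := by
  obtain ⟨χ, hχ, hχs⟩ := exists_smooth_eq_one_tsupport_subset x hr hrR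
  have hχc : HasCompactSupport χ.1 :=
    (isCompact_closedBall _ _).of_isClosed_subset (isClosed_tsupport _) hχs
  refine ⟨fun ε => ⟨fun y => χ.1 y * g ε y, contDiff_cutoff_mul V.isOpen (SmoothFun.contDiff χ)
    (hχs.trans hV) (hg.1 ε)⟩, fun ε => hχc.mul_right,
    regularNets.cutoff_mul hℛ hg (SmoothFun.contDiff χ) hχc (hχs.trans hV), fun ε v hv => ?_⟩
  refine integral_congr_ae (Eventually.of_forall fun y => ?_)
  by_cases hy : y ∈ tsupport v
  · simp only [hχ y (hv hy), one_mul]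
  · simp only [image_eq_zero_of_notMem_tsupport hy, mul_zero]

theorem IsBasic.exists_isDominatedNet_closedBall {Ω : Opens (Eu n)} {T : Functional Ω}
    (hT : IsBasic T) {x : Eu n} {r R : ℝ} (hr : 0 < r) (hrR : r < R)
    (hΩ : Metric.closedBall x R ⊆ Ω) :
    ∃ (S : Idx → SmoothFun n →ₗ[ℂ] ℂ) (K : Set (Eu n)) (j N : ℕ) (c : ℝ),
      IsDominatedNet S K j N c ∧ K ⊆ Metric.closedBall x R ∧
      ∀ u : EcM Ω, (∀ ε, tsupport (u.1 ε) ⊆ Metric.closedBall x r) →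
        Represents (fun ε => S ε (SmoothFun.ofTest (u.1 ε))) (T (Gc.mk u)) := by
  obtain ⟨χ, hχ, hχs⟩ := exists_smooth_eq_one_tsupport_subset x hr hrR
  obtain ⟨S, j, N, c, hS, hST⟩ := hT.exists_isDominatedNet
    (SmoothFun.toTest χ (isCompact_closedBall x R) hΩ hχs)
  refine ⟨S, _, j, N, c, hS, hχs, fun u hu => ?_⟩
  have hχu : EcM.smoothMul χ u = u := EcM.smoothMul_eq_self fun ε y hy => hχ y (hu ε hy)
  have hTu : T.smoothMul χ (Gc.mk u) = T (Gc.mk u) := congrArg (fun w => T (Gc.mk w)) hχu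
  exact hTu ▸ hST u

section TransposedNets

variable {Ω : Opens (Eu n)} {P : MvPolynomial (Fin n) GenC}

theorem ofTest_transposeOp (u : EcM Ω) (ε : Idx) :
    SmoothFun.ofTest ((EcM.transposeOp P u).1 ε) =
      SmoothFun.transposeOp (polyNet P ε) (SmoothFun.ofTest (u.1 ε)) := by
  refine Subtype.ext ?_
  change ((EcM.transposeOp P u).1 ε : Eu n → ℂ) = _
  rw [EcM.coe_transposeOp, coe_testTransposeOp, SmoothFun.coe_transposeOp]
  rfl

theorem represents_applyOp {T : Functional Ω} {Q : Idx → SmoothFun n →ₗ[ℂ] ℂ} {A : Set (Eu n)}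
    (hQ : ∀ u : EcM Ω, (∀ ε, tsupport (u.1 ε) ⊆ A) →
      Represents (fun ε => Q ε (SmoothFun.ofTest (u.1 ε))) (T (Gc.mk u)))
    {u : EcM Ω} (hu : ∀ ε, tsupport (u.1 ε) ⊆ A) :
    Represents (fun ε => Q ε (SmoothFun.transposeOp (polyNet P ε) (SmoothFun.ofTest (u.1 ε))))
      (applyOp P T (Gc.mk u)) := by
  rw [applyOp_mk]
  simp only [← ofTest_transposeOp]
  refine hQ _ fun ε => ?_
  rw [EcM.coe_transposeOp, coe_testTransposeOp]
  exact (tsupport_transposeOp_subset _ _).trans (hu ε)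

end TransposedNets

/-- A parametrix of `P(D)` near the origin on the level of representatives: a moderate net of
distributions `S_ε` supported in the ball of radius `ρ` and a regular net of test functions `a_ε`,
such that `P_ε(D) S_ε - δ - a_ε` is negligible on the test nets supported in the ball of
radius `R`. -/
structure LocalParametrix (ℛ : Set (ℕ → ℕ)) (P : MvPolynomial (Fin n) GenC) (ρ R : ℝ) where
  net : Idx → SmoothFun n →ₗ[ℂ] ℂ
  carrier : Set (Eu n)
  carrier_subset : carrier ⊆ Metric.closedBall 0 ρ
  isDominatedNet : ∃ (j N : ℕ) (c : ℝ), IsDominatedNet net carrier j N c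
  remainder : Idx → SmoothFun n
  hasCompactSupport_remainder : ∀ ε, HasCompactSupport (remainder ε).1
  remainder_mem : (fun ε => (remainder ε).1) ∈ regularNets ℛ (⊤ : Opens (Eu n))
  isNegligible_error : ∀ w : EcM (⊤ : Opens (Eu n)),
    (∀ ε, tsupport (w.1 ε) ⊆ Metric.closedBall 0 R) →
      IsNegligible fun ε => parametrixError (polyNet P ε) (net ε) (remainder ε)
        (hasCompactSupport_remainder ε) (SmoothFun.ofTest (w.1 ε))

section LocalParametrices

variable {ℛ : Set (ℕ → ℕ)} {P : MvPolynomial (Fin n) GenC} {ρ R : ℝ}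

theorem nonempty_localParametrix (hℛ : IsRegularScale ℛ) {F : Functional (⊤ : Opens (Eu n))}
    (hF : IsBasic F) (hpar : IsParametrix (regularNets ℛ) P F)
    (hsing : singSupp (regularNets ℛ) F ⊆ {0}) (hρ : 0 < ρ) (hR : 0 < R) :
    Nonempty (LocalParametrix ℛ P ρ R) := by
  obtain ⟨φ, hφ, hφs⟩ := exists_smooth_eq_one_tsupport_subset (0 : Eu n) (half_pos hρ)
    (half_lt_self hρ)
  obtain ⟨H, ⟨κ, hκ, hκH⟩, hH⟩ :=
    exists_isGivenBy_applyOp_smoothMul_sub_delta hℛ hpar hsing (half_pos hρ) hφ R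
  obtain ⟨S, j, N, c, hS, hSF⟩ := hF.exists_isDominatedNet
    (SmoothFun.toTest φ (isCompact_closedBall 0 ρ) (Set.subset_univ _) hφs)
  obtain ⟨a, hac, ha, haκ⟩ := regularNets.exists_hasCompactSupport hℛ hκ hR (lt_add_one R)
    (Set.subset_univ (Metric.closedBall 0 _))
  refine ⟨⟨S, _, hφs, ⟨j, N, c, hS⟩, a, hac, ha, fun w hw => ?_⟩⟩
  have hrep := (represents_applyOp (P := P) (fun u _ => hSF u)
    (fun ε => Set.subset_univ (tsupport (w.1 ε)))).sub (represents_delta w)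
  refine (hrep.isNegligible_sub ((hH w hw).symm ▸ hκH w)).congr' (Eventually.of_forall fun ε => ?_)
  beta_reduce
  rw [setIntegral_mul_test, ← haκ ε _ (hw ε)]
  rfl

namespace LocalParametrix

variable (p : LocalParametrix ℛ P ρ R)

theorem net_mem (ε : Idx) : p.net ε ∈ compactDistributions n := by
  obtain ⟨j, N, c, h⟩ := p.isDominatedNet
  exact h.mem_compactDistributions ε

/-- The correlations `y ↦ S_ε (u_ε(y + ·))` of a net of smooth functions with a local
parametrix. -/
def correlationNet (u : Idx → SmoothFun n) (ε : Idx) : SmoothFun n :=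
  SmoothFun.correlation (p.net_mem ε) (u ε)

theorem tsupport_correlationNet_subset {u : Idx → SmoothFun n} {x : Eu n} {s : ℝ} {ε : Idx}
    (hu : tsupport (u ε).1 ⊆ Metric.closedBall x s) :
    tsupport (p.correlationNet u ε).1 ⊆ Metric.closedBall x (ρ + s) := by
  obtain ⟨j, N, c, h⟩ := p.isDominatedNet
  exact (h.dominatedBy ε).tsupport_correlation_subset_closedBall p.carrier_subset hu

theorem correlationNet_mem {𝒮 : Set (ℕ → ℕ)} (h𝒮 : IsRegularScale 𝒮) {u : Idx → SmoothFun n}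
    (hu : (fun ε => (u ε).1) ∈ regularNets 𝒮 (⊤ : Opens (Eu n))) :
    (fun ε => (p.correlationNet u ε).1) ∈ regularNets 𝒮 (⊤ : Opens (Eu n)) := by
  obtain ⟨j, N, c, h⟩ := p.isDominatedNet
  exact h.correlation_mem h𝒮 hu

theorem isNegligible_apply_transposeOp_correlationNet {Q : Idx → SmoothFun n →ₗ[ℂ] ℂ}
    {K : Set (Eu n)} {j N : ℕ} {c : ℝ} (hQ : IsDominatedNet Q K j N c) {x : Eu n} {s t : ℝ}
    (hK : K ⊆ Metric.closedBall x s) (hst : s + t ≤ R) (u : EcM (⊤ : Opens (Eu n)))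
    (hu : ∀ ε, tsupport (u.1 ε) ⊆ Metric.closedBall x t) :
    IsNegligible fun ε => Q ε (SmoothFun.transposeOp (polyNet P ε)
      (p.correlationNet (fun ε => SmoothFun.ofTest (u.1 ε)) ε)) - Q ε (SmoothFun.ofTest (u.1 ε)) -
        ∫ y, u.1 ε y * correlation (Q ε ∘ₗ SmoothFun.reflect) (p.remainder ε) y := by
  have herr := fun ε => parametrixError_mem_compactDistributions (p.net_mem ε) (polyNet P ε)
    (p.hasCompactSupport_remainder ε)
  have hneg : IsNegligible fun ε =>
      Q ε (SmoothFun.correlation (herr ε) (SmoothFun.ofTest (u.1 ε))) := by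
    refine hQ.isNegligible (isNegligible_supNorm_correlation herr hQ.isCompact
      (isCompact_closedBall (0 : Eu n) R) p.isNegligible_error j u fun ε y hy z hz => ?_)
    have hys := mem_closedBall_iff_norm.1 (hK hy)
    have hyz := mem_closedBall_iff_norm.1 (hu ε hz)
    rw [mem_closedBall_zero_iff]
    calc ‖z‖ = ‖(y + z - x) - (y - x)‖ := by congr 1; abel
      _ ≤ ‖y + z - x‖ + ‖y - x‖ := norm_sub_le _ _
      _ ≤ R := by linarith
  refine hneg.congr' (Eventually.of_forall fun ε => ?_)
  beta_reduce
  rw [correlation_parametrixError, map_sub, map_sub, apply_correlation_integralAgainst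
    (u := SmoothFun.ofTest (u.1 ε)) (hQ.mem_compactDistributions ε) _ (u.1 ε).hasCompactSupport]
  rfl

end LocalParametrix

theorem LocalParametrix.isGivenBy_restrict (p : LocalParametrix ℛ P ρ (4 * ρ)) (hρ : 0 < ρ)
    (hℛ : IsRegularScale ℛ) {Ω V W : Opens (Eu n)} {hV : V ≤ Ω} {T : Functional Ω}
    (hT : IsBasic T) (hPT : IsGivenBy (regularNets ℛ) ((applyOp P T).restrict hV)) {x₀ : Eu n}
    (hball : Metric.closedBall x₀ (3 * ρ) ⊆ V) (hWΩ : W ≤ Ω)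
    (hW : (W : Set (Eu n)) ⊆ Metric.closedBall x₀ ρ) :
    IsGivenBy (regularNets ℛ) (T.restrict hWΩ) := by
  obtain ⟨g, hg, hgT⟩ := hPT
  obtain ⟨i, M, C, hS⟩ := p.isDominatedNet
  obtain ⟨Q, K, j, N, c, hQ, hK, hTQ⟩ := hT.exists_isDominatedNet_closedBall (x := x₀)
    (r := 2 * ρ) (R := 3 * ρ) (by positivity) (by linarith) fun x hx => hV (hball hx)
  obtain ⟨q, hqc, hq, hqg⟩ := regularNets.exists_hasCompactSupport hℛ hg (x := x₀)
    (r := 2 * ρ) (R := 3 * ρ) (by positivity) (by linarith) hball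
  have hSq := hS.comp_reflect.correlation_mem hℛ hq
  have hQa := hQ.comp_reflect.correlation_mem hℛ p.remainder_mem
  refine ⟨_, regularNets.mono (regularNets.sub hℛ hSq hQa) le_top, fun u => ?_⟩
  let f : Idx → SmoothFun n := fun ε => SmoothFun.ofTest (u.1 ε)
  have hus : ∀ ε, tsupport (u.1 ε) ⊆ Metric.closedBall x₀ ρ := fun ε =>
    (u.1 ε).tsupport_subset.trans hW
  have hvs : ∀ ε, tsupport (p.correlationNet f ε).1 ⊆ Metric.closedBall x₀ (2 * ρ) := fun ε =>
    (two_mul ρ).symm ▸ p.tsupport_correlationNet_subset (hus ε)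
  let v : EcM V := EcM.ofSmooth (p.correlationNet f) (isCompact_closedBall x₀ (2 * ρ))
    ((Metric.closedBall_subset_closedBall (by linarith)).trans hball) hvs
    (p.correlationNet_mem isRegularScale_univ (EcM.mem_regularNets_univ u))
  have hPv : IsNegligible fun ε => Q ε (SmoothFun.transposeOp (polyNet P ε)
      (p.correlationNet f ε)) - ∫ x in V, g ε x * v.1 ε x :=
    (represents_applyOp (P := P) hTQ (u := EcM.extend hV v) hvs).isNegligible_sub (hgT v)
  have herr : IsNegligible fun ε => Q ε (SmoothFun.transposeOp (polyNet P ε)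
      (p.correlationNet f ε)) - Q ε (f ε) -
        ∫ y, u.1 ε y * correlation (Q ε ∘ₗ SmoothFun.reflect) (p.remainder ε) y :=
    p.isNegligible_apply_transposeOp_correlationNet hQ hK (by linarith) (EcM.extend le_top u) hus
  refine (hTQ (EcM.extend hWΩ u) fun ε => (hus ε).trans
    (Metric.closedBall_subset_closedBall (by linarith))).of_isNegligible_sub
      ((hPv.sub herr).congr' (Eventually.of_forall fun ε => ?_))
  have hgv : ∫ x, g ε x * v.1 ε x =
      ∫ x, u.1 ε x * correlation (p.net ε ∘ₗ SmoothFun.reflect) (q ε) x :=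
    (hqg ε _ (hvs ε)).symm.trans (integral_mul_correlation_comm (p.net_mem ε) (hqc ε)
      (u := SmoothFun.ofTest (u.1 ε)) (u.1 ε).hasCompactSupport)
  beta_reduce
  rw [setIntegral_mul_test, setIntegral_mul_test, hgv, integral_sub_mul_test
    ((regularNets.mono hSq le_top).1 ε) ((regularNets.mono hQa le_top).1 ε)]
  simp only [mul_comm _ (u.1 ε _)]
  change _ = Q ε (f ε) - _
  ring

end LocalParametrices

theorem singSupp_subset_of_isParametrix {ℛ : Set (ℕ → ℕ)} (hℛ : IsRegularScale ℛ)
    {P : MvPolynomial (Fin n) GenC} {F : Functional (⊤ : Opens (Eu n))} (hF : IsBasic F)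
    (hpar : IsParametrix (regularNets ℛ) P F) (hsing : singSupp (regularNets ℛ) F ⊆ {0})
    {Ω : Opens (Eu n)} {T : Functional Ω} (hT : IsBasic T) :
    singSupp (regularNets ℛ) T ⊆ singSupp (regularNets ℛ) (applyOp P T) := by
  rintro x₀ ⟨hx₀, hTx₀⟩
  refine ⟨hx₀, fun ⟨V, hV, hx₀V, hPT⟩ => hTx₀ ?_⟩
  obtain ⟨r, hr, hrV⟩ := Metric.nhds_basis_closedBall.mem_iff.1 (V.isOpen.mem_nhds hx₀V)
  obtain ⟨p⟩ := nonempty_localParametrix (ρ := r / 3) (R := 4 * (r / 3)) hℛ hF hpar hsing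
    (by positivity) (by positivity)
  have hball : Metric.closedBall x₀ (3 * (r / 3)) ⊆ V := by rwa [mul_div_cancel₀ r three_ne_zero]
  have hWV : Metric.ball x₀ (r / 3) ⊆ V := Metric.ball_subset_closedBall.trans
    ((Metric.closedBall_subset_closedBall (by linarith)).trans hrV)
  let W : Opens (Eu n) := ⟨Metric.ball x₀ (r / 3), Metric.isOpen_ball⟩
  exact ⟨W, fun y hy => hV (hWV hy), Metric.mem_ball_self (by positivity),
    p.isGivenBy_restrict (by positivity) hℛ hT hPT hball _ Metric.ball_subset_closedBall⟩

theorem singSupp_delta_subset {ℛ : Set (ℕ → ℕ)} (hℛ : IsRegularScale ℛ) :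
    singSupp (regularNets ℛ) (delta n) ⊆ {0} := by
  rintro x ⟨-, hx⟩
  by_contra hx0
  refine hx ⟨⟨{0}ᶜ, isOpen_compl_singleton⟩, le_top, hx0, _, regularNets.zero hℛ, fun u => ?_⟩
  rw [restrict_mk]
  refine (represents_delta _).congr' (Eventually.of_forall fun ε => ?_)
  simp only [zero_mul, integral_zero]
  exact image_eq_zero_of_notMem_tsupport fun h => (u.1 ε).tsupport_subset h rfl

theorem mainTheorem2_general {P : MvPolynomial (Fin n) GenC}
    (hP : ∃ ξ : Eu n, IsUnit (tildeFn P ξ)) {ℛ : Set (ℕ → ℕ)} (hℛ : IsRegularScale ℛ) :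
    List.TFAE [
      IsHypoelliptic (regularNets ℛ) P,
      ∃ E : Functional (⊤ : Opens (Eu n)),
        IsBasic E ∧ IsFundamentalSolution P E ∧ singSupp (regularNets ℛ) E ⊆ {0},
      ∃ F : Functional (⊤ : Opens (Eu n)),
        IsBasic F ∧ IsParametrix (regularNets ℛ) P F ∧ singSupp (regularNets ℛ) F ⊆ {0}] := by
  tfae_have 1 → 2 := by
    intro hypo
    obtain ⟨E, hE, hPE⟩ := exists_isBasic_isFundamentalSolution hP
    refine ⟨E, hE, hPE, ?_⟩
    rw [← hypo ⊤ E hE, show applyOp P E = delta n from hPE]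
    exact singSupp_delta_subset hℛ
  tfae_have 2 → 3 := by
    rintro ⟨E, hE, hPE, hsing⟩
    refine ⟨E, hE, ?_, hsing⟩
    rw [IsParametrix, show applyOp P E = delta n from hPE, sub_self]
    exact isGivenBy_zero hℛ
  tfae_have 3 → 1 := by
    rintro ⟨F, hF, hpar, hsing⟩ Ω T hT
    exact (singSupp_applyOp_subset hℛ T P).antisymm
      (singSupp_subset_of_isParametrix hℛ hF hpar hsing hT)
  tfae_finish

end Colombeau

end

open Colombeau in
theorem mainTheorem2 (n : ℕ) (P : MvPolynomial (Fin n) GenC)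
    (hP : ∃ ξ : Eu n, IsUnit (tildeFn P ξ)) :
    List.TFAE [
      IsHypoelliptic EM P,
      ∃ E : Functional (⊤ : Opens (Eu n)),
        IsBasic E ∧ IsFundamentalSolution P E ∧ singSupp EM E ⊆ {0},
      ∃ F : Functional (⊤ : Opens (Eu n)),
        IsBasic F ∧ IsParametrix EM P F ∧ singSupp EM F ⊆ {0}] ∧
    List.TFAE [
      IsHypoelliptic EMinf P,
      ∃ E : Functional (⊤ : Opens (Eu n)),
        IsBasic E ∧ IsFundamentalSolution P E ∧ singSupp EMinf E ⊆ {0},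
      ∃ F : Functional (⊤ : Opens (Eu n)),
        IsBasic F ∧ IsParametrix EMinf P F ∧ singSupp EMinf F ⊆ {0}] := by
  rw [EM_eq_regularNets, EMinf_eq_regularNets]
  exact ⟨mainTheorem2_general hP isRegularScale_univ,
    mainTheorem2_general hP isRegularScale_range_const⟩
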